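/- **Code.** Let $k_1,k_2\ge 2$ be even, $n_i=k_i+2$. The data qubits of $I_{k_2}\circ I_{k_1}$ form a grid $(x,y)\in[n_1]\times[n_2]$ ($x$ column, $y$ row). For each Pauli type $P\in\{X,Z\}$ the stabilizers of type $P$ are generated by the products of $P$ over a row ("low-level") and over a pair of columns ("high-level"). Errors of each type are taken up to stabilizers of that type. **QEC cycle.** First the $X$ stabilizers are extracted, then the $Z$ stabilizers by the Hadamard-conjugate circuit (exchange $X\leftrightarrow Z$ and reverse every CX). Extraction of the $X$ stabilizers: (i) an $I_{k_1}$ ancilla block $a_0,\dots,a_{n_1-1}$ is prepared in $|\bar +\rangle^{\otimes k_1}$ by a two-branch tree: $a_0$ in $|0\rangle$, the others in $|+\rangle$, and for $i=1,\dots,n_1-1$ a CX from $a_i$ to $a_{\max(i-2,0)}$; the operator $X_{a_{n_1-2}}X_{a_{n_1-1}}$ is measured with one more qubit, and the attempt is discarded if the outcome is nontrivial. (ii) $n_1$ flag qubits $f_x$ are prepared in $|0\rangle$; transversal CX from $a_x$ to $f_x$; for each row $y$ transversal CX onto row $y$ from the ancilla block ($y$ even) or from the flags ($y$ odd); again transversal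 CX from $a_x$ to $f_x$; the $a_x$ are measured in the $X$ basis (register HighX) and the $f_x$ in the $Z$ basis (column hook flags of type $X$). (iii) For each row $y$: an ancilla in $|+\rangle$, a flag in $|0\rangle$, CX from ancilla to flag, CX onto $(x,y)$ from the ancilla ($x$ even) or the flag ($x$ odd) for all $x$, CX from ancilla to flag; the ancilla is measured in the $X$ basis (register LowX), the flag in the $Z$ basis (row hook flag of type $X$). **Faults.** A fault at a location is an arbitrary Pauli error on the qubits of one preparation or CX gate after it, or of one measurement before it. **Decoder.** $Z$ errors are decoded after the extraction of the $X$ stabilizers, $X$ errors after that of the $Z$ stabilizers, independently and by the same rule. The decoder for errors of type $P$ uses the sets $h_x$ of columns and $h_y$ of rows whose type-$P$ hook flags were raised since the previous extraction that detects type $P$, a number PrevFailures and a bit InputErrorAllowed passed from the previous cycle (initially $0$ and true), the set $x_s$ of columns with nontrivial high-level outcome (defined up to complement; the smaller set is taken), and the set $y_s$ of rows with nontrivial low-level outcome. It acts as follows, in this order; unless stated otherwise it passes on PrevFailures $=0$, InputErrorAllowed $=$ true. 1. If InputErrorAllowed is false and one of $x_s,y_s,h_x,h_y$ is nonempty: halt.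 2. If $h_x=h_y=\emptyset$ and $|x_s|+|y_s|=1$: halt if PrevFailures $>0$; else apply no correction and pass on PrevFailures $=1$ and InputErrorAllowed $=(x_s=\emptyset)$. 3. If $h_x=h_y=\emptyset$ otherwise: no correction if $x_s=y_s=\emptyset$; correct $(x,y)$ if $x_s=\{x\}$, $y_s=\{y\}$; correct all of column $0$ if $x_s=\emptyset$ and $y_s=[n_2]$; else halt. 4. If $h_x=\{x\}$, $h_y=\emptyset$: if $x_s=\emptyset$ and $|y_s|$ is even, or $x_s=\{x\}$ and $|y_s|$ is odd, correct column $x$ in the rows $y_s$; else halt. 5. If $h_x=\emptyset$, $h_y=\{y\}$: if $y_s=\emptyset$ and $|x_s|$ is even, or $y_s=\{y\}$ and $|x_s|$ is odd, correct row $y$ in the columns $x_s$; else halt. 6. Otherwise halt. **Generalized weight.** An error of one type, together with the pending hook-flag sets $(h_x,h_y)$ of that type, has generalized weight $0$ if it is trivial and $h_x=h_y=\emptyset$. It has generalized weight $\le 1$ if it has generalized weight $0$, or is (up to stabilizers) a single-qubit error or a whole column with $h_x=h_y=\emptyset$, or a string in column $x$ with $h_x=\{x\},h_y=\emptyset$,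 or a string in row $y$ with $h_x=\emptyset,h_y=\{y\}$. It has generalized weight $\le 2$ if it is a product of two errors of generalized weight $\le1$ (taking the unions of the flag sets), or a string in one column or one row with $h_x=h_y=\emptyset$. For a general Pauli error both bounds are imposed on its $X$ part and on its $Z$ part; generalized weight $2$ means $\le 2$ and not $\le 1$. "Error-free" means trivial error, no pending flags, PrevFailures $=0$ and InputErrorAllowed true for both types. **Proposition.** In all runs in which no ancilla preparation is discarded: 1. Without internal faults, an input of generalized weight $\le 1$ (such that, for each type, InputErrorAllowed is true or the input has generalized weight $0$) yields an error-free output, and an input of generalized weight $2$ makes the cycle halt. 2. With at most one internal fault, an error-free input does not halt and yields an output of generalized weight $\le1$ (with, for each type, InputErrorAllowed true or generalized weight $0$). With at most one internal fault, an input of generalized weight $\le 1$ yields an output of generalized weight $\le 1$, or the cycle halts, or it passes on flags with which the next cycle halts, if that has at most one fault. 3. With at most two internal faults, an error-free input yields an output of generalized weight $\le2$, or the cycle halts. -/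

import Mathlib

/-! ## Pauli frames and faulty stabilizer circuits -/

namespace Iceberg

/-- The two Pauli types. `X` also stands for the `X` measurement basis / the state `|+⟩`, and
`Z` for the `Z` measurement basis / the state `|0⟩`. -/
inductive Basis
  | X
  | Z
deriving DecidableEq

instance : Fintype Basis := ⟨{.X, .Z}, fun b => by cases b <;> decide⟩

/-- Exchange of `X` and `Z` (conjugation by the Hadamard gate). -/
def Basis.dual : Basis → Basis
  | .X => .Z
  | .Z => .X

/-- Instructions of a CSS circuit: preparation of a qubit in the `+1` eigenstate of the Pauli
operator `b` (so `|+⟩` for `b = X`, `|0⟩` for `b = Z`), the CX gate with control `c` and target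
`t`, and the measurement of a qubit in the basis `b`. -/
inductive Instr (Q : Type)
  | prep (b : Basis) (q : Q)
  | cx (c t : Q)
  | meas (b : Basis) (q : Q)

/-- What happens at one circuit location. `fst` and `snd` are the Pauli errors (up to phase; the
coordinate `b` is `1` iff a factor of type `b` is present) on the first and the second qubit of
the instruction (`snd` is used for `cx` only). Errors act after preparations and gates, and before
measurements. The bit `gauge` is not an error: a freshly prepared `+1` eigenstate of the Pauli
operator `b` is not changed by `b`, so the `b`-coordinate of its frame is arbitrary, and letting it
range over both values produces every intrinsically random measurement outcome. -/
structure Event where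
  gauge : ZMod 2
  fst : Basis → ZMod 2
  snd : Basis → ZMod 2

/-- The location is faulty. -/
def Event.isFault (ε : Event) : Bool := decide (ε.fst ≠ 0 ∨ ε.snd ≠ 0)

/-- The Pauli frame of a set `Q` of qubits (`frame b q = 1` iff the deviation from the ideal state
has a factor of type `b` at `q`), with the record of the measurement outcomes, where `1` is the
outcome `-1`. -/
structure RunState (Q : Type) where
  frame : Basis → Q → ZMod 2
  record : Q → ZMod 2

section Circuits

variable {Q : Type} [DecidableEq Q]

/-- Multiplication of a frame by the single-qubit Pauli operator `p` at `q`. -/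
def addPauli (f : Basis → Q → ZMod 2) (q : Q) (p : Basis → ZMod 2) : Basis → Q → ZMod 2 :=
  fun b q' => if q' = q then f b q' + p b else f b q'

/-- One (possibly faulty) location. -/
def step (s : RunState Q) : Instr Q × Event → RunState Q
  | (.prep b q, ε) =>
      { frame := addPauli
          (fun a q' => if q' = q then (if a = b then ε.gauge else 0) else s.frame a q') q ε.fst
        record := s.record }
  | (.cx c t, ε) =>
      { frame := addPauli (addPauli
          (fun a q' => match a with
            | .X => if q' = t then s.frame .X t + s.frame .X c else s.frame .X q'
            | .Z => if q' = c then s.frame .Z c + s.frame .Z t else s.frame .Z q')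
          c ε.fst) t ε.snd
        record := s.record }
  | (.meas b q, ε) =>
      { frame := addPauli s.frame q ε.fst
        record := fun q' =>
          if q' = q then addPauli s.frame q ε.fst b.dual q else s.record q' }

/-- Execution of an annotated circuit. -/
def run (L : List (Instr Q × Event)) (s : RunState Q) : RunState Q := L.foldl step s

/-- The number of faulty locations of an annotated circuit. -/
def faults (L : List (Instr Q × Event)) : ℕ := L.countP (fun p => p.2.isFault)

end Circuits

/-! ## The code

The physical qubits form an `n₁ × n₂` grid; `(x, y)` is the qubit in column `x` and row `y`. -/

/-- Pauli operators of one fixed type on the data qubits. -/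
abbrev Grid (n₁ n₂ : ℕ) := Fin n₁ → Fin n₂ → ZMod 2

section Code

variable {n₁ n₂ : ℕ}

/-- The vertical string with column `x` and rows `S`. -/
def vString (x : Fin n₁) (S : Finset (Fin n₂)) : Grid n₁ n₂ :=
  fun i j => if i = x ∧ j ∈ S then 1 else 0

/-- The horizontal string with row `y` and columns `S`. -/
def hString (S : Finset (Fin n₁)) (y : Fin n₂) : Grid n₁ n₂ :=
  fun i j => if i ∈ S ∧ j = y then 1 else 0

variable (n₁ n₂) in
/-- The stabilizers of either type of the concatenated iceberg code: generated by the rows and the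
pairs of columns. -/
def stabilizers : Submodule (ZMod 2) (Grid n₁ n₂) :=
  Submodule.span (ZMod 2)
    (Set.range (fun y : Fin n₂ => hString (Finset.univ : Finset (Fin n₁)) y) ∪
     Set.range (fun p : Fin n₁ × Fin n₁ =>
       vString p.1 (Finset.univ : Finset (Fin n₂)) + vString p.2 Finset.univ))

/-- Equality up to a stabilizer. -/
def SameError (e e' : Grid n₁ n₂) : Prop := e - e' ∈ stabilizers n₁ n₂

/-- No error, and no column or row flagged. -/
def IsWeightZero (e : Grid n₁ n₂) (C : Finset (Fin n₁)) (R : Finset (Fin n₂)) : Prop :=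
  SameError e 0 ∧ C = ∅ ∧ R = ∅

/-- Errors of one Pauli type of generalized weight at most one. `C` and `R` are the columns and
rows known (from flags) to carry a string: no error, a single-qubit error, a vertical string with
known column, a horizontal string with known row, or an error on a whole column. -/
def IsGenWeightLeOne (e : Grid n₁ n₂) (C : Finset (Fin n₁)) (R : Finset (Fin n₂)) : Prop :=
  IsWeightZero e C R ∨
  (∃ x y, SameError e (vString x {y}) ∧ C = ∅ ∧ R = ∅) ∨
  (∃ x S, SameError e (vString x S) ∧ C = {x} ∧ R = ∅) ∨
  (∃ y S, SameError e (hString S y) ∧ C = ∅ ∧ R = {y}) ∨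
  (∃ x, SameError e (vString x Finset.univ) ∧ C = ∅ ∧ R = ∅)

/-- Errors of one Pauli type of generalized weight at most two: a product of two errors of
generalized weight at most one, or a vertical or horizontal string with no known coordinate. -/
def IsGenWeightLeTwo (e : Grid n₁ n₂) (C : Finset (Fin n₁)) (R : Finset (Fin n₂)) : Prop :=
  (∃ e₁ C₁ R₁ e₂ C₂ R₂, IsGenWeightLeOne e₁ C₁ R₁ ∧ IsGenWeightLeOne e₂ C₂ R₂ ∧
    e = e₁ + e₂ ∧ C = C₁ ∪ C₂ ∧ R = R₁ ∪ R₂) ∨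
  (∃ x S, SameError e (vString x S) ∧ C = ∅ ∧ R = ∅) ∨
  (∃ y S, SameError e (hString S y) ∧ C = ∅ ∧ R = ∅)

end Code

/-! ## The syndrome extraction circuits -/

/-- The qubits: the data grid, the high-level ancilla (an iceberg code block) and its flags, the
qubit that verifies the preparation of the high-level ancilla, and for each row the Bell pair
(ancilla, flag) of the low-level extraction. -/
inductive Qubit (n₁ n₂ : ℕ)
  | data (x : Fin n₁) (y : Fin n₂)
  | anc (x : Fin n₁)
  | flag (x : Fin n₁)
  | check
  | rowAnc (y : Fin n₂)
  | rowFlag (y : Fin n₂)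
deriving DecidableEq

section Extraction

variable {n₁ n₂ : ℕ}

/-- The CX gate with control `c` and target `t` in the extraction of the `X` stabilizers, and its
conjugate by Hadamard gates in the extraction of the `Z` stabilizers. -/
def couple (b : Basis) (c t : Qubit n₁ n₂) : Instr (Qubit n₁ n₂) :=
  match b with
  | .X => .cx c t
  | .Z => .cx t c

/-- The parent in the two-branch tree `0 → 1 → 3 → 5 → ⋯`, `0 → 2 → 4 → ⋯`. -/
def treeParent (x : Fin n₁) : Fin n₁ := ⟨x.val - 2, lt_of_le_of_lt (Nat.sub_le _ _) x.isLt⟩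

variable (n₁ n₂)

/-- Two-branch preparation of the high-level ancilla in the logical `|+⋯+⟩` (for `b = X`) or
`|0⋯0⟩` (for `b = Z`) state, with the verification of the two ends of the branches. -/
def ancillaPreparation (b : Basis) : List (Instr (Qubit n₁ n₂)) :=
  (List.finRange n₁).map (fun x => .prep (if x.val = 0 then b.dual else b) (.anc x)) ++
  ((List.finRange n₁).filter (fun x => x.val ≠ 0)).map
    (fun x => couple b (.anc x) (.anc (treeParent x))) ++
  [.prep b .check] ++
  ((List.finRange n₁).filter (fun x => n₁ ≤ x.val + 2)).map (fun x => couple b .check (.anc x)) ++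
  [.meas b .check]

/-- Extraction of the high-level stabilizers (pairs of columns): the ancilla block is coupled
transversally to its flags, then ancilla and flags are coupled transversally to every other row,
then the ancilla is coupled to the flags again, and both are measured. -/
def highExtraction (b : Basis) : List (Instr (Qubit n₁ n₂)) :=
  (List.finRange n₁).map (fun x => .prep b.dual (.flag x)) ++
  (List.finRange n₁).map (fun x => couple b (.anc x) (.flag x)) ++
  (List.finRange n₂).flatMap (fun y => (List.finRange n₁).map (fun x =>
    couple b (if Even y.val then .anc x else .flag x) (.data x y))) ++
  (List.finRange n₁).map (fun x => couple b (.anc x) (.flag x)) ++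
  (List.finRange n₁).map (fun x => .meas b (.anc x)) ++
  (List.finRange n₁).map (fun x => .meas b.dual (.flag x))

/-- Bell-pair extraction of the low-level stabilizer of the row `y`. -/
def rowExtraction (b : Basis) (y : Fin n₂) : List (Instr (Qubit n₁ n₂)) :=
  [.prep b (.rowAnc y), .prep b.dual (.rowFlag y), couple b (.rowAnc y) (.rowFlag y)] ++
  (List.finRange n₁).map (fun x =>
    couple b (if Even x.val then .rowAnc y else .rowFlag y) (.data x y)) ++
  [couple b (.rowAnc y) (.rowFlag y), .meas b (.rowAnc y), .meas b.dual (.rowFlag y)]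

/-- One half of the QEC cycle: extraction of all stabilizers of type `b`. -/
def extraction (b : Basis) : List (Instr (Qubit n₁ n₂)) :=
  ancillaPreparation n₁ n₂ b ++ highExtraction n₁ n₂ b ++
    (List.finRange n₂).flatMap (rowExtraction n₁ n₂ b)

end Extraction

/-! ## The decoder -/

section Decoder

variable {n₁ n₂ : ℕ}

/-- What the decoder for one type of errors remembers: the columns and rows whose hook flags were
raised since the last extraction of the stabilizers that detect this type of errors, the number of
internal faults seen at that extraction, and whether an input error is now allowed. -/
structure Memory (n₁ n₂ : ℕ) where
  hookCols : Finset (Fin n₁)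
  hookRows : Finset (Fin n₂)
  prevFailures : ℕ
  inputErrorAllowed : Bool

/-- The memory before the first cycle. -/
def Memory.blank : Memory n₁ n₂ := ⟨∅, ∅, 0, true⟩

/-- The columns with an odd number of errors according to the transversal measurement of the
high-level ancilla. Only the relative values of the outcomes are meaningful, so this is the smaller
one of the two compatible sets. -/
def xCoords (high : Fin n₁ → ZMod 2) : Finset (Fin n₁) :=
  let S := Finset.univ.filter (fun x => high x = 1)
  if 2 * S.card ≤ n₁ then S else Sᶜ

/-- The rows with an odd number of errors according to the low-level syndromes. -/
def yCoords (low : Fin n₂ → ZMod 2) : Finset (Fin n₂) :=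
  Finset.univ.filter (fun y => low y = 1)

/-- The operator supported on `S × T`. -/
def rectangle (S : Finset (Fin n₁)) (T : Finset (Fin n₂)) : Grid n₁ n₂ :=
  fun i j => if i ∈ S ∧ j ∈ T then 1 else 0

/-- Decoding of a reliable syndrome without flags: a correction, or `none` (halt). -/
def noiselessDecode (xs : Finset (Fin n₁)) (ys : Finset (Fin n₂)) : Option (Grid n₁ n₂) :=
  if xs = ∅ ∧ ys = ∅ then some 0
  else if xs.card = 1 ∧ ys.card = 1 then some (rectangle xs ys)
  else if xs = ∅ ∧ ys = Finset.univ then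
    some (rectangle (Finset.univ.filter (fun x => x.val = 0)) Finset.univ)
  else none

/-- Circuit-level decoding of one type of errors: the correction and the memory that is passed on,
or `none` (halt). -/
def decode (m : Memory n₁ n₂) (high : Fin n₁ → ZMod 2) (low : Fin n₂ → ZMod 2) :
    Option (Grid n₁ n₂ × Memory n₁ n₂) :=
  let xs := xCoords high
  let ys := yCoords low
  let hx := m.hookCols
  let hy := m.hookRows
  if m.inputErrorAllowed = false ∧ ¬ (xs = ∅ ∧ ys = ∅ ∧ hx = ∅ ∧ hy = ∅) then none
  else if hx = ∅ ∧ hy = ∅ then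
    if xs.card + ys.card = 1 then
      -- only one coordinate was seen: an internal fault occurred, and the error, if any, is passed
      -- on; without a row coordinate, the next cycle must not see any input error
      if 0 < m.prevFailures then none
      else some (0, ⟨∅, ∅, 1, decide (xs = ∅)⟩)
    else (noiselessDecode xs ys).map (fun c => (c, Memory.blank))
  else if hx.card = 1 ∧ hy = ∅ then
    -- vertical hook error; halt if there is another error in addition to it
    if xs = (if Even ys.card then ∅ else hx) then some (rectangle hx ys, Memory.blank) else none
  else if hx = ∅ ∧ hy.card = 1 then
    -- horizontal hook error; halt if there is another error in addition to it
    if ys = (if Even xs.card then ∅ else hy) then some (rectangle xs hy, Memory.blank) else none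
  else none

end Decoder

/-! ## The QEC cycle -/

/-- The state between two cycles: `err a` is the error of type `a` on the data qubits, and `mem a`
is the memory of the decoder for errors of type `a`. -/
structure CycleState (n₁ n₂ : ℕ) where
  err : Basis → Grid n₁ n₂
  mem : Basis → Memory n₁ n₂

/-- The result of a run: `discarded` if the verification of the preparation of an ancilla block
failed (this attempt is not used), `halted` if the decoder halts, else the new state. -/
inductive Outcome (n₁ n₂ : ℕ)
  | discarded
  | halted
  | ok (s : CycleState n₁ n₂)

section Cycle

variable {n₁ n₂ : ℕ}

/-- One half of the QEC cycle, with the annotated circuit `L` for the extraction of the stabilizers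
of type `b`: errors of the other type are decoded from the syndromes and the hook flags raised
earlier and are corrected; the flags raised in this half concern hook errors of type `b`. -/
def halfCycle (b : Basis) (L : List (Instr (Qubit n₁ n₂) × Event)) (s : CycleState n₁ n₂) :
    Outcome n₁ n₂ :=
  let r := run L
    { frame := fun a q => match q with
        | .data x y => s.err a x y
        | _ => 0
      record := fun _ => 0 }
  if r.record .check ≠ 0 then .discarded
  else
    match decode (s.mem b.dual) (fun x => r.record (.anc x)) (fun y => r.record (.rowAnc y)) with
    | none => .halted
    | some (c, m) => .ok
        { err := fun a x y => r.frame a (.data x y) + (if a = b then 0 else c x y)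
          mem := fun a =>
            if a = b then
              { s.mem b with
                hookCols := (s.mem b).hookCols ∪
                  Finset.univ.filter (fun x => r.record (.flag x) = 1)
                hookRows := (s.mem b).hookRows ∪
                  Finset.univ.filter (fun y => r.record (.rowFlag y) = 1) }
            else m }

/-- Annotated circuits for the two halves of a QEC cycle. -/
abbrev CycleRun (n₁ n₂ : ℕ) :=
  List (Instr (Qubit n₁ n₂) × Event) × List (Instr (Qubit n₁ n₂) × Event)

/-- `ρ` is an execution of the QEC cycle (`X` stabilizers first, then `Z` stabilizers) with at most
`k` faulty locations. -/
def IsCycle (k : ℕ) (ρ : CycleRun n₁ n₂) : Prop :=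
  ρ.1.map Prod.fst = extraction n₁ n₂ .X ∧ ρ.2.map Prod.fst = extraction n₁ n₂ .Z ∧
    faults ρ.1 + faults ρ.2 ≤ k

/-- The QEC cycle, with decoding and correction. -/
def cycle (ρ : CycleRun n₁ n₂) (s : CycleState n₁ n₂) : Outcome n₁ n₂ :=
  match halfCycle .X ρ.1 s with
  | .ok s' => halfCycle .Z ρ.2 s'
  | o => o

namespace CycleState

/-- No error, and nothing was passed on by the previous cycle. -/
def ErrorFree (s : CycleState n₁ n₂) : Prop :=
  ∀ a, SameError (s.err a) 0 ∧ s.mem a = Memory.blank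

/-- Generalized weight at most one. -/
def GenWeightLeOne (s : CycleState n₁ n₂) : Prop :=
  ∀ a, IsGenWeightLeOne (s.err a) (s.mem a).hookCols (s.mem a).hookRows

/-- Generalized weight at most two. -/
def GenWeightLeTwo (s : CycleState n₁ n₂) : Prop :=
  ∀ a, IsGenWeightLeTwo (s.err a) (s.mem a).hookCols (s.mem a).hookRows

/-- Generalized weight two. -/
def GenWeightTwo (s : CycleState n₁ n₂) : Prop := s.GenWeightLeTwo ∧ ¬ s.GenWeightLeOne

/-- The previous cycle did not forbid the errors that are present. -/
def Allowed (s : CycleState n₁ n₂) : Prop :=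
  ∀ a, (s.mem a).inputErrorAllowed = true ∨
    IsWeightZero (s.err a) (s.mem a).hookCols (s.mem a).hookRows

end CycleState

end Cycle

end Iceberg

/-!
In a half cycle that extracts the stabilizers of type `b`, follow the effect of an error on each
qubit backwards through the circuit. Errors of type `b` pass the extraction undetected: the effect
of a single fault on them is a hook error, that is, a string in a column or in a row whose flag is
raised, or one of the errors of generalized weight at most one without flags. Errors of the other
type are detected: the effect of a single fault on them is a qubit error together with a change of
some outcomes, from a short list. Up to stabilizers, an error of generalized weight at most two is
told apart from the lighter ones by its syndrome, the parities of the columns up to a common flip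
and the parities of the rows, together with the flags. Each bound on the output of a cycle is
therefore a case distinction over the pairs of a few errors and fault effects, and of the half
cycle in which the faults occur. The evenness of the side lengths, which are at least four, makes
the syndrome invariant under stabilizers and keeps the syndromes of these pairs apart.
-/

namespace Iceberg

/-! ## Sensitivities of a circuit -/

section Propagation

variable {Q : Type} {M : Type*} [AddCommGroup M]

/-- Transport of sensitivities through an instruction. A function `S : Q → M` gives the effect in
`M` of an error of type `a` on each qubit after the instruction, and `i.pullback a S` gives the
effect of such an error before it. -/
def Instr.pullback [DecidableEq Q] (a : Basis) : Instr Q → (Q → M) → (Q → M)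
  | .prep _ q, S => Function.update S q 0
  | .cx c t, S =>
    match a with
    | .X => Function.update S c (S c + S t)
    | .Z => Function.update S t (S t + S c)
  | .meas _ _, S => S

variable [Module (ZMod 2) M]

/-- The effects of the type-`a` components of all faults at the instruction lie in `E`, and the
gauge freedom of a preparation acts by elements of `G`, when `S` gives the sensitivities after the
instruction. -/
def Instr.EffectsIn (a : Basis) (E : Set M) (G : Submodule (ZMod 2) M) : Instr Q → (Q → M) → Prop
  | .prep b q, S => S q ∈ E ∧ (a = b → S q ∈ G)
  | .cx c t, S => S c ∈ E ∧ S t ∈ E ∧ S c + S t ∈ E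
  | .meas _ q, S => S q ∈ E

variable {a : Basis} {E : Set M} {G : Submodule (ZMod 2) M}

/-- The contribution of the type-`a` components of the fault and the gauge bit at a location, with
sensitivities `S` after it. -/
def Event.effect (a : Basis) (ε : Event) (S : Q → M) : Instr Q → M
  | .prep b q => (if a = b then ε.gauge else 0) • S q + ε.fst a • S q
  | .cx c t => ε.fst a • S c + ε.snd a • S t
  | .meas _ q => ε.fst a • S q

theorem zmod_two_eq_zero_or_eq_one : ∀ c : ZMod 2, c = 0 ∨ c = 1 := by decide

theorem smul_mem_of_zero_mem (hzero : (0 : M) ∈ E) (c : ZMod 2) {m : M} (hm : m ∈ E) :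
    c • m ∈ E := by
  rcases zmod_two_eq_zero_or_eq_one c with rfl | rfl
  · exact (zero_smul (ZMod 2) m).symm ▸ hzero
  · exact (one_smul (ZMod 2) m).symm ▸ hm

theorem Instr.EffectsIn.exists_effect_eq (hzero : (0 : M) ∈ E) {i : Instr Q} {S : Q → M}
    (h : i.EffectsIn a E G S) (ε : Event) :
    ∃ g ∈ G, ∃ m ∈ E, ε.effect a S i = g + m ∧ (ε.isFault = false → m = 0) := by
  have no_fault : ε.isFault = false → ε.fst = 0 ∧ ε.snd = 0 := fun hε => by
    simpa only [Event.isFault, decide_eq_false_iff_not, not_or, not_not] using hε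
  rcases i with ⟨b, q⟩ | ⟨c, t⟩ | ⟨b, q⟩
  · refine ⟨(if a = b then ε.gauge else 0) • S q, ?_, ε.fst a • S q,
      smul_mem_of_zero_mem hzero _ h.1, rfl, fun hε => by simp [no_fault hε]⟩
    split_ifs with hab
    · exact G.smul_mem _ (h.2 hab)
    · exact (zero_smul (ZMod 2) (S q)).symm ▸ G.zero_mem
  · refine ⟨0, G.zero_mem, ε.fst a • S c + ε.snd a • S t, ?_, (zero_add _).symm,
      fun hε => by simp [no_fault hε]⟩
    obtain ⟨hc, ht, hct⟩ := h
    rcases zmod_two_eq_zero_or_eq_one (ε.fst a) with hu | hu <;>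
      rcases zmod_two_eq_zero_or_eq_one (ε.snd a) with hv | hv <;> simpa [hu, hv]
  · exact ⟨0, G.zero_mem, ε.fst a • S q, smul_mem_of_zero_mem hzero _ h, (zero_add _).symm,
      fun hε => by simp [no_fault hε]⟩

/-- Sensitivities `S` after the circuit are pulled back to `S'` before it, and `Instr.EffectsIn`
holds at each location on the way. -/
inductive PullsBack [DecidableEq Q] (a : Basis) (E : Set M) (G : Submodule (ZMod 2) M) :
    List (Instr Q) → (Q → M) → (Q → M) → Prop
  | nil (S) : PullsBack a E G [] S S
  | cons {i l S S' S''} : PullsBack a E G l S S' → i.EffectsIn a E G S' → i.pullback a S' = S'' →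
      PullsBack a E G (i :: l) S S''

variable [DecidableEq Q]

theorem PullsBack.append {l₁ l₂ : List (Instr Q)} {S S' S'' : Q → M}
    (h₁ : PullsBack a E G l₁ S' S'') (h₂ : PullsBack a E G l₂ S S') :
    PullsBack a E G (l₁ ++ l₂) S S'' := by
  induction h₁ with
  | nil => exact h₂
  | cons _ hE hS ih => exact .cons (ih h₂) hE hS

theorem PullsBack.flatMap_of_suffix {ι : Type*} (f : ι → List (Instr Q)) (T : List ι → Q → M)
    (l : List ι) (h : ∀ i l', i :: l' <:+ l → PullsBack a E G (f i) (T l') (T (i :: l'))) :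
    PullsBack a E G (l.flatMap f) (T []) (T l) := by
  induction l with
  | nil => exact .nil _
  | cons i l ih =>
    rw [List.flatMap_cons]
    exact (h i l List.suffix_rfl).append
      (ih fun j l' hl => h j l' (hl.trans (List.suffix_cons i l)))

theorem PullsBack.map_of_suffix {ι : Type*} (f : ι → Instr Q) (T : List ι → Q → M) (l : List ι)
    (h : ∀ i l', i :: l' <:+ l →
      (f i).EffectsIn a E G (T l') ∧ (f i).pullback a (T l') = T (i :: l')) :
    PullsBack a E G (l.map f) (T []) (T l) := by
  rw [← List.flatMap_singleton' (l.map f), List.flatMap_map]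
  exact flatMap_of_suffix _ T l fun i l' hl => .cons (.nil _) (h i l' hl).1 (h i l' hl).2

theorem notMem_of_cons_suffix {ι : Type*} {i : ι} {l l' : List ι} (hl : l.Nodup)
    (h : i :: l' <:+ l) : i ∉ l' :=
  (List.nodup_cons.1 (hl.sublist h.sublist)).1

/-- The instructions of a layer, each of which changes the sensitivity of a qubit of its own, may
be pulled back one by one: at the time of the instruction `f i` only the sensitivities of the qubits
`u j` with `j ≠ i` differ from `S`. -/
theorem PullsBack.layer {ι : Type*} {f : ι → Instr Q} {l : List ι} (hl : l.Nodup) {S S' : Q → M}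
    {u : ι → Q} (hS' : ∀ q, (∀ i ∈ l, q ≠ u i) → S' q = S q)
    (hf : ∀ i T, (∀ q, (∀ j ≠ i, q ≠ u j) → T q = S q) →
      (f i).EffectsIn a E G T ∧ (f i).pullback a T = Function.update T (u i) (S' (u i))) :
    PullsBack a E G (l.map f) S S' := by
  classical
  let T (l' : List ι) (q : Q) : M := if ∃ i ∈ l', q = u i then S' q else S q
  have hnil : T [] = S := by simp [T]
  have hall : T l = S' := by
    ext q
    by_cases hq : ∃ i ∈ l, q = u i
    · exact if_pos hq
    · rw [hS' q fun i hi h => hq ⟨i, hi, h⟩]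
      exact if_neg hq
  rw [← hnil, ← hall]
  refine map_of_suffix f T l fun i l' hs => ?_
  have hi : i ∉ l' := notMem_of_cons_suffix hl hs
  obtain ⟨hE, hT⟩ := hf i (T l') fun q hq =>
    if_neg fun ⟨j, hj, h⟩ => hq j (fun hji => hi (hji ▸ hj)) h
  refine ⟨hE, hT.trans (funext fun q => ?_)⟩
  rcases eq_or_ne q (u i) with rfl | hq <;> simp [T, *]

theorem PullsBack.map_prep {ι : Type*} {l : List ι} (hl : l.Nodup) {S S' : Q → M} {c : ι → Basis}
    {u : ι → Q} (hu : Function.Injective u) (hE : ∀ i, S (u i) ∈ E)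
    (hG : ∀ i, a = c i → S (u i) ∈ G) (hzero : ∀ i, S' (u i) = 0)
    (hS' : ∀ q, (∀ i ∈ l, q ≠ u i) → S' q = S q) :
    PullsBack a E G (l.map fun i => .prep (c i) (u i)) S S' := by
  refine .layer hl hS' fun i T hT => ?_
  have hi : T (u i) = S (u i) := hT _ fun j hj h => hj (hu h).symm
  exact ⟨⟨hi ▸ hE i, fun h => hi ▸ hG i h⟩, by rw [hzero]; rfl⟩

theorem PullsBack.map_meas {ι : Type*} (b : Basis) {u : ι → Q} {S : Q → M} (hE : ∀ i, S (u i) ∈ E)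
    (l : List ι) : PullsBack a E G (l.map fun i => .meas b (u i)) S S :=
  map_of_suffix _ (fun _ => S) l fun i _ _ => ⟨hE i, rfl⟩

theorem linearCombination_update_left [Fintype Q] (S : Q → M) (f : Q → ZMod 2) (q : Q) (v : M) :
    Fintype.linearCombination (ZMod 2) (Function.update S q v) f =
      Fintype.linearCombination (ZMod 2) S f + f q • (v - S q) := by
  have h : Function.update S q v = S + Pi.single q (v - S q) := by
    ext q'
    rcases eq_or_ne q' q with rfl | hq <;> simp [*]
  simp [h, Fintype.linearCombination_apply, smul_add, Finset.sum_add_distrib, Pi.single_apply,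
    smul_ite]

theorem linearCombination_update_right [Fintype Q] (S : Q → M) (f : Q → ZMod 2) (q : Q)
    (v : ZMod 2) :
    Fintype.linearCombination (ZMod 2) S (Function.update f q v) =
      Fintype.linearCombination (ZMod 2) S f + (v - f q) • S q := by
  have h : Function.update f q v = f + Pi.single q (v - f q) := by
    ext q'
    rcases eq_or_ne q' q with rfl | hq <;> simp [*]
  rw [h, map_add, Fintype.linearCombination_apply_single]

theorem linearCombination_addPauli [Fintype Q] (S : Q → M) (f : Basis → Q → ZMod 2) (q : Q)
    (p : Basis → ZMod 2) (a : Basis) :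
    Fintype.linearCombination (ZMod 2) S (addPauli f q p a) =
      Fintype.linearCombination (ZMod 2) S (f a) + p a • S q := by
  have h : addPauli f q p a = Function.update (f a) q (f a q + p a) := by
    ext q'
    rcases eq_or_ne q' q with rfl | hq <;> simp [addPauli, *]
  rw [h, linearCombination_update_right, add_sub_cancel_left]

theorem linearCombination_step [Fintype Q] (s : RunState Q) (i : Instr Q) (ε : Event)
    (S : Q → M) :
    Fintype.linearCombination (ZMod 2) S ((step s (i, ε)).frame a) =
      Fintype.linearCombination (ZMod 2) (i.pullback a S) (s.frame a) + ε.effect a S i := by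
  have update_eq : ∀ (f : Q → ZMod 2) q v,
      (fun q' => if q' = q then v else f q') = Function.update f q v := fun f q v => by
    ext q'; simp only [Function.update_apply]
  rcases i with ⟨b, q⟩ | ⟨c, t⟩ | ⟨b, q⟩
  · simp only [step, linearCombination_addPauli, update_eq, linearCombination_update_right,
      Instr.pullback, linearCombination_update_left, Event.effect]
    module
  · cases a <;>
    · simp only [step, linearCombination_addPauli, update_eq, linearCombination_update_right,
        Instr.pullback, linearCombination_update_left, Event.effect]
      module
  · simp only [step, linearCombination_addPauli, Instr.pullback, Event.effect]

theorem PullsBack.exists_effects [Fintype Q] (hzero : (0 : M) ∈ E) {L : List (Instr Q × Event)}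
    {S S' : Q → M} (h : PullsBack a E G (L.map Prod.fst) S S') (s : RunState Q) :
    ∃ g ∈ G, ∃ es : List M, es.length ≤ faults L ∧ (∀ m ∈ es, m ∈ E) ∧
      Fintype.linearCombination (ZMod 2) S ((run L s).frame a) =
        Fintype.linearCombination (ZMod 2) S' (s.frame a) + g + es.sum := by
  induction L generalizing s S' with
  | nil =>
    cases h
    exact ⟨0, G.zero_mem, [], by simp, by simp, by simp [run]⟩
  | cons p L ih =>
    obtain ⟨i, ε⟩ := p
    rw [List.map_cons] at h
    rcases h with _ | @⟨_, _, _, S₁, _, h, hE, rfl⟩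
    obtain ⟨g, hg, es, hlen, hes, hrun⟩ := ih h (step s (i, ε))
    obtain ⟨g', hg', m, hm, hstep, hclean⟩ := hE.exists_effect_eq hzero ε
    have hsum : Fintype.linearCombination (ZMod 2) S ((run ((i, ε) :: L) s).frame a) =
        Fintype.linearCombination (ZMod 2) (i.pullback a S₁) (s.frame a) + (g' + g) +
          (m + es.sum) := by
      rw [show run ((i, ε) :: L) s = run L (step s (i, ε)) from rfl, hrun, linearCombination_step,
        hstep]
      abel
    cases hε : ε.isFault with
    | false =>
      refine ⟨g' + g, G.add_mem hg' hg, es, ?_, hes, by simpa [hclean hε] using hsum⟩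
      simpa [faults, List.countP_cons, hε] using hlen
    | true =>
      refine ⟨g' + g, G.add_mem hg' hg, m :: es, ?_, by simpa using ⟨hm, hes⟩,
        by rwa [List.sum_cons]⟩
      simpa [faults, List.countP_cons, hε] using hlen

end Propagation

/-! ## Records of measured qubits -/

section Records

variable {Q : Type}

/-- The instruction involves the qubit `q`. -/
def Instr.ActsOn : Instr Q → Q → Prop
  | .prep _ q', q => q = q'
  | .cx c t, q => q = c ∨ q = t
  | .meas _ q', q => q = q'

@[simp]
theorem Instr.prep_actsOn {b : Basis} {q q' : Q} : (Instr.prep b q').ActsOn q ↔ q = q' := Iff.rfl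

@[simp]
theorem Instr.meas_actsOn {b : Basis} {q q' : Q} : (Instr.meas b q').ActsOn q ↔ q = q' := Iff.rfl

/-- The qubit `q` is measured in the basis `b`, and no later instruction involves it. -/
def EndsMeasured (b : Basis) (q : Q) (I : List (Instr Q)) : Prop :=
  ∃ I₁ I₂, I = I₁ ++ .meas b q :: I₂ ∧ ∀ i ∈ I₂, ¬ i.ActsOn q

variable {b : Basis} {q : Q} {I J : List (Instr Q)}

theorem EndsMeasured.append_left (h : EndsMeasured b q I) : EndsMeasured b q (J ++ I) := by
  obtain ⟨I₁, I₂, rfl, h⟩ := h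
  exact ⟨J ++ I₁, I₂, by simp, h⟩

theorem EndsMeasured.append_right (h : EndsMeasured b q I) (hJ : ∀ i ∈ J, ¬ i.ActsOn q) :
    EndsMeasured b q (I ++ J) := by
  obtain ⟨I₁, I₂, rfl, h⟩ := h
  exact ⟨I₁, I₂ ++ J, by simp, List.forall_mem_append.2 ⟨h, hJ⟩⟩

theorem EndsMeasured.flatMap {ι : Type*} {l : List ι} (hl : l.Nodup) {f : ι → List (Instr Q)}
    {x : ι} (hx : x ∈ l) (h : EndsMeasured b q (f x))
    (hf : ∀ x', x' ≠ x → ∀ i ∈ f x', ¬ i.ActsOn q) : EndsMeasured b q (l.flatMap f) := by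
  obtain ⟨l₁, l₂, rfl⟩ := List.append_of_mem hx
  rw [List.flatMap_append, List.flatMap_cons]
  refine (h.append_right fun i hi => ?_).append_left
  obtain ⟨x', hx', hi⟩ := List.mem_flatMap.1 hi
  have hx₂ : x ∉ l₂ := (List.nodup_cons.1 (List.nodup_append.1 hl).2.1).1
  exact hf x' (fun h => hx₂ (h ▸ hx')) i hi

theorem EndsMeasured.map_meas {ι : Type*} {l : List ι} (hl : l.Nodup) {f : ι → Q}
    (hf : Function.Injective f) {x : ι} (hx : x ∈ l) :
    EndsMeasured b (f x) (l.map fun x => .meas b (f x)) := by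
  rw [← List.flatMap_singleton' (l.map _), List.flatMap_map]
  refine .flatMap hl hx ⟨[], [], rfl, by simp⟩ fun x' hx' i hi => ?_
  rw [List.mem_singleton.1 hi]
  exact fun h => hx' (hf h).symm

variable [DecidableEq Q]

theorem step_of_not_actsOn (s : RunState Q) {i : Instr Q} (h : ¬ i.ActsOn q) (ε : Event) :
    (∀ a, (step s (i, ε)).frame a q = s.frame a q) ∧ (step s (i, ε)).record q = s.record q := by
  rcases i with ⟨b, q'⟩ | ⟨c, t⟩ | ⟨b, q'⟩
  · have hq : q ≠ q' := h
    simp [step, addPauli, hq]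
  · obtain ⟨hc, ht⟩ : q ≠ c ∧ q ≠ t := not_or.1 h
    exact ⟨fun a => by cases a <;> simp [step, addPauli, hc, ht], rfl⟩
  · have hq : q ≠ q' := h
    simp [step, addPauli, hq]

theorem run_of_not_actsOn {L : List (Instr Q × Event)} (h : ∀ p ∈ L, ¬ p.1.ActsOn q)
    (s : RunState Q) :
    (∀ a, (run L s).frame a q = s.frame a q) ∧ (run L s).record q = s.record q := by
  induction L generalizing s with
  | nil => exact ⟨fun _ => rfl, rfl⟩
  | cons p L ih =>
    obtain ⟨hp, hL⟩ := List.forall_mem_cons.1 h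
    obtain ⟨hframe, hrecord⟩ := ih hL (step s p)
    obtain ⟨hframe', hrecord'⟩ := step_of_not_actsOn s hp p.2
    exact ⟨fun a => (hframe a).trans (hframe' a), hrecord.trans hrecord'⟩

theorem EndsMeasured.record_eq {L : List (Instr Q × Event)}
    (h : EndsMeasured b q (L.map Prod.fst)) (s : RunState Q) :
    (run L s).record q = (run L s).frame b.dual q := by
  obtain ⟨I₁, I₂, hL, h⟩ := h
  obtain ⟨L₁, L₂, rfl, rfl, hL₂⟩ := List.map_eq_append_iff.1 hL
  obtain ⟨⟨i, ε⟩, L₃, rfl, rfl, rfl⟩ := List.map_eq_cons_iff.1 hL₂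
  have hrun : run (L₁ ++ (.meas b q, ε) :: L₃) s = run L₃ (step (run L₁ s) (.meas b q, ε)) := by
    simp only [run, List.foldl_append, List.foldl_cons]
  obtain ⟨hframe, hrecord⟩ := run_of_not_actsOn (L := L₃) (q := q)
    (fun p hp => h p.1 (List.mem_map_of_mem hp)) (step (run L₁ s) (.meas b q, ε))
  rw [hrun, hframe, hrecord]
  simp only [step, if_true]

end Records

section Extraction

variable {n₁ n₂ : ℕ} (b : Basis)

theorem Basis.dual_ne (b : Basis) : b.dual ≠ b := by cases b <;> simp [Basis.dual]

@[simp]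
theorem Basis.dual_dual (b : Basis) : b.dual.dual = b := by cases b <;> rfl

@[simp]
theorem couple_actsOn {c t q : Qubit n₁ n₂} : (couple b c t).ActsOn q ↔ q = c ∨ q = t := by
  cases b
  · rfl
  · exact or_comm

theorem not_actsOn_of_mem_rowExtraction {q : Qubit n₁ n₂} {y : Fin n₂} (hanc : q ≠ .rowAnc y)
    (hflag : q ≠ .rowFlag y) (hdata : ∀ x, q ≠ .data x y) :
    ∀ i ∈ rowExtraction n₁ n₂ b y, ¬ i.ActsOn q := by
  intro i hi
  simp only [rowExtraction, List.mem_append, List.mem_cons, List.not_mem_nil, or_false,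
    List.mem_map] at hi
  rcases hi with ((rfl | rfl | rfl) | ⟨x, -, rfl⟩) | rfl | rfl | rfl <;>
    grind [Instr.prep_actsOn, Instr.meas_actsOn, couple_actsOn]

theorem not_actsOn_of_mem_rowExtractions {q : Qubit n₁ n₂} (hanc : ∀ y, q ≠ .rowAnc y)
    (hflag : ∀ y, q ≠ .rowFlag y) (hdata : ∀ x y, q ≠ .data x y) :
    ∀ i ∈ (List.finRange n₂).flatMap (rowExtraction n₁ n₂ b), ¬ i.ActsOn q := by
  intro i hi
  obtain ⟨y, -, hi⟩ := List.mem_flatMap.1 hi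
  exact not_actsOn_of_mem_rowExtraction b (hanc y) (hflag y) (fun x => hdata x y) i hi

theorem not_actsOn_check_of_mem_highExtraction :
    ∀ i ∈ highExtraction n₁ n₂ b, ¬ i.ActsOn .check := by
  intro i hi
  simp only [highExtraction, List.mem_append, List.mem_map, List.mem_flatMap] at hi
  rcases hi with ((((⟨x, -, rfl⟩ | ⟨x, -, rfl⟩) | ⟨y, -, x, -, rfl⟩) | ⟨x, -, rfl⟩) |
    ⟨x, -, rfl⟩) | ⟨x, -, rfl⟩ <;>
    grind [Instr.prep_actsOn, Instr.meas_actsOn, couple_actsOn]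

theorem endsMeasured_check : EndsMeasured b .check (extraction n₁ n₂ b) :=
  .append_right (.append_right (.append_left ⟨[], [], rfl, by simp⟩)
    (not_actsOn_check_of_mem_highExtraction b))
    (not_actsOn_of_mem_rowExtractions b (by simp) (by simp) (by simp))

theorem endsMeasured_anc (x : Fin n₁) : EndsMeasured b (.anc x) (extraction n₁ n₂ b) := by
  refine .append_right (.append_left (.append_right (.append_left
    (.map_meas (List.nodup_finRange _) (fun _ _ h => Qubit.anc.inj h) (List.mem_finRange x)))
      fun i hi => ?_))
    (not_actsOn_of_mem_rowExtractions b (by simp) (by simp) (by simp))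
  obtain ⟨x, -, rfl⟩ := List.mem_map.1 hi
  simp

theorem endsMeasured_flag (x : Fin n₁) : EndsMeasured b.dual (.flag x) (extraction n₁ n₂ b) :=
  .append_right (.append_left (.append_left
    (.map_meas (List.nodup_finRange _) (fun _ _ h => Qubit.flag.inj h) (List.mem_finRange x))))
    (not_actsOn_of_mem_rowExtractions b (by simp) (by simp) (by simp))

theorem endsMeasured_rowAnc (y : Fin n₂) : EndsMeasured b (.rowAnc y) (extraction n₁ n₂ b) :=
  .append_left (.flatMap (List.nodup_finRange _) (List.mem_finRange y)
    (.append_left ⟨[couple b (.rowAnc y) (.rowFlag y)], [.meas b.dual (.rowFlag y)], rfl, by simp⟩)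
    fun _ hy' => not_actsOn_of_mem_rowExtraction b (by simpa using hy'.symm) (by simp) (by simp))

theorem endsMeasured_rowFlag (y : Fin n₂) :
    EndsMeasured b.dual (.rowFlag y) (extraction n₁ n₂ b) :=
  .append_left (.flatMap (List.nodup_finRange _) (List.mem_finRange y)
    (.append_left ⟨[couple b (.rowAnc y) (.rowFlag y), .meas b (.rowAnc y)], [], rfl, by simp⟩)
    fun _ hy' => not_actsOn_of_mem_rowExtraction b (by simp) (by simpa using hy'.symm) (by simp))

end Extraction

/-! ## Layers of the extraction circuits -/

section Layers

variable {n₁ n₂ : ℕ}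

/-- The qubits as a disjoint union of registers, over which sums can be split. -/
def Qubit.equivSum :
    (Fin n₁ × Fin n₂) ⊕ Fin n₁ ⊕ Fin n₁ ⊕ Unit ⊕ Fin n₂ ⊕ Fin n₂ ≃ Qubit n₁ n₂ where
  toFun
    | .inl p => .data p.1 p.2
    | .inr (.inl x) => .anc x
    | .inr (.inr (.inl x)) => .flag x
    | .inr (.inr (.inr (.inl _))) => .check
    | .inr (.inr (.inr (.inr (.inl y)))) => .rowAnc y
    | .inr (.inr (.inr (.inr (.inr y)))) => .rowFlag y
  invFun
    | .data x y => .inl (x, y)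
    | .anc x => .inr (.inl x)
    | .flag x => .inr (.inr (.inl x))
    | .check => .inr (.inr (.inr (.inl ())))
    | .rowAnc y => .inr (.inr (.inr (.inr (.inl y))))
    | .rowFlag y => .inr (.inr (.inr (.inr (.inr y))))
  left_inv p := by rcases p with _ | _ | _ | _ | _ | _ <;> rfl
  right_inv q := by cases q <;> rfl

instance : Fintype (Qubit n₁ n₂) := Fintype.ofEquiv _ Qubit.equivSum

variable {M : Type*}

/-- A function of the qubits, given by its restrictions to the registers: data, high-level ancilla,
its flags, verification, low-level ancillas, and their flags. -/
def table (d : Fin n₁ → Fin n₂ → M) (an fl : Fin n₁ → M) (ck : M) (ra rf : Fin n₂ → M) :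
    Qubit n₁ n₂ → M
  | .data x y => d x y
  | .anc x => an x
  | .flag x => fl x
  | .check => ck
  | .rowAnc y => ra y
  | .rowFlag y => rf y

variable [AddCommGroup M]

theorem pullback_couple (b : Basis) (c t : Qubit n₁ n₂) (S : Qubit n₁ n₂ → M) :
    (couple b c t).pullback b S = Function.update S c (S c + S t) := by
  cases b <;> rfl

theorem pullback_dual_couple (b : Basis) (c t : Qubit n₁ n₂) (S : Qubit n₁ n₂ → M) :
    (couple b c t).pullback b.dual S = Function.update S t (S t + S c) := by
  cases b <;> rfl

variable [Module (ZMod 2) M]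

theorem linearCombination_table (d : Fin n₁ → Fin n₂ → M) (an fl : Fin n₁ → M) (ck : M)
    (ra rf : Fin n₂ → M) (f : Qubit n₁ n₂ → ZMod 2) :
    Fintype.linearCombination (ZMod 2) (table d an fl ck ra rf) f =
      ∑ x, ∑ y, f (.data x y) • d x y + ∑ x, f (.anc x) • an x + ∑ x, f (.flag x) • fl x +
        f .check • ck + ∑ y, f (.rowAnc y) • ra y + ∑ y, f (.rowFlag y) • rf y := by
  rw [Fintype.linearCombination_apply, ← Equiv.sum_comp Qubit.equivSum]
  simp only [Fintype.sum_sum_type, Fintype.sum_prod_type, Finset.univ_unique,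
    Finset.sum_singleton]
  simp only [Qubit.equivSum, Equiv.coe_fn_mk, table, add_assoc]

variable {a b : Basis} {E : Set M} {G : Submodule (ZMod 2) M}

theorem effectsIn_couple {c t : Qubit n₁ n₂} {S : Qubit n₁ n₂ → M} :
    (couple b c t).EffectsIn a E G S ↔ S c ∈ E ∧ S t ∈ E ∧ S c + S t ∈ E := by
  cases b
  · rfl
  · simp only [couple, Instr.EffectsIn, add_comm (S t)]
    tauto

theorem PullsBack.map_couple {ι : Type*} {l : List ι} (hl : l.Nodup) {c t : ι → Qubit n₁ n₂}
    (hc : Function.Injective c) (htc : ∀ i j, t i ≠ c j) {S S' : Qubit n₁ n₂ → M}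
    (hE : ∀ i, S (c i) ∈ E ∧ S (t i) ∈ E ∧ S (c i) + S (t i) ∈ E)
    (hS : ∀ i, S' (c i) = S (c i) + S (t i)) (hS' : ∀ q, (∀ i ∈ l, q ≠ c i) → S' q = S q) :
    PullsBack b E G (l.map fun i => couple b (c i) (t i)) S S' := by
  refine .layer hl hS' fun i T hT => ?_
  have hTc : T (c i) = S (c i) := hT _ fun j hj h => hj (hc h).symm
  have hTt : T (t i) = S (t i) := hT _ fun j _ => htc i j
  rw [effectsIn_couple, pullback_couple, hTc, hTt, hS]
  exact ⟨hE i, rfl⟩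

theorem PullsBack.map_couple_dual {ι : Type*} {l : List ι} (hl : l.Nodup) {c t : ι → Qubit n₁ n₂}
    (ht : Function.Injective t) (hct : ∀ i j, c i ≠ t j) {S S' : Qubit n₁ n₂ → M}
    (hE : ∀ i, S (c i) ∈ E ∧ S (t i) ∈ E ∧ S (c i) + S (t i) ∈ E)
    (hS : ∀ i, S' (t i) = S (t i) + S (c i)) (hS' : ∀ q, (∀ i ∈ l, q ≠ t i) → S' q = S q) :
    PullsBack b.dual E G (l.map fun i => couple b (c i) (t i)) S S' := by
  refine .layer hl hS' fun i T hT => ?_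
  have hTc : T (c i) = S (c i) := hT _ fun j _ => hct i j
  have hTt : T (t i) = S (t i) := hT _ fun j hj h => hj (ht h).symm
  rw [effectsIn_couple, pullback_dual_couple, hTc, hTt, hS]
  exact ⟨hE i, rfl⟩

end Layers

/-! ## Errors that are not detected by the extraction -/

section Strings

variable {n₁ n₂ : ℕ}

theorem ite_add_ite_eq_symmDiff {α : Type*} [DecidableEq α] (S T : Finset α) (i : α) :
    ((if i ∈ S then 1 else 0) + (if i ∈ T then 1 else 0) : ZMod 2) =
      if i ∈ symmDiff S T then 1 else 0 := by
  by_cases hS : i ∈ S <;> by_cases hT : i ∈ T <;>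
    simp [Finset.mem_symmDiff, hS, hT, CharTwo.add_self_eq_zero]

theorem symmDiff_singleton_of_notMem {α : Type*} [DecidableEq α] {S : Finset α} {i : α}
    (h : i ∉ S) : symmDiff S {i} = insert i S := by
  ext j
  by_cases hj : j = i <;> simp [Finset.mem_symmDiff, hj, h]

theorem symmDiff_even_odd {n : ℕ} :
    symmDiff (Finset.univ.filter fun i : Fin n => Even i.val)
      (Finset.univ.filter fun i : Fin n => Odd i.val) = Finset.univ := by
  ext i
  by_cases h : Odd i.val <;> simp [Finset.mem_symmDiff, h, ← Nat.not_odd_iff_even]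

theorem vString_add_vString (x : Fin n₁) (S T : Finset (Fin n₂)) :
    vString x S + vString x T = vString x (symmDiff S T) := by
  ext i j
  by_cases h : i = x
  · simpa [vString, h] using ite_add_ite_eq_symmDiff S T j
  · simp [vString, h]

theorem hString_add_hString (S T : Finset (Fin n₁)) (y : Fin n₂) :
    hString S y + hString T y = hString (symmDiff S T) y := by
  ext i j
  by_cases h : j = y
  · simpa [hString, h] using ite_add_ite_eq_symmDiff S T i
  · simp [hString, h]

theorem vString_singleton (x : Fin n₁) (y : Fin n₂) : vString x {y} = hString {x} y := by
  ext i j; simp [vString, hString]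

theorem vString_empty (x : Fin n₁) : (vString x ∅ : Grid n₁ n₂) = 0 := by
  ext i j; simp [vString]

theorem hString_empty (y : Fin n₂) : (hString ∅ y : Grid n₁ n₂) = 0 := by
  ext i j; simp [hString]

theorem sum_smul_vString (e : Grid n₁ n₂) : ∑ x, ∑ y, e x y • (vString x {y} : Grid n₁ n₂) = e := by
  ext i j
  simp [Finset.sum_apply, vString, ite_and]

theorem hString_univ_mem_stabilizers (y : Fin n₂) :
    (hString Finset.univ y : Grid n₁ n₂) ∈ stabilizers n₁ n₂ :=
  Submodule.subset_span (.inl ⟨y, rfl⟩)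

theorem vString_univ_add_mem_stabilizers (x x' : Fin n₁) :
    (vString x Finset.univ + vString x' Finset.univ : Grid n₁ n₂) ∈ stabilizers n₁ n₂ :=
  Submodule.subset_span (.inr ⟨(x, x'), rfl⟩)

theorem SameError.refl (e : Grid n₁ n₂) : SameError e e := by
  simp [SameError, (stabilizers n₁ n₂).zero_mem]

/-- The set of raised flags, or of nontrivial outcomes. -/
def ones {α : Type*} [Fintype α] (f : α → ZMod 2) : Finset α := {i | f i = 1}

theorem ones_zero {α : Type*} [Fintype α] : ones (0 : α → ZMod 2) = ∅ := by simp [ones]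

theorem ones_single {α : Type*} [Fintype α] [DecidableEq α] (i : α) :
    ones (Pi.single i 1) = {i} := by
  ext j; by_cases h : j = i <;> simp [ones, h]

end Strings

section Hook

variable {n₁ n₂ : ℕ}

/-- An error, with the flags of the columns and of the rows. -/
abbrev Flagged (n₁ n₂ : ℕ) := Grid n₁ n₂ × (Fin n₁ → ZMod 2) × (Fin n₂ → ZMod 2)

variable (n₁ n₂) in
/-- The effects of a single fault on the errors of the type of the extracted stabilizers, and on
their flags: those of generalized weight at most one. -/
def hookEffects : Set (Flagged n₁ n₂) :=
  {m | IsGenWeightLeOne m.1 (ones m.2.1) (ones m.2.2)}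

variable (n₁ n₂) in
/-- Unflagged stabilizers, the gauge freedom of the errors of the type of the extracted
stabilizers. -/
def hookGauge : Submodule (ZMod 2) (Flagged n₁ n₂) := (stabilizers n₁ n₂).prod ⊥

/-- A string in an unflagged column. -/
def colErr (x : Fin n₁) (S : Finset (Fin n₂)) : Flagged n₁ n₂ := (vString x S, 0, 0)

/-- A string in a flagged column, the effect of a hook error of the high-level extraction. -/
def colHook (x : Fin n₁) (S : Finset (Fin n₂)) : Flagged n₁ n₂ := (vString x S, Pi.single x 1, 0)

/-- A string in a flagged row, the effect of a hook error of the low-level extraction. -/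
def rowHook (S : Finset (Fin n₁)) (y : Fin n₂) : Flagged n₁ n₂ := (hString S y, 0, Pi.single y 1)

theorem mem_hookEffects_of_mem_hookGauge {m : Flagged n₁ n₂} (h : m ∈ hookGauge n₁ n₂) :
    m ∈ hookEffects n₁ n₂ := by
  obtain ⟨hstab, hflags⟩ := Submodule.mem_prod.1 h
  rw [Submodule.mem_bot] at hflags
  exact .inl ⟨by simpa [SameError] using hstab, by simp [hflags, ones_zero],
    by simp [hflags, ones_zero]⟩

theorem zero_mem_hookEffects : (0 : Flagged n₁ n₂) ∈ hookEffects n₁ n₂ :=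
  mem_hookEffects_of_mem_hookGauge (Submodule.zero_mem _)

theorem colErr_singleton_mem (x : Fin n₁) (y : Fin n₂) : colErr x {y} ∈ hookEffects n₁ n₂ :=
  .inr (.inl ⟨x, y, SameError.refl _, ones_zero, ones_zero⟩)

theorem colErr_univ_mem (x : Fin n₁) : colErr x Finset.univ ∈ hookEffects n₁ n₂ :=
  .inr (.inr (.inr (.inr ⟨x, SameError.refl _, ones_zero, ones_zero⟩)))

theorem colHook_mem (x : Fin n₁) (S : Finset (Fin n₂)) : colHook x S ∈ hookEffects n₁ n₂ :=
  .inr (.inr (.inl ⟨x, S, SameError.refl _, ones_single x, ones_zero⟩))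

theorem rowHook_mem (S : Finset (Fin n₁)) (y : Fin n₂) : rowHook S y ∈ hookEffects n₁ n₂ :=
  .inr (.inr (.inr (.inl ⟨y, S, SameError.refl _, ones_zero, ones_single y⟩)))

theorem colErr_univ_add_mem_hookGauge (x x' : Fin n₁) :
    (colErr x Finset.univ + colErr x' Finset.univ : Flagged n₁ n₂) ∈ hookGauge n₁ n₂ :=
  Submodule.mem_prod.2 ⟨vString_univ_add_mem_stabilizers x x', by simp [colErr]⟩

theorem colErr_univ_add_mem (x x' : Fin n₁) :
    (colErr x Finset.univ + colErr x' Finset.univ : Flagged n₁ n₂) ∈ hookEffects n₁ n₂ :=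
  mem_hookEffects_of_mem_hookGauge (colErr_univ_add_mem_hookGauge x x')

theorem colHook_add_colErr (x : Fin n₁) {S : Finset (Fin n₂)} {y : Fin n₂} (h : y ∉ S) :
    colHook x S + colErr x {y} = colHook x (insert y S) := by
  simp [colHook, colErr, vString_add_vString, symmDiff_singleton_of_notMem h]

theorem rowHook_add_colErr {S : Finset (Fin n₁)} {x : Fin n₁} (y : Fin n₂) (h : x ∉ S) :
    rowHook S y + colErr x {y} = rowHook (insert x S) y := by
  simp [rowHook, colErr, vString_singleton, hString_add_hString, symmDiff_singleton_of_notMem h]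

theorem colHook_even_add_odd (x : Fin n₁) :
    colHook x ({y | Even y.val} : Finset (Fin n₂)) + colHook x {y | Odd y.val} =
      colErr x Finset.univ := by
  simp [colHook, colErr, vString_add_vString, symmDiff_even_odd, ZModModule.add_self,
    Prod.ext_iff]

theorem rowHook_even_add_odd_mem_hookGauge (y : Fin n₂) :
    rowHook ({x | Even x.val} : Finset (Fin n₁)) y + rowHook {x | Odd x.val} y ∈
      hookGauge n₁ n₂ := by
  simp [rowHook, hookGauge, Submodule.mem_prod, hString_add_hString, symmDiff_even_odd,
    ZModModule.add_self, hString_univ_mem_stabilizers]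

theorem pullsBack_hook_couple_row (b : Basis) (y : Fin n₂) {A B : Finset (Fin n₂)} (hA : y ∉ A)
    (hB : y ∉ B) (ck : Flagged n₁ n₂) (ra rf : Fin n₂ → Flagged n₁ n₂) :
    PullsBack b (hookEffects n₁ n₂) (hookGauge n₁ n₂)
      ((List.finRange n₁).map fun x =>
        couple b (if Even y.val then .anc x else .flag x) (.data x y))
      (table (fun x y => colErr x {y}) (fun x => colHook x A) (fun x => colHook x B) ck ra rf)
      (table (fun x y => colErr x {y})
        (fun x => colHook x (if Even y.val then insert y A else A))
        (fun x => colHook x (if Even y.val then B else insert y B)) ck ra rf) := by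
  by_cases hy : Even y.val
  · simp only [hy, if_true]
    refine .map_couple (List.nodup_finRange _) (c := .anc) (t := fun x => .data x y)
      (fun _ _ => Qubit.anc.inj) (by simp) (fun x => ?_)
      (fun x => (colHook_add_colErr x hA).symm) ?_
    · simp only [table, colHook_add_colErr x hA]
      exact ⟨colHook_mem x _, colErr_singleton_mem x y, colHook_mem x _⟩
    · rintro (_ | _ | _ | _ | _ | _) hq <;> simp_all [table]
  · simp only [hy, if_false]
    refine .map_couple (List.nodup_finRange _) (c := .flag) (t := fun x => .data x y)
      (fun _ _ => Qubit.flag.inj) (by simp) (fun x => ?_)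
      (fun x => (colHook_add_colErr x hB).symm) ?_
    · simp only [table, colHook_add_colErr x hB]
      exact ⟨colHook_mem x _, colErr_singleton_mem x y, colHook_mem x _⟩
    · rintro (_ | _ | _ | _ | _ | _) hq <;> simp_all [table]

theorem pullsBack_hook_couple_rows (b : Basis) (ck : Flagged n₁ n₂)
    (ra rf : Fin n₂ → Flagged n₁ n₂) :
    PullsBack b (hookEffects n₁ n₂) (hookGauge n₁ n₂)
      ((List.finRange n₂).flatMap fun y => (List.finRange n₁).map fun x =>
        couple b (if Even y.val then .anc x else .flag x) (.data x y))
      (table (fun x y => colErr x {y}) (fun x => colHook x ∅) (fun x => colHook x ∅) ck ra rf)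
      (table (fun x y => colErr x {y}) (fun x => colHook x {y | Even y.val})
        (fun x => colHook x {y | Odd y.val}) ck ra rf) := by
  have huniv : (List.finRange n₂).toFinset = Finset.univ := by ext; simp
  have := PullsBack.flatMap_of_suffix (a := b) (E := hookEffects n₁ n₂) (G := hookGauge n₁ n₂)
    (fun y => (List.finRange n₁).map fun x =>
      couple b (if Even y.val then .anc x else .flag x) (.data x y))
    (fun l => table (fun x y => colErr x {y})
      (fun x => colHook x (l.toFinset.filter fun y => Even y.val))
      (fun x => colHook x (l.toFinset.filter fun y => Odd y.val)) ck ra rf)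
    (List.finRange n₂) fun y l hs => ?_
  · simpa only [huniv, List.toFinset_nil, Finset.filter_empty] using this
  · have hy : y ∉ l := notMem_of_cons_suffix (List.nodup_finRange n₂) hs
    simpa only [List.toFinset_cons, Finset.filter_insert, ← Nat.not_even_iff_odd, ite_not] using
      pullsBack_hook_couple_row b y (A := l.toFinset.filter fun y => Even y.val)
        (B := l.toFinset.filter fun y => Odd y.val) (by simp [hy]) (by simp [hy]) ck ra rf

theorem pullsBack_hook_couple_bell (b : Basis) (y : Fin n₂) {S : Qubit n₁ n₂ → Flagged n₁ n₂}
    (hdata : ∀ x, S (.data x y) = colErr x {y}) (hanc : S (.rowAnc y) = rowHook ∅ y)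
    (hflag : S (.rowFlag y) = rowHook ∅ y) :
    PullsBack b (hookEffects n₁ n₂) (hookGauge n₁ n₂)
      ((List.finRange n₁).map fun x =>
        couple b (if Even x.val then .rowAnc y else .rowFlag y) (.data x y))
      S (Function.update (Function.update S (.rowAnc y) (rowHook {x | Even x.val} y))
        (.rowFlag y) (rowHook {x | Odd x.val} y)) := by
  let T (l : List (Fin n₁)) := Function.update (Function.update S (.rowAnc y)
    (rowHook (l.toFinset.filter fun x => Even x.val) y))
    (.rowFlag y) (rowHook (l.toFinset.filter fun x => Odd x.val) y)
  have hnil : T [] = S := by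
    simp only [T, List.toFinset_nil, Finset.filter_empty]
    rw [← hanc, Function.update_eq_self, hanc, ← hflag, Function.update_eq_self]
  have huniv : (List.finRange n₁).toFinset = Finset.univ := by ext; simp
  have := PullsBack.map_of_suffix (a := b) (E := hookEffects n₁ n₂) (G := hookGauge n₁ n₂)
    (fun x => couple b (if Even x.val then .rowAnc y else .rowFlag y) (.data x y)) T
    (List.finRange n₁) fun x l hs => ?_
  · rw [hnil] at this
    simpa only [T, huniv] using this
  · have hx : x ∉ l := notMem_of_cons_suffix (List.nodup_finRange n₁) hs
    rw [effectsIn_couple, pullback_couple]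
    by_cases he : Even x.val
    · have ho : ¬ Odd x.val := Nat.not_odd_iff_even.2 he
      simp [T, hdata, he, ho, hx, Finset.filter_insert, rowHook_add_colErr, rowHook_mem,
        colErr_singleton_mem, Function.update_comm]
    · have ho : Odd x.val := Nat.not_even_iff_odd.1 he
      simp [T, hdata, he, ho, hx, Finset.filter_insert, rowHook_add_colErr, rowHook_mem,
        colErr_singleton_mem]

end Hook

section Hook

variable {n₁ n₂ : ℕ}

theorem pullsBack_hook_row (b : Basis) (y : Fin n₂) {S : Qubit n₁ n₂ → Flagged n₁ n₂}
    (hdata : ∀ x, S (.data x y) = colErr x {y}) (hanc : S (.rowAnc y) = 0)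
    (hflag : S (.rowFlag y) = rowHook ∅ y) :
    PullsBack b (hookEffects n₁ n₂) (hookGauge n₁ n₂) (rowExtraction n₁ n₂ b y) S
      (Function.update S (.rowFlag y) 0) := by
  have hsum := rowHook_even_add_odd_mem_hookGauge (n₁ := n₁) y
  have measure : PullsBack b (hookEffects n₁ n₂) (hookGauge n₁ n₂)
      [couple b (.rowAnc y) (.rowFlag y), .meas b (.rowAnc y), .meas b.dual (.rowFlag y)]
      S (Function.update S (.rowAnc y) (rowHook ∅ y)) := by
    refine .cons (.cons (.cons (.nil S) ?_ rfl) ?_ rfl) ?_ ?_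
    · simp [Instr.EffectsIn, hflag, rowHook_mem]
    · simp [Instr.EffectsIn, Instr.pullback, hanc, zero_mem_hookEffects]
    · simp [effectsIn_couple, Instr.pullback, hanc, hflag, zero_mem_hookEffects, rowHook_mem]
    · rw [pullback_couple]
      simp [Instr.pullback, hanc, hflag]
  refine .append (.append ?_ (pullsBack_hook_couple_bell b y ?_ ?_ ?_)) measure
  · refine .cons (.cons (.cons (.nil _) ?_ (pullback_couple _ _ _ _)) ?_ rfl) ?_ ?_
    · simp [effectsIn_couple, rowHook_mem, mem_hookEffects_of_mem_hookGauge hsum]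
    · simp [Instr.EffectsIn, rowHook_mem, b.dual_ne.symm]
    · simp [Instr.EffectsIn, Instr.pullback, hsum, mem_hookEffects_of_mem_hookGauge hsum]
    · ext1 q
      by_cases ha : q = .rowAnc y <;> by_cases hf : q = .rowFlag y <;>
        simp_all [Instr.pullback]
  · simpa using hdata
  · simp
  · simpa using hflag

theorem pullsBack_hook_rows (b : Basis) (an fl : Fin n₁ → Flagged n₁ n₂) (ck : Flagged n₁ n₂) :
    PullsBack b (hookEffects n₁ n₂) (hookGauge n₁ n₂)
      ((List.finRange n₂).flatMap (rowExtraction n₁ n₂ b))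
      (table (fun x y => colErr x {y}) an fl ck 0 (rowHook ∅))
      (table (fun x y => colErr x {y}) an fl ck 0 0) := by
  have := PullsBack.flatMap_of_suffix (a := b) (E := hookEffects n₁ n₂) (G := hookGauge n₁ n₂)
    (rowExtraction n₁ n₂ b) (fun l => table (fun x y => colErr x {y}) an fl ck 0
      (fun y => if y ∈ l then 0 else rowHook ∅ y))
    (List.finRange n₂) fun y l hs => ?_
  · simp only [List.not_mem_nil, if_false, List.mem_finRange, if_true] at this
    exact this
  · have hy : y ∉ l := notMem_of_cons_suffix (List.nodup_finRange n₂) hs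
    convert pullsBack_hook_row b y (S := table (fun x y => colErr x {y}) an fl ck 0
      (fun y => if y ∈ l then 0 else rowHook ∅ y)) (fun _ => rfl) rfl (if_neg hy) using 1
    ext1 q
    rcases q with _ | _ | _ | _ | _ | y' <;> simp only [table, ne_eq, reduceCtorEq,
      not_false_eq_true, Function.update_of_ne]
    by_cases h : y' = y <;> simp [h, table]

theorem pullsBack_hook_high (b : Basis) (ck : Flagged n₁ n₂) (ra rf : Fin n₂ → Flagged n₁ n₂) :
    PullsBack b (hookEffects n₁ n₂) (hookGauge n₁ n₂) (highExtraction n₁ n₂ b)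
      (table (fun x y => colErr x {y}) 0 (fun x => colHook x ∅) ck ra rf)
      (table (fun x y => colErr x {y}) (fun x => colErr x Finset.univ) 0 ck ra rf) := by
  have hnd := List.nodup_finRange n₁
  have hzero : (0 : Flagged n₁ n₂) ∈ hookEffects n₁ n₂ := zero_mem_hookEffects
  refine .append ?_ (.map_meas _ (u := Qubit.flag) (fun x => colHook_mem x ∅) _)
  refine .append ?_ (.map_meas _ (u := Qubit.anc) (fun _ => hzero) _)
  refine .append (S' := table (fun x y => colErr x {y}) (fun x => colHook x ∅)
    (fun x => colHook x ∅) ck ra rf) ?_ ?_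
  · refine .append (.append (S' := table (fun x y => colErr x {y}) (fun x => colErr x Finset.univ)
      (fun x => colHook x {y | Odd y.val}) ck ra rf) ?_ ?_)
      (pullsBack_hook_couple_rows b ck ra rf)
    · refine .map_prep hnd (fun _ _ => Qubit.flag.inj) (fun x => colHook_mem x _)
        (fun x h => absurd h.symm b.dual_ne) (fun x => rfl) ?_
      rintro (_ | _ | _ | _ | _ | _) hq <;> simp_all [table]
    · refine .map_couple hnd (fun _ _ => Qubit.anc.inj) (by simp) (fun x => ?_)
        (fun x => (colHook_even_add_odd x).symm) ?_
      · refine ⟨colHook_mem x _, colHook_mem x _, ?_⟩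
        simpa only [table, colHook_even_add_odd] using colErr_univ_mem x
      · rintro (_ | _ | _ | _ | _ | _) hq <;> simp_all [table]
  · refine .map_couple hnd (fun _ _ => Qubit.anc.inj) (by simp) (fun x => ?_)
      (fun x => (zero_add _).symm) ?_
    · simpa [table, colHook_mem] using zero_mem_hookEffects
    · rintro (_ | _ | _ | _ | _ | _) hq <;> simp_all [table]

theorem treeParent_le (x : Fin n₁) : treeParent x ≤ x := Nat.sub_le _ _

variable (n₁) in
/-- The qubits of the tree other than the root, which are the controls of its gates. -/
abbrev treeControls : List (Fin n₁) := (List.finRange n₁).filter fun x => x.val ≠ 0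

theorem mem_iff_of_cons_suffix {ι : Type*} [Preorder ι] {x x' : ι} {l l₀ : List ι}
    (hl₀ : l₀.Pairwise (· < ·)) (h : x :: l <:+ l₀) : x' ∈ l ↔ x' ∈ l₀ ∧ x < x' := by
  refine ⟨fun hx' => ⟨(l.suffix_cons x |>.trans h).mem hx',
    (List.pairwise_cons.1 (hl₀.sublist h.sublist)).1 x' hx'⟩, fun ⟨hmem, hlt⟩ => ?_⟩
  obtain ⟨l₁, rfl⟩ := h
  rcases List.mem_append.1 hmem with hm | hm
  · exact absurd ((List.pairwise_append.1 hl₀).2.2 x' hm x List.mem_cons_self) hlt.not_gt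
  · exact (List.mem_cons.1 hm).resolve_left hlt.ne'

theorem pullsBack_hook_tree (b : Basis) (fl : Fin n₁ → Flagged n₁ n₂) (ck : Flagged n₁ n₂)
    (ra rf : Fin n₂ → Flagged n₁ n₂) :
    PullsBack b (hookEffects n₁ n₂) (hookGauge n₁ n₂)
      ((treeControls n₁).map fun x => couple b (.anc x) (.anc (treeParent x)))
      (table (fun x y => colErr x {y}) (fun x => colErr x Finset.univ) fl ck ra rf)
      (table (fun x y => colErr x {y}) (fun x => if x.val = 0 then colErr x Finset.univ else
        colErr x Finset.univ + colErr (treeParent x) Finset.univ) fl ck ra rf) := by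
  have := PullsBack.map_of_suffix (a := b) (E := hookEffects n₁ n₂) (G := hookGauge n₁ n₂)
    (fun x => couple b (.anc x) (.anc (treeParent x)))
    (fun l => table (fun x y => colErr x {y}) (fun x => if x ∈ l then
      colErr x Finset.univ + colErr (treeParent x) Finset.univ else colErr x Finset.univ)
      fl ck ra rf) (treeControls n₁) fun x l hs => ?_
  · simpa using this
  · have hlt {x'} (h : x' ∈ l) : x < x' :=
      ((mem_iff_of_cons_suffix ((List.pairwise_lt_finRange n₁).filter _) hs).1 h).2
    have hx : x ∉ l := fun h => (hlt h).false
    have hp : treeParent x ∉ l := fun h => (hlt h).not_ge (treeParent_le x)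
    rw [effectsIn_couple, pullback_couple]
    refine ⟨by simp [table, hx, hp, colErr_univ_mem, colErr_univ_add_mem], funext fun q => ?_⟩
    rcases q with _ | x' | _ | _ | _ | _ <;> simp only [table, ne_eq, reduceCtorEq,
      not_false_eq_true, Function.update_of_ne]
    by_cases h : x' = x <;> simp [h, hx, hp, table]

theorem finRange_filter_ends (k : ℕ) :
    (List.finRange (k + 2)).filter (fun x => k + 2 ≤ x.val + 2) =
      [(Fin.last k).castSucc, Fin.last (k + 1)] := by
  rw [List.finRange_succ_last, List.finRange_succ_last]
  simp [List.filter_map, Function.comp_def]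

theorem pullsBack_hook_preparation {k : ℕ} (b : Basis) (fl : Fin (k + 2) → Flagged (k + 2) n₂)
    (ra rf : Fin n₂ → Flagged (k + 2) n₂) :
    PullsBack b (hookEffects (k + 2) n₂) (hookGauge (k + 2) n₂) (ancillaPreparation (k + 2) n₂ b)
      (table (fun x y => colErr x {y}) (fun x => colErr x Finset.univ) fl 0 ra rf)
      (table (fun x y => colErr x {y}) 0 fl 0 ra rf) := by
  rw [ancillaPreparation, finRange_filter_ends]
  refine .append ?_ (.cons (.nil _) zero_mem_hookEffects rfl)
  refine .append (S' := table (fun x y => colErr x {y}) (fun x => colErr x Finset.univ) fl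
    (colErr (Fin.last (k + 1)) Finset.univ + colErr (Fin.last k).castSucc Finset.univ) ra rf) ?_
    (.cons (.cons (.nil _) ?_ (pullback_couple _ _ _ _)) ?_ ?_)
  · refine .append (.append ?_ (pullsBack_hook_tree b fl 0 ra rf)) (.cons (.nil _)
      ⟨colErr_univ_add_mem _ _, fun _ => colErr_univ_add_mem_hookGauge _ _⟩ ?_)
    · refine .map_prep (List.nodup_finRange _) (fun _ _ => Qubit.anc.inj) (fun x => ?_)
        (fun x hx => ?_) (fun x => rfl) ?_
      · simp only [table]
        split_ifs
        exacts [colErr_univ_mem x, colErr_univ_add_mem _ _]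
      · simp only [table]
        split_ifs at hx ⊢
        exacts [absurd hx.symm b.dual_ne, colErr_univ_add_mem_hookGauge _ _]
      · rintro (_ | _ | _ | _ | _ | _) hq <;> simp_all [table]
    · ext1 q
      cases q <;> simp [Instr.pullback, table]
  · simp [effectsIn_couple, Instr.pullback, table, zero_mem_hookEffects, colErr_univ_mem]
  · simp [effectsIn_couple, Instr.pullback, table, colErr_univ_mem, colErr_univ_add_mem]
  · rw [pullback_couple]
    ext1 q
    cases q <;> simp [Instr.pullback, table]

theorem pullsBack_hook {k : ℕ} (b : Basis) :
    PullsBack b (hookEffects (k + 2) n₂) (hookGauge (k + 2) n₂) (extraction (k + 2) n₂ b)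
      (table (fun x y => colErr x {y}) 0 (fun x => colHook x ∅) 0 0 (rowHook ∅))
      (table (fun x y => colErr x {y}) 0 0 0 0 0) :=
  ((pullsBack_hook_preparation b _ _ _).append (pullsBack_hook_high b _ _ _)).append
    (pullsBack_hook_rows b _ _ _)

/-- The data frame at the beginning of a half cycle. -/
def dataFrame (e : Grid n₁ n₂) : Qubit n₁ n₂ → ZMod 2
  | .data x y => e x y
  | _ => 0

theorem linearCombination_hook (f : Qubit n₁ n₂ → ZMod 2) :
    Fintype.linearCombination (ZMod 2) (table (fun x y => colErr x {y}) 0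
      (fun x => colHook x ∅) 0 0 (rowHook ∅)) f =
      ((fun x y => f (.data x y), fun x => f (.flag x), fun y => f (.rowFlag y)) :
        Flagged n₁ n₂) := by
  rw [linearCombination_table]
  refine Prod.ext ?_ (Prod.ext ?_ ?_)
  · simpa [Prod.fst_sum, colErr, colHook, rowHook, vString_empty, hString_empty] using
      sum_smul_vString fun x y => f (.data x y)
  · ext x
    simp [Prod.fst_sum, Prod.snd_sum, colErr, colHook, rowHook, Pi.single_apply]
  · ext y
    simp [Prod.snd_sum, colErr, colHook, rowHook, Pi.single_apply]

theorem linearCombination_dataFrame_hook (e : Grid n₁ n₂) :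
    Fintype.linearCombination (ZMod 2) (table (fun x y => colErr x {y}) 0 0 0 0 0)
      (dataFrame e) = ((e, 0, 0) : Flagged n₁ n₂) := by
  rw [linearCombination_table]
  refine Prod.ext ?_ (Prod.ext ?_ ?_)
  · simpa [Prod.fst_sum, colErr, dataFrame] using sum_smul_vString e
  · simp [Prod.snd_sum, colErr]
  · simp [Prod.snd_sum, colErr]

theorem exists_hookEffects {k : ℕ} {b : Basis} {L : List (Instr (Qubit (k + 2) n₂) × Event)}
    (hL : L.map Prod.fst = extraction (k + 2) n₂ b) (s : RunState (Qubit (k + 2) n₂))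
    {e : Grid (k + 2) n₂} (hs : s.frame b = dataFrame e) :
    ∃ g ∈ hookGauge (k + 2) n₂, ∃ es : List (Flagged (k + 2) n₂), es.length ≤ faults L ∧
      (∀ m ∈ es, m ∈ hookEffects (k + 2) n₂) ∧
      ((fun x y => (run L s).frame b (.data x y), fun x => (run L s).record (.flag x),
        fun y => (run L s).record (.rowFlag y)) : Flagged (k + 2) n₂) =
      (e, 0, 0) + g + es.sum := by
  obtain ⟨g, hg, es, hlen, hes, hrun⟩ :=
    PullsBack.exists_effects zero_mem_hookEffects (hL ▸ pullsBack_hook b) s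
  have hflag : ∀ x, (run L s).record (.flag x) = (run L s).frame b (.flag x) := fun x => by
    rw [(hL ▸ endsMeasured_flag b x : EndsMeasured _ _ (L.map Prod.fst)).record_eq, b.dual_dual]
  have hrowFlag : ∀ y, (run L s).record (.rowFlag y) = (run L s).frame b (.rowFlag y) :=
    fun y => by
      rw [(hL ▸ endsMeasured_rowFlag b y : EndsMeasured _ _ (L.map Prod.fst)).record_eq,
        b.dual_dual]
  refine ⟨g, hg, es, hlen, hes, ?_⟩
  simp only [hflag, hrowFlag, ← linearCombination_dataFrame_hook e, ← hs, ← hrun,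
    linearCombination_hook]

end Hook

/-! ## Faults and the detected errors -/

section Detect

variable {n₁ n₂ : ℕ}

/-- An error, with the flips of the verification of the high-level ancilla, of the high-level
outcomes, and of the low-level outcomes. -/
abbrev Observed (n₁ n₂ : ℕ) := Grid n₁ n₂ × ZMod 2 × (Fin n₁ → ZMod 2) × (Fin n₂ → ZMod 2)

/-- The effects of a single fault on the errors that are detected in a half cycle. A data error is
seen by both kinds of stabilizers if it occurs early, and by none if it occurs late. -/
inductive IsDetectEffect : Observed n₁ n₂ → Prop
  | gauge (t : ZMod 2) : IsDetectEffect (0, 0, fun _ => t, 0)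
  | high (x) : IsDetectEffect (0, 0, Pi.single x 1, 0)
  | low (y) : IsDetectEffect (0, 0, 0, Pi.single y 1)
  | late (x y) : IsDetectEffect (vString x {y}, 0, 0, 0)
  | mid (x y) : IsDetectEffect (vString x {y}, 0, 0, Pi.single y 1)
  | early (x y) : IsDetectEffect (vString x {y}, 0, Pi.single x 1, Pi.single y 1)
  | verify (h) : IsDetectEffect (0, 1, h, 0)

variable (n₁ n₂) in
/-- The set of effects of a single fault on the detected errors. -/
def detectEffects : Set (Observed n₁ n₂) := {m | IsDetectEffect m}

variable (n₁ n₂) in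
/-- Complementation of the high-level outcomes, the gauge freedom of the detected errors. -/
def detectGauge : Submodule (ZMod 2) (Observed n₁ n₂) :=
  Submodule.span (ZMod 2) {(0, 0, fun _ => 1, 0)}

/-- A data error that is not seen. -/
def dataFlip (x : Fin n₁) (y : Fin n₂) : Observed n₁ n₂ := (vString x {y}, 0, 0, 0)

/-- The flip of a high-level outcome. -/
def highFlip (x : Fin n₁) : Observed n₁ n₂ := (0, 0, Pi.single x 1, 0)

/-- The flip of a low-level outcome. -/
def lowFlip (y : Fin n₂) : Observed n₁ n₂ := (0, 0, 0, Pi.single y 1)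

/-- The flip of the outcome of the verification. -/
def checkFlip : Observed n₁ n₂ := (0, 1, 0, 0)

/-- The effect of an error inside the tree at `x` that propagates along the branch to the verified
end: every second outcome from `x` on is flipped. -/
def branchFlip (x : Fin n₁) : Observed n₁ n₂ :=
  (0, 1, fun x' => if x ≤ x' ∧ x'.val % 2 = x.val % 2 then 1 else 0, 0)

theorem zero_mem_detectEffects : (0 : Observed n₁ n₂) ∈ detectEffects n₁ n₂ := .gauge 0

theorem dataFlip_mem (x : Fin n₁) (y : Fin n₂) : dataFlip x y ∈ detectEffects n₁ n₂ := .late x y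

theorem highFlip_mem (x : Fin n₁) : highFlip x ∈ detectEffects n₁ n₂ := .high x

theorem lowFlip_mem (y : Fin n₂) : lowFlip y ∈ detectEffects n₁ n₂ := .low y

theorem checkFlip_mem : checkFlip ∈ detectEffects n₁ n₂ := .verify 0

theorem branchFlip_mem (x : Fin n₁) : branchFlip x ∈ detectEffects n₁ n₂ := .verify _

theorem dataFlip_add_lowFlip_mem (x : Fin n₁) (y : Fin n₂) :
    dataFlip x y + lowFlip y ∈ detectEffects n₁ n₂ := by
  simpa [detectEffects, dataFlip, lowFlip] using IsDetectEffect.mid x y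

theorem dataFlip_add_lowFlip_add_highFlip_mem (x : Fin n₁) (y : Fin n₂) :
    dataFlip x y + lowFlip y + highFlip x ∈ detectEffects n₁ n₂ := by
  simpa [detectEffects, dataFlip, lowFlip, highFlip] using IsDetectEffect.early x y

theorem pullsBack_detect_row (b : Basis) (y : Fin n₂) {d : Fin n₁ → Fin n₂ → Observed n₁ n₂}
    (an fl : Fin n₁ → Observed n₁ n₂) (ck : Observed n₁ n₂) {ra : Fin n₂ → Observed n₁ n₂}
    (hd : ∀ x, d x y = dataFlip x y) (hra : ra y = lowFlip y) :
    PullsBack b.dual (detectEffects n₁ n₂) (detectGauge n₁ n₂) (rowExtraction n₁ n₂ b y)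
      (table d an fl ck ra 0)
      (table (fun x => Function.update (d x) y (dataFlip x y + lowFlip y)) an fl ck
        (Function.update ra y 0) 0) := by
  have measure : PullsBack b.dual (detectEffects n₁ n₂) (detectGauge n₁ n₂)
      [couple b (.rowAnc y) (.rowFlag y), .meas b (.rowAnc y), .meas b.dual (.rowFlag y)]
      (table d an fl ck ra 0) (table d an fl ck ra (Pi.single y (lowFlip y))) := by
    refine .cons (.cons (.cons (.nil _) zero_mem_detectEffects rfl) ?_ rfl) ?_ ?_
    · exact (hra ▸ lowFlip_mem y : ra y ∈ detectEffects n₁ n₂)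
    · simp [effectsIn_couple, Instr.pullback, table, hra, zero_mem_detectEffects, lowFlip_mem]
    · rw [pullback_dual_couple]
      ext1 q
      rcases q with _ | _ | _ | _ | _ | y' <;> simp only [Instr.pullback, table, ne_eq,
        reduceCtorEq, not_false_eq_true, Function.update_of_ne]
      by_cases h : y' = y <;> simp [h, hra, table]
  refine .append (.append (S' := table (fun x => Function.update (d x) y
    (dataFlip x y + lowFlip y)) an fl ck ra (Pi.single y (lowFlip y))) ?_ ?_) measure
  · refine .cons (.cons (.cons (.nil _) ?_ (pullback_dual_couple _ _ _ _)) ?_ rfl) ?_ ?_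
    · simp [effectsIn_couple, table, hra, lowFlip_mem, ZModModule.add_self,
        zero_mem_detectEffects]
    · simp [Instr.EffectsIn, table, hra, ZModModule.add_self, zero_mem_detectEffects]
    · simp [Instr.EffectsIn, Instr.pullback, table, hra, lowFlip_mem, b.dual_ne]
    · ext1 q
      rcases q with _ | _ | _ | _ | y' | y' <;> simp only [Instr.pullback, table, ne_eq,
        reduceCtorEq, not_false_eq_true, Function.update_of_ne]
      all_goals by_cases h : y' = y <;> simp [h, table]
  · refine .map_couple_dual (List.nodup_finRange _) (t := fun x => .data x y)
      (c := fun x => if Even x.val then .rowAnc y else .rowFlag y)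
      (fun _ _ h => (Qubit.data.inj h).1) (fun _ _ => by split_ifs <;> simp) (fun x => ?_)
      (fun x => ?_) ?_
    · split_ifs <;> simp [table, hd, hra, lowFlip_mem, dataFlip_mem, add_comm (lowFlip y),
        dataFlip_add_lowFlip_mem]
    · split_ifs <;> simp [table, hd, hra]
    · rintro (⟨x', y'⟩ | _ | _ | _ | _ | _) hq <;> simp_all [table]

theorem pullsBack_detect_rows (b : Basis) (an fl : Fin n₁ → Observed n₁ n₂)
    (ck : Observed n₁ n₂) :
    PullsBack b.dual (detectEffects n₁ n₂) (detectGauge n₁ n₂)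
      ((List.finRange n₂).flatMap (rowExtraction n₁ n₂ b))
      (table dataFlip an fl ck lowFlip 0)
      (table (fun x y => dataFlip x y + lowFlip y) an fl ck 0 0) := by
  have := PullsBack.flatMap_of_suffix (a := b.dual) (E := detectEffects n₁ n₂)
    (G := detectGauge n₁ n₂) (rowExtraction n₁ n₂ b)
    (fun l => table (fun x y => if y ∈ l then dataFlip x y + lowFlip y else dataFlip x y)
      an fl ck (fun y => if y ∈ l then 0 else lowFlip y) 0) (List.finRange n₂) fun y l hs => ?_
  · simp only [List.not_mem_nil, if_false, List.mem_finRange, if_true] at this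
    exact this
  · have hy : y ∉ l := notMem_of_cons_suffix (List.nodup_finRange n₂) hs
    convert pullsBack_detect_row b y an fl ck (ra := fun y => if y ∈ l then 0 else lowFlip y)
      (d := fun x y => if y ∈ l then dataFlip x y + lowFlip y else dataFlip x y)
      (fun x => if_neg hy) (if_neg hy) using 2
    · ext1 x
      ext1 y'
      by_cases h : y' = y <;> simp [h]
    · ext1 y'
      by_cases h : y' = y <;> simp [h]

theorem pullsBack_detect_couple_rows (b : Basis) (ck : Observed n₁ n₂)
    (ra rf : Fin n₂ → Observed n₁ n₂) :
    PullsBack b.dual (detectEffects n₁ n₂) (detectGauge n₁ n₂)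
      ((List.finRange n₂).flatMap fun y => (List.finRange n₁).map fun x =>
        couple b (if Even y.val then .anc x else .flag x) (.data x y))
      (table (fun x y => dataFlip x y + lowFlip y) highFlip highFlip ck ra rf)
      (table (fun x y => dataFlip x y + lowFlip y + highFlip x) highFlip highFlip ck ra rf) := by
  have := PullsBack.flatMap_of_suffix (a := b.dual) (E := detectEffects n₁ n₂)
    (G := detectGauge n₁ n₂) (fun y => (List.finRange n₁).map fun x =>
      couple b (if Even y.val then .anc x else .flag x) (.data x y))
    (fun l => table (fun x y => if y ∈ l then dataFlip x y + lowFlip y + highFlip x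
      else dataFlip x y + lowFlip y) highFlip highFlip ck ra rf) (List.finRange n₂) fun y l hs => ?_
  · simpa using this
  · have hy : y ∉ l := notMem_of_cons_suffix (List.nodup_finRange n₂) hs
    refine .map_couple_dual (List.nodup_finRange _) (t := fun x => .data x y)
      (c := fun x => if Even y.val then .anc x else .flag x) (fun _ _ h => (Qubit.data.inj h).1)
      (fun _ _ => by split_ifs <;> simp) (fun x => ?_) (fun x => ?_) ?_
    · split_ifs <;> simp [table, hy, highFlip_mem, dataFlip_add_lowFlip_mem,
        add_comm (highFlip x), dataFlip_add_lowFlip_add_highFlip_mem]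
    · split_ifs <;> simp [table, hy]
    · rintro (⟨x', y'⟩ | _ | _ | _ | _ | _) hq <;> simp_all [table]

theorem pullsBack_detect_couple_flags (b : Basis) (d : Fin n₁ → Fin n₂ → Observed n₁ n₂)
    (ck : Observed n₁ n₂) (ra rf : Fin n₂ → Observed n₁ n₂) {fl : Fin n₁ → Observed n₁ n₂}
    (hfl : ∀ x, fl x ∈ detectEffects n₁ n₂) (hfl' : ∀ x, fl x + highFlip x ∈ detectEffects n₁ n₂) :
    PullsBack b.dual (detectEffects n₁ n₂) (detectGauge n₁ n₂)
      ((List.finRange n₁).map fun x => couple b (.anc x) (.flag x))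
      (table d highFlip fl ck ra rf) (table d highFlip (fl + highFlip) ck ra rf) := by
  refine .map_couple_dual (List.nodup_finRange _) (fun _ _ => Qubit.flag.inj) (by simp)
    (fun x => ⟨highFlip_mem x, hfl x, ?_⟩) (fun x => rfl) ?_
  · simpa only [table, add_comm (highFlip x)] using hfl' x
  · rintro (_ | _ | _ | _ | _ | _) hq <;> simp_all [table]

theorem pullsBack_detect_high (b : Basis) (ck : Observed n₁ n₂) (ra rf : Fin n₂ → Observed n₁ n₂) :
    PullsBack b.dual (detectEffects n₁ n₂) (detectGauge n₁ n₂) (highExtraction n₁ n₂ b)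
      (table (fun x y => dataFlip x y + lowFlip y) highFlip 0 ck ra rf)
      (table (fun x y => dataFlip x y + lowFlip y + highFlip x) highFlip 0 ck ra rf) := by
  have hzero : (0 : Observed n₁ n₂) ∈ detectEffects n₁ n₂ := zero_mem_detectEffects
  refine .append ?_ (.map_meas _ (u := Qubit.flag) (fun _ => hzero) _)
  refine .append ?_ (.map_meas _ (u := Qubit.anc) highFlip_mem _)
  refine .append ?_ (pullsBack_detect_couple_flags b _ ck ra rf (fun _ => hzero) fun x => ?_)
  · rw [zero_add]
    refine .append ?_ (pullsBack_detect_couple_rows b ck ra rf)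
    refine .append ?_ (pullsBack_detect_couple_flags b _ ck ra rf highFlip_mem fun x => ?_)
    · rw [ZModModule.add_self]
      refine .map_prep (List.nodup_finRange _) (fun _ _ => Qubit.flag.inj) (fun _ => hzero)
        (fun _ _ => Submodule.zero_mem _) (fun _ => rfl) fun _ _ => rfl
    · exact (ZModModule.add_self (highFlip x)).symm ▸ hzero
  · simpa using highFlip_mem x

theorem highFlip_add_branchFlip {k : ℕ} (x : Fin k) :
    (highFlip (x.castAdd 2) + branchFlip (x.addNat 2) : Observed (k + 2) n₂) =
      branchFlip (x.castAdd 2) := by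
  simp only [highFlip, branchFlip, Prod.mk_add_mk, zero_add, add_zero]
  refine congrArg (fun h => ((0, 1, h, 0) : Observed (k + 2) n₂)) (funext fun x' => ?_)
  simp only [Pi.add_apply, Pi.single_apply, Fin.ext_iff, Fin.le_def, Fin.val_castAdd,
    Fin.val_addNat]
  by_cases h : x'.val = x.val
  · simp [h]
  · have : x.val + 2 ≤ x'.val ∧ x'.val % 2 = (x.val + 2) % 2 ↔
        x.val ≤ x'.val ∧ x'.val % 2 = x.val % 2 := by omega
    simp only [h, this, if_false, zero_add]

theorem highFlip_add_checkFlip {k : ℕ} {x : Fin (k + 2)} (hx : k ≤ x.val) :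
    (highFlip x + checkFlip : Observed (k + 2) n₂) = branchFlip x := by
  simp only [highFlip, checkFlip, branchFlip, Prod.mk_add_mk, zero_add, add_zero]
  refine congrArg (fun h => ((0, 1, h, 0) : Observed (k + 2) n₂)) (funext fun x' => ?_)
  have : x' = x ↔ x ≤ x' ∧ x'.val % 2 = x.val % 2 := by
    rw [Fin.ext_iff, Fin.le_def]
    omega
  simp only [Pi.single_apply, this]

theorem branchFlip_zero_add_branchFlip_one {k : ℕ} :
    (branchFlip 0 + branchFlip 1 : Observed (k + 2) n₂) = (0, 0, fun _ => 1, 0) := by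
  simp only [branchFlip, Prod.mk_add_mk, add_zero, CharTwo.add_self_eq_zero]
  refine congrArg (fun h => ((0, 0, h, 0) : Observed (k + 2) n₂)) (funext fun x => ?_)
  rcases Nat.mod_two_eq_zero_or_one x.val with h | h
  · simp [h]
  · have : 1 ≤ x.val := by omega
    simp [h, Fin.le_def, this]

theorem treeControls_add_two (k : ℕ) :
    treeControls (k + 2) = 1 :: (List.finRange k).map fun x => x.addNat 2 := by
  have hsucc : ∀ x : Fin k, x.succ.succ = x.addNat 2 := fun _ => rfl
  have hne : ∀ x : Fin k, x.addNat 2 ≠ 0 := fun x => Fin.succ_ne_zero x.succ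
  simp [treeControls, List.finRange_succ, List.filter_map, Function.comp_def, hsucc, hne]

theorem pullsBack_detect_branches {k : ℕ} (b : Basis)
    (d : Fin (k + 2) → Fin n₂ → Observed (k + 2) n₂) (fl : Fin (k + 2) → Observed (k + 2) n₂)
    (ck : Observed (k + 2) n₂) (ra rf : Fin n₂ → Observed (k + 2) n₂) :
    PullsBack b.dual (detectEffects (k + 2) n₂) (detectGauge (k + 2) n₂)
      ((List.finRange k).map fun x => couple b (.anc (x.addNat 2)) (.anc (x.castAdd 2)))
      (table d (fun x => if k ≤ x.val then branchFlip x else highFlip x) fl ck ra rf)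
      (table d branchFlip fl ck ra rf) := by
  have := PullsBack.map_of_suffix (a := b.dual) (E := detectEffects (k + 2) n₂)
    (G := detectGauge (k + 2) n₂)
    (fun x => couple b (.anc (x.addNat 2)) (.anc (x.castAdd 2)))
    (fun l => table d (fun x => if ∀ h : x.val < k, ⟨x, h⟩ ∈ l then branchFlip x else highFlip x)
      fl ck ra rf) (List.finRange k) fun x l hs => ?_
  · simpa using this
  · have hmem x' := mem_iff_of_cons_suffix (x' := x') (List.pairwise_lt_finRange k) hs
    have hx : x ∉ l := fun h => ((hmem x).1 h).2.false
    have hchild : ∀ h : x.val + 2 < k, (⟨x.val + 2, h⟩ : Fin k) ∈ l := fun h =>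
      (hmem _).2 ⟨List.mem_finRange _, Fin.lt_def.2 (Nat.lt_add_of_pos_right two_pos)⟩
    rw [effectsIn_couple, pullback_dual_couple]
    refine ⟨by simp [table, hx, hchild, highFlip_mem, branchFlip_mem,
      add_comm (branchFlip _), highFlip_add_branchFlip], funext fun q => ?_⟩
    rcases q with _ | x' | _ | _ | _ | _ <;> simp only [table, ne_eq, reduceCtorEq,
      not_false_eq_true, Function.update_of_ne]
    by_cases h : x' = x.castAdd 2
    · simp [h, hx, hchild, highFlip_add_branchFlip]
    · have hne : ∀ h' : x'.val < k, (⟨x', h'⟩ : Fin k) ≠ x := fun h' hx' =>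
        h (Fin.ext (Fin.ext_iff.1 hx' : x'.val = x.val))
      simp [h, hne, table]

theorem pullsBack_detect_tree {k : ℕ} (b : Basis)
    (d : Fin (k + 2) → Fin n₂ → Observed (k + 2) n₂) (fl : Fin (k + 2) → Observed (k + 2) n₂)
    (ck : Observed (k + 2) n₂) (ra rf : Fin n₂ → Observed (k + 2) n₂) :
    PullsBack b.dual (detectEffects (k + 2) n₂) (detectGauge (k + 2) n₂)
      ((treeControls (k + 2)).map fun x => couple b (.anc x) (.anc (treeParent x)))
      (table d (fun x => if k ≤ x.val then branchFlip x else highFlip x) fl ck ra rf)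
      (table d (Function.update branchFlip 0 (0, 0, fun _ => 1, 0)) fl ck ra rf) := by
  have hroot : treeParent (1 : Fin (k + 2)) = 0 := Fin.ext (by simp [treeParent])
  have hparent : ∀ x : Fin k, treeParent (x.addNat 2) = x.castAdd 2 := fun x => rfl
  rw [treeControls_add_two, List.map_cons, List.map_map]
  refine .cons (S' := table d branchFlip fl ck ra rf) ?_ ?_ ?_
  · simpa only [Function.comp_def, hparent] using pullsBack_detect_branches b d fl ck ra rf
  · rw [hroot, effectsIn_couple]
    simp only [table, add_comm (branchFlip 1), branchFlip_zero_add_branchFlip_one]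
    exact ⟨branchFlip_mem 1, branchFlip_mem 0, .gauge 1⟩
  · rw [hroot, pullback_dual_couple]
    ext1 q
    rcases q with _ | x | _ | _ | _ | _ <;> simp only [table, ne_eq, reduceCtorEq,
      not_false_eq_true, Function.update_of_ne]
    by_cases h : x = 0 <;> simp [h, table, branchFlip_zero_add_branchFlip_one]

theorem pullsBack_detect_verify {k : ℕ} (b : Basis)
    (d : Fin (k + 2) → Fin n₂ → Observed (k + 2) n₂) (fl : Fin (k + 2) → Observed (k + 2) n₂)
    (ra rf : Fin n₂ → Observed (k + 2) n₂) :
    PullsBack b.dual (detectEffects (k + 2) n₂) (detectGauge (k + 2) n₂)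
      ([(Fin.last k).castSucc, Fin.last (k + 1)].map fun x => couple b .check (.anc x))
      (table d highFlip fl checkFlip ra rf)
      (table d (fun x => if k ≤ x.val then branchFlip x else highFlip x) fl checkFlip ra rf) := by
  have hlast : k ≤ (Fin.last (k + 1)).val := Nat.le_succ k
  have hprev : k ≤ (Fin.last k).castSucc.val := le_rfl
  refine .cons (.cons (.nil _) ?_ (pullback_dual_couple _ _ _ _)) ?_ ?_
  · simp [effectsIn_couple, table, add_comm checkFlip, highFlip_add_checkFlip hlast,
      checkFlip_mem, highFlip_mem, branchFlip_mem]
  · simp [effectsIn_couple, table, add_comm checkFlip, highFlip_add_checkFlip hprev,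
      checkFlip_mem, highFlip_mem, branchFlip_mem]
  · rw [pullback_dual_couple]
    ext1 q
    rcases q with _ | x | _ | _ | _ | _ <;> simp only [table, ne_eq, reduceCtorEq,
      not_false_eq_true, Function.update_of_ne]
    rcases eq_or_ne x (Fin.last (k + 1)) with rfl | h₁
    · have : Fin.last (k + 1) ≠ (Fin.last k).castSucc := (Fin.castSucc_lt_last _).ne'
      simp [this, highFlip_add_checkFlip hlast]
    rcases eq_or_ne x (Fin.last k).castSucc with rfl | h₂
    · simp [table, h₁, highFlip_add_checkFlip hprev]
    · have hx : ¬k ≤ x.val := by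
        simp only [ne_eq, Fin.ext_iff, Fin.val_last, Fin.val_castSucc] at h₁ h₂
        omega
      simp [table, h₁, h₂, hx]

theorem pullsBack_detect_preparation {k : ℕ} (b : Basis)
    (d : Fin (k + 2) → Fin n₂ → Observed (k + 2) n₂) (fl : Fin (k + 2) → Observed (k + 2) n₂)
    (ra rf : Fin n₂ → Observed (k + 2) n₂) :
    PullsBack b.dual (detectEffects (k + 2) n₂) (detectGauge (k + 2) n₂)
      (ancillaPreparation (k + 2) n₂ b)
      (table d highFlip fl checkFlip ra rf) (table d 0 fl 0 ra rf) := by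
  rw [ancillaPreparation, finRange_filter_ends]
  refine .append (.append (.append (.append ?_ (pullsBack_detect_tree b d fl 0 ra rf))
    (.cons (.nil _) ⟨checkFlip_mem, fun h => absurd h b.dual_ne⟩ ?_))
    (pullsBack_detect_verify b d fl ra rf)) (.cons (.nil _) checkFlip_mem rfl)
  · refine .map_prep (List.nodup_finRange _) (fun _ _ => Qubit.anc.inj) (fun x => ?_)
      (fun x hx => ?_) (fun _ => rfl) ?_
    · by_cases h : x = 0
      · simp only [table, h, Function.update_self]
        exact IsDetectEffect.gauge 1
      · simpa [table, h] using branchFlip_mem x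
    · split_ifs at hx with h
      · simp only [table, Fin.val_eq_zero_iff.1 h, Function.update_self]
        exact Submodule.mem_span_singleton_self _
      · exact absurd hx b.dual_ne
    · rintro (_ | _ | _ | _ | _ | _) hq <;> simp_all [table]
  · ext1 q
    cases q <;> simp [Instr.pullback, table]

theorem pullsBack_detect {k : ℕ} (b : Basis) :
    PullsBack b.dual (detectEffects (k + 2) n₂) (detectGauge (k + 2) n₂) (extraction (k + 2) n₂ b)
      (table dataFlip highFlip 0 checkFlip lowFlip 0)
      (table (fun x y => dataFlip x y + lowFlip y + highFlip x) 0 0 0 0 0) :=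
  ((pullsBack_detect_preparation b _ _ _ _).append (pullsBack_detect_high b _ _ _)).append
    (pullsBack_detect_rows b _ _ _)

/-- The parities of the columns. -/
def colSum (e : Grid n₁ n₂) : Fin n₁ → ZMod 2 := fun x => ∑ y, e x y

/-- The parities of the rows. -/
def rowSum (e : Grid n₁ n₂) : Fin n₂ → ZMod 2 := fun y => ∑ x, e x y

theorem linearCombination_detect (f : Qubit n₁ n₂ → ZMod 2) :
    Fintype.linearCombination (ZMod 2) (table dataFlip highFlip 0 checkFlip lowFlip 0) f =
      ((fun x y => f (.data x y), f .check, fun x => f (.anc x), fun y => f (.rowAnc y)) :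
        Observed n₁ n₂) := by
  rw [linearCombination_table]
  refine Prod.ext ?_ (Prod.ext ?_ (Prod.ext ?_ ?_))
  · simpa [Prod.fst_sum, dataFlip, highFlip, lowFlip, checkFlip] using
      sum_smul_vString fun x y => f (.data x y)
  · simp [Prod.fst_sum, Prod.snd_sum, dataFlip, highFlip, lowFlip, checkFlip]
  · ext x
    simp [Prod.fst_sum, Prod.snd_sum, dataFlip, highFlip, lowFlip, checkFlip, Pi.single_apply]
  · ext y
    simp [Prod.snd_sum, dataFlip, highFlip, lowFlip, checkFlip, Pi.single_apply]

theorem linearCombination_dataFrame_detect (e : Grid n₁ n₂) :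
    Fintype.linearCombination (ZMod 2)
      (table (fun x y => dataFlip x y + lowFlip y + highFlip x) 0 0 0 0 0) (dataFrame e) =
      ((e, 0, colSum e, rowSum e) : Observed n₁ n₂) := by
  rw [linearCombination_table]
  refine Prod.ext ?_ (Prod.ext ?_ (Prod.ext ?_ ?_))
  · simpa [Prod.fst_sum, dataFlip, highFlip, lowFlip, dataFrame] using sum_smul_vString e
  · simp [Prod.fst_sum, Prod.snd_sum, dataFlip, highFlip, lowFlip]
  · ext x
    simp [Prod.fst_sum, Prod.snd_sum, dataFlip, highFlip, lowFlip, Pi.single_apply, dataFrame,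
      colSum, Finset.sum_apply]
  · ext y
    simp [Prod.snd_sum, dataFlip, highFlip, lowFlip, Pi.single_apply, dataFrame, rowSum,
      Finset.sum_apply]

theorem exists_detectEffects {k : ℕ} {b : Basis} {L : List (Instr (Qubit (k + 2) n₂) × Event)}
    (hL : L.map Prod.fst = extraction (k + 2) n₂ b) (s : RunState (Qubit (k + 2) n₂))
    {e : Grid (k + 2) n₂} (hs : s.frame b.dual = dataFrame e) :
    ∃ t : ZMod 2, ∃ es : List (Observed (k + 2) n₂), es.length ≤ faults L ∧
      (∀ m ∈ es, IsDetectEffect m) ∧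
      ((fun x y => (run L s).frame b.dual (.data x y), (run L s).record .check,
        fun x => (run L s).record (.anc x), fun y => (run L s).record (.rowAnc y)) :
          Observed (k + 2) n₂) =
      (e, 0, colSum e, rowSum e) + (0, 0, fun _ => t, 0) + es.sum := by
  obtain ⟨g, hg, es, hlen, hes, hrun⟩ :=
    PullsBack.exists_effects zero_mem_detectEffects (hL ▸ pullsBack_detect b) s
  obtain ⟨t, rfl⟩ := Submodule.mem_span_singleton.1 hg
  refine ⟨t, es, hlen, hes, ?_⟩
  have hcheck : (run L s).record .check = (run L s).frame b.dual .check :=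
    (hL ▸ endsMeasured_check b : EndsMeasured _ _ (L.map Prod.fst)).record_eq s
  have hanc : ∀ x, (run L s).record (.anc x) = (run L s).frame b.dual (.anc x) := fun x =>
    (hL ▸ endsMeasured_anc b x : EndsMeasured _ _ (L.map Prod.fst)).record_eq s
  have hrowAnc : ∀ y, (run L s).record (.rowAnc y) = (run L s).frame b.dual (.rowAnc y) :=
    fun y => (hL ▸ endsMeasured_rowAnc b y : EndsMeasured _ _ (L.map Prod.fst)).record_eq s
  have ht : t • ((0, 0, fun _ => 1, 0) : Observed (k + 2) n₂) = (0, 0, fun _ => t, 0) := by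
    simp [Prod.smul_mk, Pi.smul_def]
  simp only [hcheck, hanc, hrowAnc, ← ht, ← linearCombination_dataFrame_detect e, ← hs, ← hrun,
    linearCombination_detect]

end Detect

/-! ## Syndromes -/

section Ones

variable {α : Type*} [Fintype α]

theorem mem_ones {f : α → ZMod 2} {i : α} : i ∈ ones f ↔ f i = 1 := by simp [ones]

theorem ones_add [DecidableEq α] (f g : α → ZMod 2) :
    ones (f + g) = symmDiff (ones f) (ones g) := by
  ext i
  have hf := zmod_two_eq_zero_or_eq_one (f i)
  have hg := zmod_two_eq_zero_or_eq_one (g i)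
  rcases hf with hf | hf <;> rcases hg with hg | hg <;>
    simp [mem_ones, Finset.mem_symmDiff, hf, hg, CharTwo.add_self_eq_zero]

theorem ones_const_one : ones (fun _ : α => 1) = Finset.univ := by simp [ones]

theorem natCast_card_ones (f : α → ZMod 2) : ((ones f).card : ZMod 2) = ∑ i, f i := by
  rw [ones, Finset.card_filter, Nat.cast_sum]
  refine Finset.sum_congr rfl fun i _ => ?_
  rcases zmod_two_eq_zero_or_eq_one (f i) with h | h <;> simp [h]

end Ones

section Syndromes

variable {n₁ n₂ : ℕ} {e e' f f' : Grid n₁ n₂} {x : Fin n₁} {y : Fin n₂}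

theorem SameError.symm (h : SameError e e') : SameError e' e := by
  simpa [SameError] using (stabilizers n₁ n₂).neg_mem h

theorem SameError.trans {e'' : Grid n₁ n₂} (h : SameError e e') (h' : SameError e' e'') :
    SameError e e'' := by
  simpa [SameError] using (stabilizers n₁ n₂).add_mem h h'

theorem SameError.add (h : SameError e e') (h' : SameError f f') :
    SameError (e + f) (e' + f') := by
  simpa [SameError, add_sub_add_comm] using (stabilizers n₁ n₂).add_mem h h'

theorem SameError.add_eq_zero (h : SameError e f) (h' : SameError e' f) :
    SameError (e + e') 0 :=
  ZModModule.add_self f ▸ h.add h'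

theorem SameError.add_vString {S T : Finset (Fin n₂)} (h : SameError e (vString x S))
    (h' : SameError f (vString x T)) : SameError (e + f) (vString x (symmDiff S T)) :=
  vString_add_vString x S T ▸ h.add h'

theorem SameError.add_hString {S T : Finset (Fin n₁)} (h : SameError e (hString S y))
    (h' : SameError f (hString T y)) : SameError (e + f) (hString (symmDiff S T) y) :=
  hString_add_hString S T y ▸ h.add h'

theorem sameError_vString_univ (x x' : Fin n₁) :
    SameError (vString x Finset.univ : Grid n₁ n₂) (vString x' Finset.univ) := by
  rw [SameError, ZModModule.sub_eq_add]
  exact vString_univ_add_mem_stabilizers x x'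

theorem sameError_hString_compl (S : Finset (Fin n₁)) (y : Fin n₂) :
    SameError (hString S y) (hString Sᶜ y) := by
  rw [SameError, ZModModule.sub_eq_add, hString_add_hString, symmDiff_compl_self]
  exact hString_univ_mem_stabilizers y

theorem colSum_add (e f : Grid n₁ n₂) : colSum (e + f) = colSum e + colSum f := by
  ext x; simp [colSum, Finset.sum_add_distrib]

theorem rowSum_add (e f : Grid n₁ n₂) : rowSum (e + f) = rowSum e + rowSum f := by
  ext x; simp [rowSum, Finset.sum_add_distrib]

theorem colSum_smul (t : ZMod 2) (e : Grid n₁ n₂) : colSum (t • e) = t • colSum e := by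
  ext x; simp [colSum, Finset.mul_sum]

theorem rowSum_smul (t : ZMod 2) (e : Grid n₁ n₂) : rowSum (t • e) = t • rowSum e := by
  ext x; simp [rowSum, Finset.mul_sum]

theorem colSum_zero : colSum (0 : Grid n₁ n₂) = 0 := by ext; simp [colSum]

theorem rowSum_zero : rowSum (0 : Grid n₁ n₂) = 0 := by ext; simp [rowSum]

theorem sum_colSum (e : Grid n₁ n₂) : ∑ x, colSum e x = ∑ y, rowSum e y := Finset.sum_comm

theorem colSum_vString (x : Fin n₁) (S : Finset (Fin n₂)) :
    colSum (vString x S) = Pi.single x (S.card : ZMod 2) := by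
  ext i
  by_cases hi : i = x <;> simp [colSum, vString, hi]

theorem rowSum_hString (S : Finset (Fin n₁)) (y : Fin n₂) :
    rowSum (hString S y) = Pi.single y (S.card : ZMod 2) := by
  ext j
  by_cases hj : j = y <;> simp [rowSum, hString, hj]

theorem ones_single_natCast {α : Type*} [Fintype α] [DecidableEq α] (i : α) (k : ℕ) :
    ones (Pi.single i (k : ZMod 2)) = if Even k then ∅ else {i} := by
  split_ifs with h
  · rw [(ZMod.natCast_eq_zero_iff_even).2 h, Pi.single_zero, ones_zero]
  · rw [(ZMod.natCast_eq_one_iff_odd).2 (Nat.not_even_iff_odd.1 h), ones_single]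

theorem ones_colSum_vString (x : Fin n₁) (S : Finset (Fin n₂)) :
    ones (colSum (vString x S)) = if Even S.card then ∅ else {x} := by
  rw [colSum_vString, ones_single_natCast]

theorem ones_rowSum_hString (S : Finset (Fin n₁)) (y : Fin n₂) :
    ones (rowSum (hString S y)) = if Even S.card then ∅ else {y} := by
  rw [rowSum_hString, ones_single_natCast]

theorem ones_rowSum_vString (x : Fin n₁) (S : Finset (Fin n₂)) :
    ones (rowSum (vString x S)) = S := by
  ext j
  simp only [mem_ones, rowSum, vString]
  by_cases hj : j ∈ S <;> simp [hj, -Finset.sum_boole]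

theorem ones_colSum_hString (S : Finset (Fin n₁)) (y : Fin n₂) :
    ones (colSum (hString S y)) = S := by
  ext i
  simp only [mem_ones, colSum, hString]
  by_cases hi : i ∈ S <;> simp [hi, -Finset.sum_boole]

theorem colSum_eq_const_and_rowSum_eq_zero (hn₁ : Even n₁) (hn₂ : Even n₂)
    (he : e ∈ stabilizers n₁ n₂) : (∃ t, colSum e = fun _ => t) ∧ rowSum e = 0 := by
  have hcast₁ : (n₁ : ZMod 2) = 0 := (ZMod.natCast_eq_zero_iff_even).2 hn₁
  have hcast₂ : (n₂ : ZMod 2) = 0 := (ZMod.natCast_eq_zero_iff_even).2 hn₂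
  induction he using Submodule.span_induction with
  | mem e he =>
    rcases he with ⟨y, rfl⟩ | ⟨p, rfl⟩
    · refine ⟨⟨1, ?_⟩, ?_⟩
      · ext x
        simp [colSum, hString]
      · simp [rowSum_hString, hcast₁]
    · refine ⟨⟨0, ?_⟩, ?_⟩
      · ext x
        simp [colSum_add, colSum_vString, hcast₂]
      · ext y
        simpa [rowSum, vString, Finset.sum_add_distrib] using CharTwo.add_self_eq_zero (1 : ZMod 2)
  | zero => exact ⟨⟨0, colSum_zero⟩, rowSum_zero⟩
  | add e f _ _ he hf =>
    obtain ⟨⟨t, ht⟩, he⟩ := he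
    obtain ⟨⟨u, hu⟩, hf⟩ := hf
    exact ⟨⟨t + u, by rw [colSum_add, ht, hu]; rfl⟩, by rw [rowSum_add, he, hf, add_zero]⟩
  | smul c e _ he =>
    obtain ⟨⟨t, ht⟩, he⟩ := he
    exact ⟨⟨c * t, by rw [colSum_smul, ht]; rfl⟩, by rw [rowSum_smul, he, smul_zero]⟩

/-- The sets of coordinates that the decoder reads off the high-level outcomes `h` and the low-level
outcomes `l`. When `2 * xs.card = n₁`, both complementary sets are admitted as `xs`. -/
structure Syndrome (h : Fin n₁ → ZMod 2) (l : Fin n₂ → ZMod 2) (xs : Finset (Fin n₁))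
    (ys : Finset (Fin n₂)) : Prop where
  card_le : 2 * xs.card ≤ n₁
  high : xs = ones h ∨ xs = (ones h)ᶜ
  low : ys = ones l

/-- The sets of coordinates that the decoder reads off the faultless syndrome of `e`. -/
abbrev SyndromeOf (e : Grid n₁ n₂) := Syndrome (colSum e) (rowSum e)

variable {h : Fin n₁ → ZMod 2} {l : Fin n₂ → ZMod 2} {xs : Finset (Fin n₁)} {ys : Finset (Fin n₂)}

theorem Syndrome.eq_of_card_lt (hs : Syndrome h l xs ys) (hh : 2 * (ones h).card < n₁) :
    xs = ones h := by
  refine hs.high.resolve_right fun hx => ?_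
  have hcard := hs.card_le
  rw [hx, Finset.card_compl, Fintype.card_fin] at hcard
  omega

theorem Syndrome.add_const (hs : Syndrome h l xs ys) (t : ZMod 2) :
    Syndrome ((fun _ => t) + h) l xs ys := by
  rcases zmod_two_eq_zero_or_eq_one t with rfl | rfl
  · exact ⟨hs.card_le, by simpa [Pi.add_def] using hs.high, hs.low⟩
  · refine ⟨hs.card_le, ?_, hs.low⟩
    rw [ones_add, ones_const_one, ← Finset.top_eq_univ, top_symmDiff, hnot_eq_compl, compl_compl]
    exact hs.high.symm

theorem Syndrome.congr (hn₁ : Even n₁) (hn₂ : Even n₂) (he : SameError e e')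
    (hs : Syndrome (colSum e + h) (rowSum e + l) xs ys) :
    Syndrome (colSum e' + h) (rowSum e' + l) xs ys := by
  obtain ⟨⟨t, ht⟩, hr⟩ := colSum_eq_const_and_rowSum_eq_zero hn₁ hn₂ he.symm
  have he' : e' = (e' - e) + e := (sub_add_cancel e' e).symm
  rw [he', colSum_add, rowSum_add, ht, hr, zero_add, add_assoc]
  exact hs.add_const t

theorem SyndromeOf.congr (hn₁ : Even n₁) (hn₂ : Even n₂) (he : SameError e e')
    (hs : SyndromeOf e xs ys) : SyndromeOf e' xs ys := by
  simpa using Syndrome.congr (h := 0) (l := 0) hn₁ hn₂ he (by simpa using hs)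

theorem SyndromeOf.eq_of_hString {S : Finset (Fin n₁)} (hs : SyndromeOf (hString S y) xs ys) :
    (xs = S ∨ xs = Sᶜ) ∧ ys = if Even S.card then ∅ else {y} :=
  ⟨ones_colSum_hString S y ▸ hs.high, hs.low.trans (ones_rowSum_hString S y)⟩

theorem SyndromeOf.eq_of_vString {S : Finset (Fin n₂)} (hn₁ : 3 ≤ n₁)
    (hs : SyndromeOf (vString x S) xs ys) :
    xs = (if Even S.card then ∅ else {x}) ∧ ys = S := by
  refine ⟨(hs.eq_of_card_lt ?_).trans (ones_colSum_vString x S),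
    hs.low.trans (ones_rowSum_vString x S)⟩
  rw [ones_colSum_vString]
  split_ifs <;> simp only [Finset.card_empty, Finset.card_singleton] <;> omega

theorem Syndrome.card_add_card (hn₁ : Even n₁) (hs : Syndrome h l xs ys) :
    ((xs.card + ys.card : ℕ) : ZMod 2) = ∑ x, h x + ∑ y, l y := by
  have hx : (xs.card : ZMod 2) = (ones h).card := by
    rcases hs.high with hx | hx
    · rw [hx]
    · rw [hx, Finset.card_compl, Fintype.card_fin, Nat.cast_sub
        ((Finset.card_le_univ _).trans_eq (Fintype.card_fin n₁)),
        (ZMod.natCast_eq_zero_iff_even).2 hn₁, zero_sub, ZModModule.neg_eq_self]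
  rw [Nat.cast_add, hx, hs.low, natCast_card_ones, natCast_card_ones]

theorem SyndromeOf.even_card (hn₁ : Even n₁) (hs : SyndromeOf e xs ys) :
    Even (xs.card + ys.card) := by
  rw [← ZMod.natCast_eq_zero_iff_even, hs.card_add_card hn₁, sum_colSum]
  exact CharTwo.add_self_eq_zero _

end Syndromes

/-! ## The decoder -/

section Decoding

variable {n₁ n₂ : ℕ}

/-- The decoder after the check that an input error is allowed. -/
def decodeBody (m : Memory n₁ n₂) (xs : Finset (Fin n₁)) (ys : Finset (Fin n₂)) :
    Option (Grid n₁ n₂ × Memory n₁ n₂) :=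
  if m.hookCols = ∅ ∧ m.hookRows = ∅ then
    if xs.card + ys.card = 1 then
      if 0 < m.prevFailures then none
      else some (0, ⟨∅, ∅, 1, decide (xs = ∅)⟩)
    else (noiselessDecode xs ys).map (fun c => (c, Memory.blank))
  else if m.hookCols.card = 1 ∧ m.hookRows = ∅ then
    if xs = (if Even ys.card then ∅ else m.hookCols) then
      some (rectangle m.hookCols ys, Memory.blank) else none
  else if m.hookCols = ∅ ∧ m.hookRows.card = 1 then
    if ys = (if Even xs.card then ∅ else m.hookRows) then
      some (rectangle xs m.hookRows, Memory.blank) else none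
  else none

/-- The decoder as a function of the coordinates that it reads off the outcomes. -/
def decodeSets (m : Memory n₁ n₂) (xs : Finset (Fin n₁)) (ys : Finset (Fin n₂)) :
    Option (Grid n₁ n₂ × Memory n₁ n₂) :=
  if m.inputErrorAllowed = false ∧ ¬ (xs = ∅ ∧ ys = ∅ ∧ m.hookCols = ∅ ∧ m.hookRows = ∅) then none
  else decodeBody m xs ys

theorem rectangle_singleton_left (x : Fin n₁) (T : Finset (Fin n₂)) :
    rectangle {x} T = vString x T := by
  ext i j; simp [rectangle, vString]

theorem rectangle_singleton_right (S : Finset (Fin n₁)) (y : Fin n₂) :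
    rectangle S {y} = hString S y := by
  ext i j; simp [rectangle, hString]

theorem filter_val_eq_zero (hn₁ : 0 < n₁) :
    (Finset.univ.filter fun x : Fin n₁ => x.val = 0) = {⟨0, hn₁⟩} := by
  ext x; simp [Fin.ext_iff]

variable {m m' : Memory n₁ n₂} {xs : Finset (Fin n₁)} {ys : Finset (Fin n₂)} {c : Grid n₁ n₂}

theorem decodeBody_of_decodeSets (h : decodeSets m xs ys = some (c, m')) :
    decodeBody m xs ys = some (c, m') := by
  unfold decodeSets at h
  split_ifs at h
  exact h

theorem eq_empty_of_decodeSets (h : decodeSets m xs ys = some (c, m'))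
    (hm : m.inputErrorAllowed = false) :
    xs = ∅ ∧ ys = ∅ ∧ m.hookCols = ∅ ∧ m.hookRows = ∅ := by
  unfold decodeSets at h
  split_ifs at h with h'
  by_contra hne
  exact h' ⟨hm, hne⟩

theorem decodeSets_of_allowed (hm : m.inputErrorAllowed = true) :
    decodeSets m xs ys = decodeBody m xs ys := by
  simp [decodeSets, hm]

/-- The cases in which the decoder does not halt, with the correction and the memory that is
passed on. -/
inductive DecodeCase (m : Memory n₁ n₂) (xs : Finset (Fin n₁)) (ys : Finset (Fin n₂)) :
    Grid n₁ n₂ → Memory n₁ n₂ → Prop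
  | single (hx : m.hookCols = ∅) (hy : m.hookRows = ∅) (h : xs.card + ys.card = 1) :
      DecodeCase m xs ys 0 ⟨∅, ∅, 1, decide (xs = ∅)⟩
  | trivial (hx : m.hookCols = ∅) (hy : m.hookRows = ∅) (h : xs = ∅) (h' : ys = ∅) :
      DecodeCase m xs ys 0 Memory.blank
  | point (hx : m.hookCols = ∅) (hy : m.hookRows = ∅) (x y) (h : xs = {x}) (h' : ys = {y}) :
      DecodeCase m xs ys (vString x {y}) Memory.blank
  | column (hx : m.hookCols = ∅) (hy : m.hookRows = ∅) (x) (h : xs = ∅)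
      (h' : ys = Finset.univ) : DecodeCase m xs ys (vString x Finset.univ) Memory.blank
  | vertical (x) (hx : m.hookCols = {x}) (hy : m.hookRows = ∅)
      (h : xs = if Even ys.card then ∅ else {x}) :
      DecodeCase m xs ys (vString x ys) Memory.blank
  | horizontal (y) (hx : m.hookCols = ∅) (hy : m.hookRows = {y})
      (h : ys = if Even xs.card then ∅ else {y}) :
      DecodeCase m xs ys (hString xs y) Memory.blank

theorem DecodeCase.of_noiselessDecode (hn₁ : 0 < n₁) (hx : m.hookCols = ∅) (hy : m.hookRows = ∅)
    (h : noiselessDecode xs ys = some c) : DecodeCase m xs ys c Memory.blank := by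
  unfold noiselessDecode at h
  split_ifs at h with hnone hpoint hcolumn
  · obtain rfl := Option.some.inj h
    exact .trivial hx hy hnone.1 hnone.2
  · obtain ⟨x, rfl⟩ := Finset.card_eq_one.1 hpoint.1
    obtain ⟨y, rfl⟩ := Finset.card_eq_one.1 hpoint.2
    obtain rfl := Option.some.inj h
    exact rectangle_singleton_left x {y} ▸ .point hx hy x y rfl rfl
  · obtain rfl := Option.some.inj h
    rw [filter_val_eq_zero hn₁, rectangle_singleton_left]
    exact .column hx hy _ hcolumn.1 hcolumn.2

theorem DecodeCase.of_decodeBody (hn₁ : 0 < n₁) (h : decodeBody m xs ys = some (c, m')) :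
    DecodeCase m xs ys c m' := by
  unfold decodeBody at h
  generalize hA : (if Even ys.card then ∅ else m.hookCols) = A at h
  generalize hB : (if Even xs.card then ∅ else m.hookRows) = B at h
  split_ifs at h with hflags hcard _ hcol hxs hrow hys
  · obtain ⟨rfl, rfl⟩ := Prod.mk.inj (Option.some.inj h)
    exact .single hflags.1 hflags.2 hcard
  · obtain ⟨c', hc', h⟩ := Option.map_eq_some_iff.1 h
    obtain ⟨rfl, rfl⟩ := Prod.mk.inj h
    exact .of_noiselessDecode hn₁ hflags.1 hflags.2 hc'
  · obtain ⟨x, hx⟩ := Finset.card_eq_one.1 hcol.1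
    obtain ⟨rfl, rfl⟩ := Prod.mk.inj (Option.some.inj h)
    rw [hx, rectangle_singleton_left]
    exact .vertical x hx hcol.2 (hx ▸ hxs.trans hA.symm)
  · obtain ⟨y, hy⟩ := Finset.card_eq_one.1 hrow.2
    obtain ⟨rfl, rfl⟩ := Prod.mk.inj (Option.some.inj h)
    rw [hy, rectangle_singleton_right]
    exact .horizontal y hrow.1 hy (hy ▸ hys.trans hB.symm)

theorem DecodeCase.of_mem_hookCols {x : Fin n₁} (hx : x ∈ m.hookCols)
    (h : DecodeCase m xs ys c m') : m.hookCols = {x} ∧ m.hookRows = ∅ ∧ xs ⊆ {x} := by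
  cases h with
  | vertical x' hC hR h =>
    obtain rfl := Finset.mem_singleton.1 (hC ▸ hx)
    exact ⟨hC, hR, by rw [h]; split_ifs <;> simp⟩
  | _ => exact absurd (‹m.hookCols = ∅› ▸ hx) (Finset.notMem_empty x)

theorem DecodeCase.of_mem_hookRows {y : Fin n₂} (hy : y ∈ m.hookRows)
    (h : DecodeCase m xs ys c m') : m.hookCols = ∅ ∧ m.hookRows = {y} ∧ ys ⊆ {y} := by
  cases h with
  | horizontal y' hC hR h =>
    obtain rfl := Finset.mem_singleton.1 (hR ▸ hy)
    exact ⟨hC, hR, by rw [h]; split_ifs <;> simp⟩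
  | _ => exact absurd (‹m.hookRows = ∅› ▸ hy) (Finset.notMem_empty y)

end Decoding

/-! ## Weights -/

section Weights

variable {n₁ n₂ : ℕ} {e e' f : Grid n₁ n₂} {C C' : Finset (Fin n₁)} {R R' : Finset (Fin n₂)}
  {x x' : Fin n₁} {y y' : Fin n₂}

/-- The sets of rows of an unflagged vertical string of generalized weight at most one. -/
def IsUnflagged (S : Finset (Fin n₂)) : Prop := S = ∅ ∨ (∃ y, S = {y}) ∨ S = Finset.univ

theorem isGenWeightLeOne_of_sameError_zero (he : SameError e 0) : IsGenWeightLeOne e ∅ ∅ :=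
  .inl ⟨he, rfl, rfl⟩

theorem isGenWeightLeOne_of_isUnflagged {S : Finset (Fin n₂)} (hS : IsUnflagged S)
    (he : SameError e (vString x S)) : IsGenWeightLeOne e ∅ ∅ := by
  rcases hS with rfl | ⟨y, rfl⟩ | rfl
  · exact isGenWeightLeOne_of_sameError_zero (vString_empty x ▸ he)
  · exact .inr (.inl ⟨x, y, he, rfl, rfl⟩)
  · exact .inr (.inr (.inr (.inr ⟨x, he, rfl, rfl⟩)))

theorem isGenWeightLeOne_of_vString {S : Finset (Fin n₂)} (he : SameError e (vString x S)) :
    IsGenWeightLeOne e {x} ∅ :=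
  .inr (.inr (.inl ⟨x, S, he, rfl, rfl⟩))

theorem isGenWeightLeOne_of_hString {S : Finset (Fin n₁)} (he : SameError e (hString S y)) :
    IsGenWeightLeOne e ∅ {y} :=
  .inr (.inr (.inr (.inl ⟨y, S, he, rfl, rfl⟩)))

theorem isGenWeightLeOne_of_point (he : SameError e (vString x {y})) : IsGenWeightLeOne e ∅ ∅ :=
  isGenWeightLeOne_of_isUnflagged (.inr (.inl ⟨y, rfl⟩)) he

theorem IsGenWeightLeOne.cases (hn₁ : 0 < n₁) (h : IsGenWeightLeOne e C R) :
    (∃ x S, IsUnflagged S ∧ SameError e (vString x S) ∧ C = ∅ ∧ R = ∅) ∨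
    (∃ x S, SameError e (vString x S) ∧ C = {x} ∧ R = ∅) ∨
    (∃ y S, SameError e (hString S y) ∧ C = ∅ ∧ R = {y}) := by
  rcases h with ⟨h, hCR⟩ | ⟨x, y, h, hCR⟩ | ⟨x, S, h, hCR⟩ | ⟨y, S, h, hCR⟩ | ⟨x, h, hCR⟩
  · exact .inl ⟨⟨0, hn₁⟩, ∅, .inl rfl, by rwa [vString_empty], hCR⟩
  · exact .inl ⟨x, {y}, .inr (.inl ⟨y, rfl⟩), h, hCR⟩
  · exact .inr (.inl ⟨x, S, h, hCR⟩)
  · exact .inr (.inr ⟨y, S, h, hCR⟩)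
  · exact .inl ⟨x, Finset.univ, .inr (.inr rfl), h, hCR⟩

theorem IsGenWeightLeOne.unflagged (hn₁ : 0 < n₁) (h : IsGenWeightLeOne e ∅ ∅) :
    ∃ x S, IsUnflagged S ∧ SameError e (vString x S) := by
  rcases h.cases hn₁ with ⟨x, S, hS, he, -⟩ | ⟨x, -, -, hC, -⟩ | ⟨y, -, -, -, hR⟩
  · exact ⟨x, S, hS, he⟩
  · exact absurd hC.symm (Finset.singleton_ne_empty x)
  · exact absurd hR.symm (Finset.singleton_ne_empty y)

theorem IsGenWeightLeOne.congr (he : SameError e e') (h : IsGenWeightLeOne e' C R) :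
    IsGenWeightLeOne e C R := by
  rcases h with ⟨h, hCR⟩ | ⟨x, y, h, hCR⟩ | ⟨x, S, h, hCR⟩ | ⟨y, S, h, hCR⟩ | ⟨x, h, hCR⟩
  exacts [.inl ⟨he.trans h, hCR⟩, .inr (.inl ⟨x, y, he.trans h, hCR⟩),
    .inr (.inr (.inl ⟨x, S, he.trans h, hCR⟩)),
    .inr (.inr (.inr (.inl ⟨y, S, he.trans h, hCR⟩))),
    .inr (.inr (.inr (.inr ⟨x, he.trans h, hCR⟩)))]

theorem IsGenWeightLeTwo.add (he : IsGenWeightLeOne e C R) (hf : IsGenWeightLeOne f C' R') :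
    IsGenWeightLeTwo (e + f) (C ∪ C') (R ∪ R') :=
  .inl ⟨e, C, R, f, C', R', he, hf, rfl, rfl, rfl⟩

theorem IsGenWeightLeTwo.add_unflagged (he : IsGenWeightLeOne e C R)
    (hf : IsGenWeightLeOne f ∅ ∅) : IsGenWeightLeTwo (e + f) C R := by
  simpa using IsGenWeightLeTwo.add he hf

theorem IsGenWeightLeOne.leTwo (he : IsGenWeightLeOne e C R) : IsGenWeightLeTwo e C R := by
  simpa using IsGenWeightLeTwo.add_unflagged he
    (isGenWeightLeOne_of_sameError_zero (SameError.refl (0 : Grid n₁ n₂)))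

theorem IsGenWeightLeTwo.congr (he : SameError e e') (h : IsGenWeightLeTwo e' C R) :
    IsGenWeightLeTwo e C R := by
  rcases h with ⟨e₁, C₁, R₁, e₂, C₂, R₂, h₁, h₂, rfl, hC, hR⟩ | ⟨x, S, h, hCR⟩ | ⟨y, S, h, hCR⟩
  · refine .inl ⟨e - e₂, C₁, R₁, e₂, C₂, R₂, h₁.congr ?_, h₂, by simp, hC, hR⟩
    simpa [SameError, sub_sub, add_comm] using he
  · exact .inr (.inl ⟨x, S, he.trans h, hCR⟩)
  · exact .inr (.inr ⟨y, S, he.trans h, hCR⟩)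

end Weights

/-! ## Faultless syndrome extraction -/

/-- An even length, at least four: the possible numbers of columns and of rows of the grid. -/
class EvenLength (n : ℕ) : Prop where
  even : Even n
  four_le : 4 ≤ n

section Faultless

variable {n₁ n₂ : ℕ} [EvenLength n₁] {m m' : Memory n₁ n₂} {xs : Finset (Fin n₁)}
  {ys : Finset (Fin n₂)} {c e f : Grid n₁ n₂} {C C' : Finset (Fin n₁)}
  {R R' : Finset (Fin n₂)} {x x' : Fin n₁} {y y' : Fin n₂}

theorem EvenLength.pos (n : ℕ) [EvenLength n] : 0 < n := four_pos.trans_le EvenLength.four_le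

theorem EvenLength.card_univ_ne_one (n : ℕ) [EvenLength n] :
    (Finset.univ : Finset (Fin n)).card ≠ 1 := by
  have := EvenLength.four_le (n := n)
  rw [Finset.card_fin]
  omega

variable [EvenLength n₂]

theorem SyndromeOf.of_vString {S : Finset (Fin n₂)} (hs : SyndromeOf e xs ys)
    (he : SameError e (vString x S)) : xs = (if Even S.card then ∅ else {x}) ∧ ys = S :=
  (SyndromeOf.congr EvenLength.even EvenLength.even he hs).eq_of_vString
    (Nat.le_of_succ_le EvenLength.four_le)

theorem SyndromeOf.of_hString {S : Finset (Fin n₁)} (hs : SyndromeOf e xs ys)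
    (he : SameError e (hString S y)) :
    SameError e (hString xs y) ∧ ys = if Even xs.card then ∅ else {y} := by
  obtain ⟨hxs, -⟩ := (SyndromeOf.congr EvenLength.even EvenLength.even he hs).eq_of_hString
  have hexs : SameError e (hString xs y) := by
    rcases hxs with rfl | rfl
    exacts [he, he.trans (sameError_hString_compl S y)]
  exact ⟨hexs, (SyndromeOf.congr EvenLength.even EvenLength.even hexs hs).eq_of_hString.2⟩

theorem decodeBody_of_isUnflagged {S : Finset (Fin n₂)} (hS : IsUnflagged S)
    (he : SameError e (vString x S)) (hs : SyndromeOf e xs ys) (hC : m.hookCols = ∅)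
    (hR : m.hookRows = ∅) : ∃ c, decodeBody m xs ys = some (c, Memory.blank) ∧
      SameError (e + c) 0 := by
  obtain ⟨hxs, rfl⟩ := hs.of_vString he
  rcases hS with rfl | ⟨y, rfl⟩ | rfl
  · refine ⟨0, ?_, by simpa [vString_empty] using he⟩
    simp [decodeBody, hC, hR, noiselessDecode, hxs]
  · refine ⟨vString x {y}, ?_, he.add_eq_zero (SameError.refl _)⟩
    rw [if_neg (by simp)] at hxs
    simp [decodeBody, hC, hR, noiselessDecode, hxs, rectangle_singleton_left]
  · refine ⟨vString ⟨0, EvenLength.pos n₁⟩ Finset.univ, ?_,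
      he.add_eq_zero (sameError_vString_univ _ _)⟩
    have hne : (Finset.univ : Finset (Fin n₂)) ≠ ∅ := fun h =>
      absurd (Finset.mem_univ ⟨0, EvenLength.pos n₂⟩) (h ▸ Finset.notMem_empty _)
    have hn₂ : n₂ ≠ 1 := Finset.card_fin n₂ ▸ EvenLength.card_univ_ne_one n₂
    rw [Finset.card_fin, if_pos EvenLength.even] at hxs
    simp [decodeBody, hC, hR, noiselessDecode, hxs, rectangle_singleton_left, hne, hn₂,
      filter_val_eq_zero (EvenLength.pos n₁)]

theorem decodeBody_of_isGenWeightLeOne (he : IsGenWeightLeOne e m.hookCols m.hookRows)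
    (hs : SyndromeOf e xs ys) :
    ∃ c, decodeBody m xs ys = some (c, Memory.blank) ∧ SameError (e + c) 0 := by
  rcases he.cases (EvenLength.pos n₁) with ⟨x, S, hS, he, hC, hR⟩ | ⟨x, S, he, hC, hR⟩ |
    ⟨y, S, he, hC, hR⟩
  · exact decodeBody_of_isUnflagged hS he hs hC hR
  · obtain ⟨hxs, rfl⟩ := hs.of_vString he
    refine ⟨vString x ys, ?_, he.add_eq_zero (SameError.refl _)⟩
    simp [decodeBody, hC, hR, hxs, rectangle_singleton_left]
  · obtain ⟨hexs, hys⟩ := hs.of_hString he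
    refine ⟨hString xs y, ?_, hexs.add_eq_zero (SameError.refl _)⟩
    rw [decodeBody, if_neg (by simp [hR]), if_neg (by simp [hR]), if_pos (by simp [hC, hR]), hR,
      if_pos hys, rectangle_singleton_right]

theorem DecodeCase.leOne_of_vString {S : Finset (Fin n₂)} (h : DecodeCase m xs ys c m')
    (hs : SyndromeOf e xs ys) (he : SameError e (vString x S)) (hC : m.hookCols = ∅)
    (hR : m.hookRows = ∅) : IsGenWeightLeOne e ∅ ∅ := by
  obtain ⟨-, rfl⟩ := hs.of_vString he
  refine isGenWeightLeOne_of_isUnflagged ?_ he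
  cases h with
  | single _ _ h => exact absurd (hs.even_card EvenLength.even) (by simp [h])
  | trivial _ _ _ h => exact .inl h
  | point _ _ _ y _ h => exact .inr (.inl ⟨y, h⟩)
  | column _ _ _ _ h => exact .inr (.inr h)
  | vertical x h => simp [hC] at h
  | horizontal y _ h => simp [hR] at h

theorem DecodeCase.leOne_of_hString {S : Finset (Fin n₁)} (h : DecodeCase m xs ys c m')
    (hs : SyndromeOf e xs ys) (he : SameError e (hString S y)) (hC : m.hookCols = ∅)
    (hR : m.hookRows = ∅) : IsGenWeightLeOne e ∅ ∅ := by
  obtain ⟨hexs, hys⟩ := hs.of_hString he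
  cases h with
  | single _ _ h => exact absurd (hs.even_card EvenLength.even) (by simp [h])
  | trivial _ _ h _ =>
    rw [h, hString_empty] at hexs
    exact isGenWeightLeOne_of_sameError_zero hexs
  | point _ _ x _ h _ =>
    rw [h, ← vString_singleton] at hexs
    exact isGenWeightLeOne_of_point hexs
  | column _ _ _ h h' =>
    rw [h, Finset.card_empty, if_pos Even.zero] at hys
    exact absurd (Finset.mem_univ (⟨0, EvenLength.pos n₂⟩ : Fin n₂)) (by simp [← h', hys])
  | vertical x h => simp [hC] at h
  | horizontal y _ h => simp [hR] at h

theorem DecodeCase.leOne_of_points (h : DecodeCase m xs ys c m') (hs : SyndromeOf e xs ys)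
    (he : SameError e (vString x {y} + vString x' {y'})) (hC : m.hookCols = ∅)
    (hR : m.hookRows = ∅) : IsGenWeightLeOne e ∅ ∅ := by
  have hn₂ := EvenLength.four_le (n := n₂)
  by_cases hyy : y = y'
  · subst hyy
    rw [vString_singleton, vString_singleton, hString_add_hString] at he
    exact h.leOne_of_hString hs he hC hR
  · have hys : ys = {y, y'} := by
      rw [(SyndromeOf.congr EvenLength.even EvenLength.even he hs).low, rowSum_add, ones_add,
        ones_rowSum_vString, ones_rowSum_vString,
        symmDiff_singleton_of_notMem (by simpa using Ne.symm hyy), Finset.pair_comm]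
    have hcard : ys.card = 2 := by rw [hys, Finset.card_pair hyy]
    cases h with
    | single _ _ h => exact absurd (hs.even_card EvenLength.even) (by simp [h])
    | trivial _ _ _ h => simp [h] at hcard
    | point _ _ _ _ _ h => simp [h] at hcard
    | column _ _ _ _ h =>
      rw [h, Finset.card_fin] at hcard
      omega
    | vertical x h => simp [hC] at h
    | horizontal y _ h => simp [hR] at h

theorem DecodeCase.leOne_of_unflagged {S S' : Finset (Fin n₂)} (h : DecodeCase m xs ys c m')
    (hs : SyndromeOf (e + f) xs ys) (hS : IsUnflagged S) (hS' : IsUnflagged S')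
    (he : SameError e (vString x S)) (hf : SameError f (vString x' S'))
    (hC : m.hookCols = ∅) (hR : m.hookRows = ∅) : IsGenWeightLeOne (e + f) ∅ ∅ := by
  rcases hS with rfl | ⟨y, rfl⟩ | rfl
  · have hef := he.add hf
    rw [vString_empty, zero_add] at hef
    exact isGenWeightLeOne_of_isUnflagged hS' hef
  · rcases hS' with rfl | ⟨y', rfl⟩ | rfl
    · have hef := he.add hf
      rw [vString_empty, add_zero] at hef
      exact isGenWeightLeOne_of_point hef
    · exact h.leOne_of_points hs (he.add hf) hC hR
    · exact h.leOne_of_vString hs (he.add_vString (hf.trans (sameError_vString_univ x' x))) hC hR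
  · exact h.leOne_of_vString hs ((he.trans (sameError_vString_univ x x')).add_vString hf) hC hR

theorem leOne_of_vertical {S S' : Finset (Fin n₂)} (hxs : xs ⊆ {x})
    (hs : SyndromeOf (e + f) xs ys) (he : SameError e (vString x S)) (hS' : IsUnflagged S')
    (hf : SameError f (vString x' S')) : IsGenWeightLeOne (e + f) {x} ∅ := by
  rcases hS' with rfl | ⟨y', rfl⟩ | rfl
  · refine isGenWeightLeOne_of_vString (he.add_vString (T := ∅) ?_)
    rwa [vString_empty] at hf ⊢
  · obtain rfl : x' = x := by
      by_contra hne
      have hones : ones (colSum (vString x S + vString x' {y'})) =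
          insert x' (if Even S.card then ∅ else {x}) := by
        rw [colSum_add, ones_add, ones_colSum_vString, ones_colSum_vString,
          if_neg (show ¬ Even (Finset.card {y'}) by simp),
          symmDiff_singleton_of_notMem (by split_ifs <;> simp [hne])]
      have hhigh := (SyndromeOf.congr EvenLength.even EvenLength.even (he.add hf) hs).high
      rw [hones] at hhigh
      rcases hhigh with rfl | rfl
      · exact hne (by simpa using hxs (Finset.mem_insert_self x' _))
      · have hcompl := Finset.card_le_card hxs
        have hcard := Finset.card_insert_le x' (if Even S.card then ∅ else {x})
        have hite : (if Even S.card then ∅ else {x} : Finset (Fin n₁)).card ≤ 1 := by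
          split_ifs <;> simp
        have hn₁ := EvenLength.four_le (n := n₁)
        rw [Finset.card_compl, Fintype.card_fin, Finset.card_singleton] at hcompl
        omega
    exact isGenWeightLeOne_of_vString (he.add_vString hf)
  · exact isGenWeightLeOne_of_vString
      (he.add_vString (hf.trans (sameError_vString_univ x' x)))

theorem leOne_of_horizontal {S : Finset (Fin n₁)} {S' : Finset (Fin n₂)} (hys : ys ⊆ {y})
    (hs : SyndromeOf (e + f) xs ys) (he : SameError e (hString S y)) (hS' : IsUnflagged S')
    (hf : SameError f (vString x' S')) : IsGenWeightLeOne (e + f) ∅ {y} := by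
  have hlow : ys = symmDiff (if Even S.card then ∅ else {y}) S' := by
    rw [(SyndromeOf.congr EvenLength.even EvenLength.even (he.add hf) hs).low, rowSum_add, ones_add,
      ones_rowSum_hString, ones_rowSum_vString]
  have hS'y : ∀ z ∈ S', z = y := fun z hz => by
    by_contra hne
    refine hne (Finset.mem_singleton.1 (hys ?_))
    rw [hlow, Finset.mem_symmDiff]
    exact .inr ⟨hz, by split_ifs <;> simp [hne]⟩
  rcases hS' with rfl | ⟨y', rfl⟩ | rfl
  · refine isGenWeightLeOne_of_hString (he.add_hString (T := ∅) ?_)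
    rwa [vString_empty, ← hString_empty y] at hf
  · obtain rfl := hS'y y' (Finset.mem_singleton_self y')
    exact isGenWeightLeOne_of_hString (he.add_hString (vString_singleton x' y' ▸ hf))
  · refine absurd ?_ (EvenLength.card_univ_ne_one n₂)
    exact Finset.card_eq_one.2 ⟨y, Finset.eq_singleton_iff_unique_mem.2 ⟨Finset.mem_univ y, hS'y⟩⟩

theorem DecodeCase.leOne_add_unflagged (h : DecodeCase m xs ys c m')
    (he : IsGenWeightLeOne e m.hookCols m.hookRows) (hf : IsGenWeightLeOne f ∅ ∅)
    (hs : SyndromeOf (e + f) xs ys) : IsGenWeightLeOne (e + f) m.hookCols m.hookRows := by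
  obtain ⟨x', S', hS', hf⟩ := hf.unflagged (EvenLength.pos n₁)
  rcases he.cases (EvenLength.pos n₁) with ⟨x, S, hS, he, hC, hR⟩ | ⟨x, S, he, hC, hR⟩ |
    ⟨y, S, he, hC, hR⟩
  · rw [hC, hR]
    exact h.leOne_of_unflagged hs hS hS' he hf hC hR
  · rw [hC, hR]
    exact leOne_of_vertical (h.of_mem_hookCols (hC ▸ Finset.mem_singleton_self x)).2.2 hs he hS' hf
  · rw [hC, hR]
    exact leOne_of_horizontal (h.of_mem_hookRows (hR ▸ Finset.mem_singleton_self y)).2.2 hs he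
      hS' hf

theorem DecodeCase.leOne_add (h : DecodeCase m xs ys c m') (he : IsGenWeightLeOne e C R)
    (hf : IsGenWeightLeOne f C' R') (hC : m.hookCols = C ∪ C') (hR : m.hookRows = R ∪ R')
    (hs : SyndromeOf (e + f) xs ys) : IsGenWeightLeOne (e + f) m.hookCols m.hookRows := by
  by_cases hCR' : C' = ∅ ∧ R' = ∅
  · obtain ⟨rfl, rfl⟩ := hCR'
    rw [Finset.union_empty] at hC hR
    exact h.leOne_add_unflagged (hC ▸ hR ▸ he) hf hs
  rcases he.cases (EvenLength.pos n₁) with ⟨-, -, -, -, rfl, rfl⟩ | ⟨x, S, hex, rfl, rfl⟩ |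
    ⟨y, S, hey, rfl, rfl⟩
  · rw [Finset.empty_union] at hC hR
    rw [add_comm] at hs ⊢
    exact h.leOne_add_unflagged (hC ▸ hR ▸ hf) he hs
  · obtain ⟨hC₀, hR₀, -⟩ := h.of_mem_hookCols (x := x) (by simp [hC])
    rcases hf.cases (EvenLength.pos n₁) with ⟨-, -, -, -, hCR⟩ | ⟨x', S', hfx, rfl, rfl⟩ |
      ⟨y', S', -, rfl, rfl⟩
    · exact absurd hCR hCR'
    · obtain rfl : x' = x := by
        rw [← Finset.mem_singleton, ← hC₀, hC]
        exact Finset.mem_union_right _ (Finset.mem_singleton_self x')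
      rw [hC₀, hR₀]
      exact isGenWeightLeOne_of_vString (hex.add_vString hfx)
    · simp [hR₀] at hR
  · obtain ⟨hC₀, hR₀, -⟩ := h.of_mem_hookRows (y := y) (by simp [hR])
    rcases hf.cases (EvenLength.pos n₁) with ⟨-, -, -, -, hCR⟩ | ⟨x', S', -, rfl, rfl⟩ |
      ⟨y', S', hfy, rfl, rfl⟩
    · exact absurd hCR hCR'
    · simp [hC₀] at hC
    · obtain rfl : y' = y := by
        rw [← Finset.mem_singleton, ← hR₀, hR]
        exact Finset.mem_union_right _ (Finset.mem_singleton_self y')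
      rw [hC₀, hR₀]
      exact isGenWeightLeOne_of_hString (hey.add_hString hfy)

theorem isGenWeightLeOne_of_decodeBody (he : IsGenWeightLeTwo e m.hookCols m.hookRows)
    (hs : SyndromeOf e xs ys) (h : decodeBody m xs ys = some (c, m')) :
    IsGenWeightLeOne e m.hookCols m.hookRows := by
  replace h := DecodeCase.of_decodeBody (EvenLength.pos n₁) h
  rcases he with ⟨e₁, C₁, R₁, e₂, C₂, R₂, h₁, h₂, rfl, hC, hR⟩ | ⟨x, S, he, hC, hR⟩ |
    ⟨y, S, he, hC, hR⟩
  · exact h.leOne_add h₁ h₂ hC hR hs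
  · rw [hC, hR]
    exact h.leOne_of_vString hs he hC hR
  · rw [hC, hR]
    exact h.leOne_of_hString hs he hC hR

end Faultless

/-! ## Faulty syndrome extraction -/

section Faulty

variable {n₁ n₂ : ℕ} {m m' : Memory n₁ n₂} {xs : Finset (Fin n₁)} {ys : Finset (Fin n₂)}
  {c e e' f : Grid n₁ n₂} {x x' z : Fin n₁} {y : Fin n₂} {p q : Observed n₁ n₂}

/-- With at most `k` faults in the extraction that detects it, the error `e` becomes `e'`, the
verification is passed, and the decoder reads off the coordinates `xs` and `ys`. -/
def Detects (k : ℕ) (e e' : Grid n₁ n₂) (xs : Finset (Fin n₁)) (ys : Finset (Fin n₂)) : Prop :=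
  ∃ es : List (Observed n₁ n₂), es.length ≤ k ∧ (∀ p ∈ es, IsDetectEffect p) ∧
    e' = e + es.sum.1 ∧ es.sum.2.1 = 0 ∧
    Syndrome (colSum e + es.sum.2.2.1) (rowSum e + es.sum.2.2.2) xs ys

theorem Detects.mono {k k' : ℕ} (h : Detects k e e' xs ys) (hk : k ≤ k') :
    Detects k' e e' xs ys := by
  obtain ⟨es, hlen, h⟩ := h
  exact ⟨es, hlen.trans hk, h⟩

theorem Detects.eq_and_syndromeOf (h : Detects 0 e e' xs ys) : e' = e ∧ SyndromeOf e xs ys := by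
  obtain ⟨es, hlen, -, he, -, hs⟩ := h
  obtain rfl := List.length_eq_zero_iff.1 (Nat.le_zero.1 hlen)
  exact ⟨by simpa using he, by simpa using hs⟩

theorem Detects.exists_effects (h : Detects 2 e e' xs ys) :
    ∃ p q, IsDetectEffect p ∧ IsDetectEffect q ∧ e' = e + (p + q).1 ∧
      Syndrome (colSum e + (p + q).2.2.1) (rowSum e + (p + q).2.2.2) xs ys := by
  obtain ⟨es, hlen, hes, he, -, hs⟩ := h
  match es, hlen with
  | [], _ => exact ⟨_, _, .gauge 0, .gauge 0, by simpa using he, by simpa [Pi.add_def] using hs⟩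
  | [p], _ =>
    exact ⟨p, _, hes p (by simp), .gauge 0, by simpa using he, by simpa [Pi.add_def] using hs⟩
  | [p, q], _ =>
    exact ⟨p, q, hes p (by simp), hes q (by simp), by simpa using he, by simpa using hs⟩

/-- The ways in which an extraction with at most one fault detects the error `e`: the error that it
leaves, with the coordinates `xs` and `ys` that the decoder reads off. -/
inductive SingleFaultDetection (e : Grid n₁ n₂) (xs : Finset (Fin n₁)) (ys : Finset (Fin n₂)) :
    Grid n₁ n₂ → Prop
  | unaffected (hs : SyndromeOf e xs ys) : SingleFaultDetection e xs ys e
  | high (x : Fin n₁) (hs : Syndrome (colSum e + Pi.single x 1) (rowSum e) xs ys) :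
      SingleFaultDetection e xs ys e
  | low (y : Fin n₂) (hs : Syndrome (colSum e) (rowSum e + Pi.single y 1) xs ys) :
      SingleFaultDetection e xs ys e
  | late (x : Fin n₁) (y : Fin n₂) (hs : SyndromeOf e xs ys) :
      SingleFaultDetection e xs ys (e + vString x {y})
  | mid (x : Fin n₁) (y : Fin n₂) (hs : Syndrome (colSum e) (rowSum e + Pi.single y 1) xs ys) :
      SingleFaultDetection e xs ys (e + vString x {y})
  | early (x : Fin n₁) (y : Fin n₂) (hs : SyndromeOf (e + vString x {y}) xs ys) :
      SingleFaultDetection e xs ys (e + vString x {y})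

theorem rowSum_vString_singleton (x : Fin n₁) (y : Fin n₂) :
    rowSum (vString x {y}) = Pi.single y 1 := by
  rw [vString_singleton, rowSum_hString, Finset.card_singleton, Nat.cast_one]

theorem Detects.singleFaultDetection (h : Detects 1 e e' xs ys) :
    SingleFaultDetection e xs ys e' := by
  obtain ⟨es, hlen, hes, rfl, hverify, hs⟩ := h
  match es, hlen with
  | [], _ => simpa using SingleFaultDetection.unaffected (by simpa using hs)
  | [p], _ =>
    simp only [List.sum_singleton] at hverify hs ⊢
    cases hes _ (List.mem_singleton_self _) with
    | gauge t =>
      rw [add_zero] at hs ⊢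
      refine .unaffected ?_
      have hflip := hs.add_const t
      rwa [add_left_comm, ZModModule.add_self, add_zero] at hflip
    | high x => simpa using SingleFaultDetection.high x (by simpa using hs)
    | low y => simpa using SingleFaultDetection.low y (by simpa using hs)
    | late x y => exact .late x y (by simpa using hs)
    | mid x y => exact .mid x y (by simpa using hs)
    | early x y =>
      refine .early x y ?_
      rwa [SyndromeOf, colSum_add, rowSum_add, rowSum_vString_singleton, colSum_vString,
        Finset.card_singleton, Nat.cast_one]
    | verify h => exact absurd hverify one_ne_zero

/-- Two errors in one row after a cycle in which the decoder only saw a column, so that it forbids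
input errors in the next cycle. -/
def IsDeferredPair (e : Grid n₁ n₂) (m : Memory n₁ n₂) : Prop :=
  (∃ x x' y, x ≠ x' ∧ SameError e (vString x {y} + vString x' {y})) ∧ m = ⟨∅, ∅, 1, false⟩

theorem DecodeCase.hooks_eq (h : DecodeCase m xs ys c m') :
    m'.hookCols = ∅ ∧ m'.hookRows = ∅ := by
  cases h <;> exact ⟨rfl, rfl⟩

theorem sameError_add_of_sameError_zero (he : SameError e 0) (f : Grid n₁ n₂) :
    SameError (e + f) f := by
  simpa using he.add (SameError.refl f)

theorem IsDetectEffect.isGenWeightLeOne (hp : IsDetectEffect p) : IsGenWeightLeOne p.1 ∅ ∅ := by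
  cases hp with
  | late x y | mid x y | early x y => exact isGenWeightLeOne_of_point (SameError.refl _)
  | _ => exact isGenWeightLeOne_of_sameError_zero (SameError.refl _)

theorem IsDetectEffect.cases_low (hp : IsDetectEffect p) :
    p.1 = 0 ∨ (p.2.2.1 = 0 ∧ p.2.2.2 = 0) ∨ ∃ y, p.2.2.2 = Pi.single y 1 := by
  cases hp with
  | late x y => exact .inr (.inl ⟨rfl, rfl⟩)
  | mid x y | early x y => exact .inr (.inr ⟨y, rfl⟩)
  | _ => exact .inl rfl

theorem IsDetectEffect.card_ones_low_le_one (hp : IsDetectEffect p) :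
    (ones p.2.2.2).card ≤ 1 := by
  cases hp <;> simp [ones_zero, ones_single]

theorem IsDetectEffect.eq_of_syndrome_point (hn₁ : 3 ≤ n₁) (hp : IsDetectEffect p)
    (hs : Syndrome p.2.2.1 p.2.2.2 {x} {y}) : p.1 = vString x {y} := by
  have hlow := hs.low
  have hhigh := hs.eq_of_card_lt
  cases hp with
  | low | mid =>
    exact absurd (hhigh (by simpa [ones_zero] using by omega)) (by simp [ones_zero])
  | early x' y' =>
    rw [ones_single, Finset.singleton_inj] at hlow
    have hx := hhigh (by simpa [ones_single] using by omega)
    rw [ones_single, Finset.singleton_inj] at hx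
    rw [hlow, hx]
  | _ => simp [ones_zero] at hlow

theorem Syndrome.odd_card_of_high (hn₁ : Even n₁)
    (hs : Syndrome (colSum e + Pi.single x 1) (rowSum e) xs ys) : Odd (xs.card + ys.card) := by
  rw [← ZMod.natCast_eq_one_iff_odd, hs.card_add_card hn₁]
  simp [Finset.sum_add_distrib, sum_colSum, add_right_comm, CharTwo.add_self_eq_zero]

theorem Syndrome.odd_card_of_low (hn₁ : Even n₁)
    (hs : Syndrome (colSum e) (rowSum e + Pi.single y 1) xs ys) : Odd (xs.card + ys.card) := by
  rw [← ZMod.natCast_eq_one_iff_odd, hs.card_add_card hn₁]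
  simp [Finset.sum_add_distrib, sum_colSum, ← add_assoc, CharTwo.add_self_eq_zero]

theorem DecodeCase.of_odd (hn₂ : Even n₂) (h : DecodeCase m xs ys c m')
    (hodd : Odd (xs.card + ys.card)) :
    m.hookCols = ∅ ∧ m.hookRows = ∅ ∧ xs.card + ys.card = 1 ∧ c = 0 ∧
      m' = ⟨∅, ∅, 1, decide (xs = ∅)⟩ := by
  rw [← Nat.not_even_iff_odd] at hodd
  cases h with
  | single h1 h2 h3 => exact ⟨h1, h2, h3, rfl, rfl⟩
  | trivial _ _ h h' => simp [h, h'] at hodd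
  | point _ _ x y h h' => simp [h, h'] at hodd
  | column _ _ x h h' => simp [h, h', hn₂] at hodd
  | vertical x _ _ h =>
    rw [Nat.even_add, h] at hodd
    split_ifs at hodd <;> simp_all
  | horizontal y _ _ h =>
    rw [Nat.even_add, h] at hodd
    split_ifs at hodd <;> simp_all

theorem not_syndrome_column_of_effects [EvenLength n₂] (hp : IsDetectEffect p)
    (hq : IsDetectEffect q) :
    ¬ Syndrome (p + q).2.2.1 (p + q).2.2.2 xs Finset.univ := by
  intro hs
  have hn₂ := EvenLength.four_le (n := n₂)
  have hlow := hs.low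
  simp only [Prod.snd_add, ones_add] at hlow
  have hcard := Finset.card_le_card (symmDiff_le_sup : symmDiff (ones p.2.2.2) (ones q.2.2.2) ≤ _)
  have hunion := Finset.card_union_le (ones p.2.2.2) (ones q.2.2.2)
  have hp₁ := hp.card_ones_low_le_one
  have hq₁ := hq.card_ones_low_le_one
  rw [← hlow, Finset.card_fin, Finset.sup_eq_union] at hcard
  omega

variable [EvenLength n₁]

theorem leTwo_of_effects_of_point (hp : IsDetectEffect p) (hq : IsDetectEffect q)
    (hs : Syndrome (p + q).2.2.1 (p + q).2.2.2 {x} {y}) :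
    IsGenWeightLeTwo ((p + q).1 + vString x {y}) ∅ ∅ := by
  have hn₁ : 3 ≤ n₁ := Nat.le_of_succ_le EvenLength.four_le
  have hxy : IsGenWeightLeOne (vString x {y}) ∅ ∅ := isGenWeightLeOne_of_point (SameError.refl _)
  rw [Prod.fst_add]
  simp only [Prod.snd_add, Prod.fst_add] at hs
  rcases hp.cases_low with hp₀ | hplate | ⟨y₁, hpy⟩
  · rw [hp₀, zero_add]
    exact .add_unflagged hq.isGenWeightLeOne hxy
  · rw [hplate.1, hplate.2, zero_add, zero_add] at hs
    rw [hq.eq_of_syndrome_point hn₁ hs, add_assoc, ZModModule.add_self, add_zero]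
    exact hp.isGenWeightLeOne.leTwo
  rcases hq.cases_low with hq₀ | hqlate | ⟨y₂, hqy⟩
  · rw [hq₀, add_zero]
    exact .add_unflagged hp.isGenWeightLeOne hxy
  · rw [hqlate.1, hqlate.2, add_zero, add_zero] at hs
    rw [hp.eq_of_syndrome_point hn₁ hs, add_right_comm, ZModModule.add_self, zero_add]
    exact hq.isGenWeightLeOne.leTwo
  · have hsum := natCast_card_ones (p.2.2.2 + q.2.2.2)
    rw [← hs.low, hpy, hqy] at hsum
    simp [Finset.sum_add_distrib, CharTwo.add_self_eq_zero] at hsum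

variable [EvenLength n₂]

theorem Syndrome.eq_of_vString_of_low {S : Finset (Fin n₂)}
    (hs : Syndrome (colSum e) (rowSum e + Pi.single y 1) xs ys) (he : SameError e (vString x S)) :
    xs = (if Even S.card then ∅ else {x}) ∧ ys = symmDiff S {y} := by
  have hn₁ := EvenLength.four_le (n := n₁)
  replace hs := Syndrome.congr (h := 0) EvenLength.even EvenLength.even he (by rwa [add_zero])
  rw [add_zero] at hs
  refine ⟨(hs.eq_of_card_lt ?_).trans (ones_colSum_vString x S), ?_⟩
  · rw [ones_colSum_vString]
    split_ifs <;> simp only [Finset.card_empty, Finset.card_singleton] <;> omega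
  · rw [hs.low, ones_add, ones_rowSum_vString, ones_single]

theorem decodeSets_blank_of_low (he : SameError e 0)
    (hs : Syndrome (colSum e) (rowSum e + Pi.single y 1) xs ys) :
    decodeSets Memory.blank xs ys = some (0, ⟨∅, ∅, 1, true⟩) := by
  obtain ⟨rfl, rfl⟩ := hs.eq_of_vString_of_low (x := ⟨0, EvenLength.pos n₁⟩) (S := ∅)
    (by rwa [vString_empty])
  rw [← Finset.bot_eq_empty, bot_symmDiff]
  simp [decodeSets, decodeBody, Memory.blank]

theorem decodeSets_blank_of_high (he : SameError e 0)
    (hs : Syndrome (colSum e + Pi.single x 1) (rowSum e) xs ys) :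
    decodeSets Memory.blank xs ys = some (0, ⟨∅, ∅, 1, false⟩) := by
  have hn₁ := EvenLength.four_le (n := n₁)
  replace hs := Syndrome.congr (l := 0) EvenLength.even EvenLength.even he
    (by rwa [add_zero (rowSum e)])
  rw [colSum_zero, rowSum_zero, zero_add, zero_add] at hs
  have hxs := hs.eq_of_card_lt (by rw [ones_single, Finset.card_singleton]; omega)
  rw [ones_single] at hxs
  have hys := hs.low
  rw [ones_zero] at hys
  simp [decodeSets, decodeBody, Memory.blank, hxs, hys]

theorem sameError_zero_of_decodeSets (he : IsGenWeightLeOne e m.hookCols m.hookRows)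
    (hs : SyndromeOf e xs ys) (h : decodeSets m xs ys = some (c, m')) :
    SameError (e + c) 0 ∧ m' = Memory.blank := by
  obtain ⟨c', hc', hz⟩ := decodeBody_of_isGenWeightLeOne he hs
  rw [decodeBody_of_decodeSets h] at hc'
  obtain ⟨rfl, rfl⟩ := Prod.mk.inj (Option.some.inj hc')
  exact ⟨hz, rfl⟩

theorem leOne_or_isDeferredPair_of_mid (he : IsGenWeightLeOne e ∅ ∅)
    (hs : Syndrome (colSum e) (rowSum e + Pi.single y 1) xs ys) (hcard : xs.card + ys.card = 1)
    (x : Fin n₁) : IsGenWeightLeOne (e + vString x {y}) ∅ ∅ ∨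
      IsDeferredPair (e + vString x {y}) ⟨∅, ∅, 1, decide (xs = ∅)⟩ := by
  obtain ⟨x₀, S, hS, he⟩ := he.unflagged (EvenLength.pos n₁)
  obtain ⟨hxs, hys⟩ := hs.eq_of_vString_of_low he
  rcases hS with rfl | ⟨y₀, rfl⟩ | rfl
  · rw [vString_empty] at he
    exact .inl (isGenWeightLeOne_of_point (sameError_add_of_sameError_zero he _))
  · rw [if_neg (by simp)] at hxs
    have hys₀ : ys = ∅ := Finset.card_eq_zero.1 (by rw [hxs, Finset.card_singleton] at hcard; omega)
    obtain rfl : y₀ = y := by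
      rw [hys₀, eq_comm, ← Finset.bot_eq_empty, symmDiff_eq_bot] at hys
      exact Finset.singleton_inj.1 hys
    have hpair := he.add (SameError.refl (vString x {y₀}))
    by_cases hx : x₀ = x
    · subst hx
      rw [ZModModule.add_self] at hpair
      exact .inl (isGenWeightLeOne_of_sameError_zero hpair)
    · exact .inr ⟨⟨x₀, x, y₀, hx, hpair⟩, by simp [hxs]⟩
  · have hn₂ := EvenLength.four_le (n := n₂)
    rw [hys, ← Finset.top_eq_univ, top_symmDiff, hnot_eq_compl, Finset.card_compl,
      Fintype.card_fin, Finset.card_singleton] at hcard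
    omega

theorem leOne_or_isDeferredPair_of_decodeSets (he : IsGenWeightLeOne e m.hookCols m.hookRows)
    (hd : Detects 1 e e' xs ys) (h : decodeSets m xs ys = some (c, m')) :
    IsGenWeightLeOne (e' + c) m'.hookCols m'.hookRows ∨ IsDeferredPair (e' + c) m' := by
  have hbody := decodeBody_of_decodeSets h
  have hcase := DecodeCase.of_decodeBody (EvenLength.pos n₁) hbody
  obtain ⟨hC, hR⟩ := hcase.hooks_eq
  cases hd.singleFaultDetection with
  | unaffected hs =>
    rw [hC, hR]
    exact .inl (isGenWeightLeOne_of_sameError_zero (sameError_zero_of_decodeSets he hs h).1)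
  | high x hs =>
    obtain ⟨hmC, hmR, -, rfl, rfl⟩ :=
      hcase.of_odd EvenLength.even (hs.odd_card_of_high EvenLength.even)
    rw [add_zero]
    rw [hmC, hmR] at he
    exact .inl he
  | low y hs =>
    obtain ⟨hmC, hmR, -, rfl, rfl⟩ :=
      hcase.of_odd EvenLength.even (hs.odd_card_of_low EvenLength.even)
    rw [add_zero]
    rw [hmC, hmR] at he
    exact .inl he
  | late x y hs =>
    rw [hC, hR, add_right_comm]
    exact .inl (isGenWeightLeOne_of_point
      (sameError_add_of_sameError_zero (sameError_zero_of_decodeSets he hs h).1 _))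
  | mid x y hs =>
    obtain ⟨hmC, hmR, hcard, rfl, rfl⟩ :=
      hcase.of_odd EvenLength.even (hs.odd_card_of_low EvenLength.even)
    rw [add_zero]
    rw [hmC, hmR] at he
    exact leOne_or_isDeferredPair_of_mid he hs hcard x
  | early x y hs =>
    have he' := isGenWeightLeOne_of_decodeBody
      (.add_unflagged he (isGenWeightLeOne_of_point (SameError.refl _))) hs hbody
    rw [hC, hR]
    exact .inl (isGenWeightLeOne_of_sameError_zero (sameError_zero_of_decodeSets he' hs h).1)

theorem exists_decodeSets_blank (he : SameError e 0) (hd : Detects 1 e e' xs ys) :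
    ∃ c m', decodeSets Memory.blank xs ys = some (c, m') ∧
      IsGenWeightLeOne (e' + c) m'.hookCols m'.hookRows ∧
      (m'.inputErrorAllowed = true ∨ IsWeightZero (e' + c) m'.hookCols m'.hookRows) := by
  have he₁ := isGenWeightLeOne_of_sameError_zero he
  have hpoint (x y) : IsGenWeightLeOne (e + vString x {y}) ∅ ∅ :=
    isGenWeightLeOne_of_point (sameError_add_of_sameError_zero he _)
  have hblank : decodeSets Memory.blank xs ys = decodeBody Memory.blank xs ys :=
    decodeSets_of_allowed rfl
  cases hd.singleFaultDetection with
  | unaffected hs =>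
    obtain ⟨c, hc, hz⟩ := decodeBody_of_isGenWeightLeOne (m := Memory.blank) he₁ hs
    exact ⟨c, _, hblank.trans hc, isGenWeightLeOne_of_sameError_zero hz, .inl rfl⟩
  | high x hs =>
    exact ⟨0, _, decodeSets_blank_of_high he hs, by rwa [add_zero],
      .inr ⟨by rwa [add_zero], rfl, rfl⟩⟩
  | low y hs => exact ⟨0, _, decodeSets_blank_of_low he hs, by rwa [add_zero], .inl rfl⟩
  | late x y hs =>
    obtain ⟨c, hc, hz⟩ := decodeBody_of_isGenWeightLeOne (m := Memory.blank) he₁ hs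
    refine ⟨c, _, hblank.trans hc, isGenWeightLeOne_of_point (x := x) (y := y) ?_, .inl rfl⟩
    rw [add_right_comm]
    exact sameError_add_of_sameError_zero hz _
  | mid x y hs =>
    exact ⟨0, _, decodeSets_blank_of_low he hs, by rw [add_zero]; exact hpoint x y, .inl rfl⟩
  | early x y hs =>
    obtain ⟨c, hc, hz⟩ := decodeBody_of_isGenWeightLeOne (m := Memory.blank) (hpoint x y) hs
    exact ⟨c, _, hblank.trans hc, isGenWeightLeOne_of_sameError_zero hz, .inl rfl⟩

theorem not_syndromeOf_pair_add (hx : x ≠ x') (he : SameError e (vString x {y} + vString x' {y}))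
    (hf : IsGenWeightLeOne f ∅ ∅) : ¬ SyndromeOf (e + f) ∅ ∅ := by
  intro hs
  have hn₁ := EvenLength.four_le (n := n₁)
  rw [vString_singleton, vString_singleton, hString_add_hString,
    symmDiff_singleton_of_notMem (by simpa using hx.symm)] at he
  have hcard : ({x', x} : Finset (Fin n₁)).card = 2 := Finset.card_pair hx.symm
  obtain ⟨x₀, S, -, hf⟩ := hf.unflagged (EvenLength.pos n₁)
  have hef := SyndromeOf.congr EvenLength.even EvenLength.even (he.add hf) hs
  obtain rfl : ∅ = S := by
    have hlow := hef.low
    rwa [rowSum_add, ones_add, ones_rowSum_hString, if_pos (by simp [hcard]), ones_rowSum_vString,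
      ← Finset.bot_eq_empty, bot_symmDiff] at hlow
  rw [vString_empty, add_zero] at hef
  rcases hef.eq_of_hString.1 with hpair | hcompl
  · simp [← hpair] at hcard
  · rw [eq_comm, Finset.compl_eq_empty_iff] at hcompl
    rw [hcompl, Finset.card_fin] at hcard
    omega

theorem not_detects_pair (hx : x ≠ x') (he : SameError e (vString x {y} + vString x' {y})) :
    ¬ Detects 1 e e' ∅ ∅ := by
  intro hd
  cases hd.singleFaultDetection with
  | unaffected hs | late _ _ hs =>
    exact not_syndromeOf_pair_add hx he (isGenWeightLeOne_of_sameError_zero (SameError.refl 0))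
      (by rwa [add_zero])
  | high _ hs => simpa using hs.odd_card_of_high EvenLength.even
  | low _ hs | mid _ _ hs => simpa using hs.odd_card_of_low EvenLength.even
  | early _ _ hs =>
    exact not_syndromeOf_pair_add hx he (isGenWeightLeOne_of_point (SameError.refl _)) hs

theorem leTwo_of_decodeSets (he : SameError e 0) (hC : m.hookCols = ∅) (hR : m.hookRows = ∅)
    (hd : Detects 2 e e' xs ys) (h : decodeSets m xs ys = some (c, m')) :
    IsGenWeightLeTwo (e' + c) m'.hookCols m'.hookRows := by
  have hcase := DecodeCase.of_decodeBody (EvenLength.pos n₁) (decodeBody_of_decodeSets h)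
  obtain ⟨hC', hR'⟩ := hcase.hooks_eq
  obtain ⟨p, q, hp, hq, rfl, hs⟩ := hd.exists_effects
  replace hs := Syndrome.congr EvenLength.even EvenLength.even he hs
  rw [colSum_zero, rowSum_zero, zero_add, zero_add] at hs
  rw [hC', hR', add_assoc]
  refine IsGenWeightLeTwo.congr (sameError_add_of_sameError_zero he _) ?_
  cases hcase with
  | single | trivial =>
    rw [add_zero]
    exact .add_unflagged hp.isGenWeightLeOne hq.isGenWeightLeOne
  | point _ _ x y hx hy =>
    subst hx hy
    exact leTwo_of_effects_of_point hp hq hs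
  | column _ _ _ _ hy => exact absurd (hy ▸ hs) (not_syndrome_column_of_effects hp hq)
  | vertical x hx => exact absurd (hx.symm.trans hC) (Finset.singleton_ne_empty x)
  | horizontal y _ hy => exact absurd (hy.symm.trans hR) (Finset.singleton_ne_empty y)

end Faulty

/-! ## The evolution of the errors of one type -/

section Steps

variable {n₁ n₂ : ℕ} {e e' e₁ δ f : Grid n₁ n₂} {m m' m₁ : Memory n₁ n₂} {C C' : Finset (Fin n₁)}
  {R R' : Finset (Fin n₂)} {j j' : ℕ} {g p : Flagged n₁ n₂}

/-- With at most `k` faults, a half cycle causes the hook error `δ`, up to stabilizers, and raises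
the flags of the columns `C` and of the rows `R`. -/
def Hooks (k : ℕ) (δ : Grid n₁ n₂) (C : Finset (Fin n₁)) (R : Finset (Fin n₂)) : Prop :=
  ∃ g ∈ hookGauge n₁ n₂, ∃ es : List (Flagged n₁ n₂), es.length ≤ k ∧
    (∀ p ∈ es, p ∈ hookEffects n₁ n₂) ∧ δ = (g + es.sum).1 ∧ C = ones (g + es.sum).2.1 ∧
    R = ones (g + es.sum).2.2

/-- The passage of an error `e` and a memory `m` of the type that a half cycle does not detect,
through this half cycle with at most `k` faults. -/
def HookStep (k : ℕ) (e : Grid n₁ n₂) (m : Memory n₁ n₂) (e' : Grid n₁ n₂) (m' : Memory n₁ n₂) :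
    Prop :=
  ∃ δ C R, Hooks k δ C R ∧ e' = e + δ ∧
    m' = { m with hookCols := m.hookCols ∪ C, hookRows := m.hookRows ∪ R }

/-- The passage of an error `e` and a memory `m` of the type that a half cycle detects and corrects,
through this half cycle with at most `k` faults. -/
def DetectStep (k : ℕ) (e : Grid n₁ n₂) (m : Memory n₁ n₂) (e' : Grid n₁ n₂)
    (m' : Memory n₁ n₂) : Prop :=
  ∃ e₁ xs ys c, Detects k e e₁ xs ys ∧ decodeSets m xs ys = some (c, m') ∧ e' = e₁ + c

/-- The decoder may halt on the error `e` with the memory `m`, after at most `k` faults in the half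
cycle that detects `e`. -/
def DetectHalt (k : ℕ) (e : Grid n₁ n₂) (m : Memory n₁ n₂) : Prop :=
  ∃ e₁ xs ys, Detects k e e₁ xs ys ∧ decodeSets m xs ys = none

/-- The condition of `CycleState.ErrorFree` on the errors of one type. -/
def IsClean (e : Grid n₁ n₂) (m : Memory n₁ n₂) : Prop := SameError e 0 ∧ m = Memory.blank

/-- The condition of `CycleState.Allowed` on the errors of one type. -/
def IsAllowed (e : Grid n₁ n₂) (m : Memory n₁ n₂) : Prop :=
  m.inputErrorAllowed = true ∨ IsWeightZero e m.hookCols m.hookRows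

theorem Hooks.mono (h : Hooks j δ C R) (hj : j ≤ j') : Hooks j' δ C R := by
  obtain ⟨g, hg, es, hlen, h⟩ := h
  exact ⟨g, hg, es, hlen.trans hj, h⟩

theorem HookStep.mono (h : HookStep j e m e' m') (hj : j ≤ j') : HookStep j' e m e' m' := by
  obtain ⟨δ, C, R, h, h'⟩ := h
  exact ⟨δ, C, R, h.mono hj, h'⟩

theorem DetectStep.mono (h : DetectStep j e m e' m') (hj : j ≤ j') : DetectStep j' e m e' m' := by
  obtain ⟨e₁, xs, ys, c, h, h'⟩ := h
  exact ⟨e₁, xs, ys, c, h.mono hj, h'⟩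

theorem DetectHalt.mono (h : DetectHalt j e m) (hj : j ≤ j') : DetectHalt j' e m := by
  obtain ⟨e₁, xs, ys, h, h'⟩ := h
  exact ⟨e₁, xs, ys, h.mono hj, h'⟩

theorem IsClean.leOne (h : IsClean e m) : IsGenWeightLeOne e m.hookCols m.hookRows := by
  obtain ⟨he, rfl⟩ := h
  exact isGenWeightLeOne_of_sameError_zero he

theorem IsClean.isAllowed (h : IsClean e m) : IsAllowed e m := by
  obtain ⟨-, rfl⟩ := h
  exact .inl rfl

theorem IsDeferredPair.leTwo (h : IsDeferredPair e m) :
    IsGenWeightLeTwo e m.hookCols m.hookRows := by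
  obtain ⟨⟨x, x', y, -, he⟩, rfl⟩ := h
  exact (IsGenWeightLeTwo.add_unflagged (isGenWeightLeOne_of_point (SameError.refl _))
    (isGenWeightLeOne_of_point (SameError.refl _))).congr he

theorem add_mem_hookEffects_of_mem_hookGauge (hg : g ∈ hookGauge n₁ n₂)
    (hp : p ∈ hookEffects n₁ n₂) : g + p ∈ hookEffects n₁ n₂ := by
  obtain ⟨hstab, hflags⟩ := Submodule.mem_prod.1 hg
  rw [Submodule.mem_bot] at hflags
  have hgp : SameError (g.1 + p.1) p.1 := by simpa [SameError] using hstab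
  simpa [hookEffects, hflags] using IsGenWeightLeOne.congr hgp hp

theorem IsGenWeightLeOne.add_symmDiff (hn₁ : 0 < n₁) (he : IsGenWeightLeOne e C R)
    (hf : IsGenWeightLeOne f C' R') :
    IsGenWeightLeTwo (e + f) (symmDiff C C') (symmDiff R R') := by
  have of_disjoint (hC : Disjoint C C') (hR : Disjoint R R') :
      IsGenWeightLeTwo (e + f) (symmDiff C C') (symmDiff R R') := by
    rw [hC.symmDiff_eq_sup, hR.symmDiff_eq_sup]
    exact .add he hf
  rcases he.cases hn₁ with ⟨_, _, _, _, rfl, rfl⟩ | ⟨x, S, heS, rfl, rfl⟩ | ⟨y, S, heS, rfl, rfl⟩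
  · exact of_disjoint (Finset.disjoint_empty_left _) (Finset.disjoint_empty_left _)
  · rcases hf.cases hn₁ with ⟨_, _, _, _, rfl, rfl⟩ | ⟨x', S', hfS, rfl, rfl⟩ | ⟨_, _, _, rfl, rfl⟩
    · exact of_disjoint (Finset.disjoint_empty_right _) (Finset.disjoint_empty_right _)
    · obtain rfl | hx := eq_or_ne x x'
      · exact .inr (.inl ⟨x, _, heS.add_vString hfS, symmDiff_self _, symmDiff_self _⟩)
      · exact of_disjoint (Finset.disjoint_singleton.2 hx) (Finset.disjoint_empty_left _)
    · exact of_disjoint (Finset.disjoint_empty_right _) (Finset.disjoint_empty_left _)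
  · rcases hf.cases hn₁ with ⟨_, _, _, _, rfl, rfl⟩ | ⟨_, _, _, rfl, rfl⟩ | ⟨y', S', hfS, rfl, rfl⟩
    · exact of_disjoint (Finset.disjoint_empty_right _) (Finset.disjoint_empty_right _)
    · exact of_disjoint (Finset.disjoint_empty_left _) (Finset.disjoint_empty_right _)
    · obtain rfl | hy := eq_or_ne y y'
      · exact .inr (.inr ⟨y, _, heS.add_hString hfS, symmDiff_self _, symmDiff_self _⟩)
      · exact of_disjoint (Finset.disjoint_empty_left _) (Finset.disjoint_singleton.2 hy)

theorem Hooks.sameError_zero (h : Hooks 0 δ C R) : SameError δ 0 ∧ C = ∅ ∧ R = ∅ := by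
  obtain ⟨g, hg, es, hlen, -, rfl, rfl, rfl⟩ := h
  obtain rfl : es = [] := List.length_eq_zero_iff.1 (Nat.le_zero.1 hlen)
  obtain ⟨hstab, hflags⟩ := Submodule.mem_prod.1 hg
  rw [Submodule.mem_bot] at hflags
  rw [List.sum_nil, add_zero, hflags]
  exact ⟨by simpa [SameError] using hstab, ones_zero, ones_zero⟩

theorem Hooks.leOne (h : Hooks 1 δ C R) : IsGenWeightLeOne δ C R := by
  obtain ⟨g, hg, es, hlen, hes, rfl, rfl, rfl⟩ := h
  match es, hlen with
  | [], _ => simpa [hookEffects] using mem_hookEffects_of_mem_hookGauge hg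
  | [p], _ =>
    simpa [hookEffects] using add_mem_hookEffects_of_mem_hookGauge hg (hes p (by simp))

theorem Hooks.leTwo (hn₁ : 0 < n₁) (h : Hooks 2 δ C R) : IsGenWeightLeTwo δ C R := by
  obtain ⟨g, hg, es, hlen, hes, rfl, rfl, rfl⟩ := h
  match es, hlen with
  | [], _ => simpa using IsGenWeightLeOne.leTwo (mem_hookEffects_of_mem_hookGauge hg)
  | [p], _ =>
    simpa using IsGenWeightLeOne.leTwo
      (add_mem_hookEffects_of_mem_hookGauge hg (hes p (by simp)))
  | [p, q], _ =>
    have hsum := IsGenWeightLeOne.add_symmDiff hn₁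
      (add_mem_hookEffects_of_mem_hookGauge hg (hes p (by simp))) (hes q (by simp))
    simpa [← ones_add, add_assoc] using hsum

theorem HookStep.refl (e : Grid n₁ n₂) (m : Memory n₁ n₂) : HookStep 0 e m e m :=
  ⟨0, ∅, ∅, ⟨0, zero_mem _, [], le_rfl, by simp, by simp, by simp [ones], by simp [ones]⟩,
    (add_zero e).symm, by simp⟩

theorem HookStep.sameError (h : HookStep 0 e m e' m') : SameError e' e ∧ m' = m := by
  obtain ⟨δ, C, R, h, rfl, rfl⟩ := h
  obtain ⟨hδ, rfl, rfl⟩ := h.sameError_zero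
  exact ⟨by simpa using (SameError.refl e).add hδ, by simp⟩

theorem HookStep.leOne (h : HookStep 0 e m e' m')
    (he : IsGenWeightLeOne e m.hookCols m.hookRows) :
    IsGenWeightLeOne e' m'.hookCols m'.hookRows := by
  obtain ⟨hs, rfl⟩ := h.sameError
  exact he.congr hs

theorem HookStep.leOne_of_leOne (h : HookStep 0 e m e' m')
    (he : IsGenWeightLeOne e' m'.hookCols m'.hookRows) :
    IsGenWeightLeOne e m.hookCols m.hookRows := by
  obtain ⟨hs, rfl⟩ := h.sameError
  exact he.congr hs.symm

theorem HookStep.leTwo (h : HookStep 0 e m e' m')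
    (he : IsGenWeightLeTwo e m.hookCols m.hookRows) :
    IsGenWeightLeTwo e' m'.hookCols m'.hookRows := by
  obtain ⟨hs, rfl⟩ := h.sameError
  exact he.congr hs

theorem HookStep.isClean (h : HookStep 0 e m e' m') (he : IsClean e m) : IsClean e' m' := by
  obtain ⟨hs, rfl⟩ := h.sameError
  exact ⟨hs.trans he.1, he.2⟩

theorem HookStep.isAllowed (h : HookStep 0 e m e' m') (he : IsAllowed e m) : IsAllowed e' m' := by
  obtain ⟨hs, rfl⟩ := h.sameError
  exact he.imp_right fun hzero => ⟨hs.trans hzero.1, hzero.2⟩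

theorem HookStep.isDeferredPair (h : HookStep 0 e m e' m') (he : IsDeferredPair e m) :
    IsDeferredPair e' m' := by
  obtain ⟨hs, rfl⟩ := h.sameError
  obtain ⟨⟨x, x', y, hx, he⟩, hm⟩ := he
  exact ⟨⟨x, x', y, hx, hs.trans he⟩, hm⟩

theorem HookStep.leOne_of_isClean (h : HookStep 1 e m e' m') (hc : IsClean e m) :
    IsGenWeightLeOne e' m'.hookCols m'.hookRows ∧ m'.inputErrorAllowed = true := by
  obtain ⟨δ, C, R, h, rfl, rfl⟩ := h
  obtain ⟨he, rfl⟩ := hc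
  exact ⟨by simpa [Memory.blank] using h.leOne.congr (sameError_add_of_sameError_zero he δ), rfl⟩

theorem HookStep.leTwo_of_leOne (h : HookStep 1 e m e' m')
    (he : IsGenWeightLeOne e m.hookCols m.hookRows) :
    IsGenWeightLeTwo e' m'.hookCols m'.hookRows := by
  obtain ⟨δ, C, R, h, rfl, rfl⟩ := h
  exact .add he h.leOne

theorem HookStep.leTwo_of_isClean (hn₁ : 0 < n₁) (h : HookStep 2 e m e' m') (hc : IsClean e m) :
    IsGenWeightLeTwo e' m'.hookCols m'.hookRows := by
  obtain ⟨δ, C, R, h, rfl, rfl⟩ := h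
  obtain ⟨he, rfl⟩ := hc
  simpa [Memory.blank] using (h.leTwo hn₁).congr (sameError_add_of_sameError_zero he δ)

variable [EvenLength n₁] [EvenLength n₂]

theorem DetectStep.isClean_of_leOne (h : DetectStep 0 e m e' m')
    (he : IsGenWeightLeOne e m.hookCols m.hookRows) : IsClean e' m' := by
  obtain ⟨e₁, xs, ys, c, hd, h, rfl⟩ := h
  obtain ⟨rfl, hs⟩ := hd.eq_and_syndromeOf
  exact sameError_zero_of_decodeSets he hs h

theorem DetectStep.leOne_of_leTwo (h : DetectStep 0 e m e' m')
    (he : IsGenWeightLeTwo e m.hookCols m.hookRows) :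
    IsGenWeightLeOne e m.hookCols m.hookRows := by
  obtain ⟨e₁, xs, ys, c, hd, h, rfl⟩ := h
  exact isGenWeightLeOne_of_decodeBody he hd.eq_and_syndromeOf.2 (decodeBody_of_decodeSets h)

theorem DetectStep.isClean_of_leTwo (h : DetectStep 0 e m e' m')
    (he : IsGenWeightLeTwo e m.hookCols m.hookRows) : IsClean e' m' :=
  h.isClean_of_leOne (h.leOne_of_leTwo he)

theorem not_detectHalt_of_leOne (he : IsGenWeightLeOne e m.hookCols m.hookRows)
    (ha : IsAllowed e m) : ¬ DetectHalt 0 e m := by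
  rintro ⟨e₁, xs, ys, hd, h⟩
  obtain ⟨rfl, hs⟩ := hd.eq_and_syndromeOf
  obtain ⟨c, hc, -⟩ := decodeBody_of_isGenWeightLeOne he hs
  rcases ha with ha | ⟨hzero, hC, hR⟩
  · rw [decodeSets_of_allowed ha, hc] at h
    exact Option.some_ne_none _ h
  · rw [← vString_empty ⟨0, EvenLength.pos n₁⟩] at hzero
    obtain ⟨hxs, hys⟩ := hs.of_vString hzero
    rw [Finset.card_empty, if_pos Even.zero] at hxs
    rw [decodeSets, if_neg (by simp [hxs, hys, hC, hR]), hc] at h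
    exact Option.some_ne_none _ h

theorem not_detectHalt_of_isClean (hc : IsClean e m) : ¬ DetectHalt 1 e m := by
  rintro ⟨e₁, xs, ys, hd, h⟩
  obtain ⟨he, rfl⟩ := hc
  obtain ⟨c, m', hsome, -⟩ := exists_decodeSets_blank he hd
  exact Option.some_ne_none _ (hsome.symm.trans h)

theorem DetectStep.leOne_of_isClean (h : DetectStep 1 e m e' m') (hc : IsClean e m) :
    IsGenWeightLeOne e' m'.hookCols m'.hookRows ∧ IsAllowed e' m' := by
  obtain ⟨e₁, xs, ys, c, hd, h, rfl⟩ := h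
  obtain ⟨he, rfl⟩ := hc
  obtain ⟨c', m'', hsome, hle⟩ := exists_decodeSets_blank he hd
  obtain ⟨rfl, rfl⟩ := Prod.mk.inj (Option.some.inj (hsome.symm.trans h))
  exact hle

theorem DetectStep.leOne_or_isDeferredPair (h : DetectStep 1 e m e' m')
    (he : IsGenWeightLeOne e m.hookCols m.hookRows) :
    IsGenWeightLeOne e' m'.hookCols m'.hookRows ∨ IsDeferredPair e' m' := by
  obtain ⟨e₁, xs, ys, c, hd, h, rfl⟩ := h
  exact leOne_or_isDeferredPair_of_decodeSets he hd h

theorem DetectStep.leTwo_of_isClean (h : DetectStep 2 e m e' m') (hc : IsClean e m) :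
    IsGenWeightLeTwo e' m'.hookCols m'.hookRows := by
  obtain ⟨e₁, xs, ys, c, hd, h, rfl⟩ := h
  obtain ⟨he, rfl⟩ := hc
  exact leTwo_of_decodeSets he rfl rfl hd h

theorem IsDeferredPair.not_detectStep (hp : IsDeferredPair e m) (h : HookStep j e m e₁ m₁)
    (hj : j + j' ≤ 1) : ¬ DetectStep j' e₁ m₁ e' m' := by
  rintro ⟨e₂, xs, ys, c, hd, hsome, rfl⟩
  obtain ⟨⟨x, x', y, hx, he⟩, rfl⟩ := hp
  obtain ⟨δ, C, R, h, rfl, rfl⟩ := h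
  obtain ⟨rfl, rfl, hC, hR⟩ := eq_empty_of_decodeSets hsome rfl
  simp only [Finset.empty_union] at hC hR
  subst hC hR
  obtain rfl | rfl : j = 0 ∨ j' = 0 := by omega
  · exact not_detects_pair hx (by simpa using he.add h.sameError_zero.1) (hd.mono (by omega))
  · exact not_syndromeOf_pair_add hx he (h.mono (by omega)).leOne hd.eq_and_syndromeOf.2

end Steps

/-! ## The cycle -/

section HalfCycles

variable {n₁ n₂ : ℕ}

theorem syndrome_coords (high : Fin n₁ → ZMod 2) (low : Fin n₂ → ZMod 2) :
    Syndrome high low (xCoords high) (yCoords low) := by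
  have hS : Finset.univ.filter (fun x => high x = 1) = ones high := rfl
  simp only [xCoords, hS]
  split_ifs with h
  · exact ⟨h, .inl rfl, rfl⟩
  · refine ⟨?_, .inr rfl, rfl⟩
    rw [Finset.card_compl, Fintype.card_fin]
    omega

/-- The possible outcomes of the half cycle that detects the errors of type `b.dual`, with at most
`k` faults. -/
inductive HalfStep (b : Basis) (k : ℕ) (s : CycleState n₁ n₂) : Outcome n₁ n₂ → Prop
  | discarded (hk : 0 < k) : HalfStep b k s .discarded
  | halted (h : DetectHalt k (s.err b.dual) (s.mem b.dual)) : HalfStep b k s .halted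
  | ok (s' : CycleState n₁ n₂) (hook : HookStep k (s.err b) (s.mem b) (s'.err b) (s'.mem b))
      (detect : DetectStep k (s.err b.dual) (s.mem b.dual) (s'.err b.dual) (s'.mem b.dual)) :
      HalfStep b k s (.ok s')

/-- The possible outcomes of a cycle with at most `k` faults. -/
inductive CycleStep (k : ℕ) (s : CycleState n₁ n₂) : Outcome n₁ n₂ → Prop
  | discarded (hk : 0 < k) : CycleStep k s .discarded
  | haltedZ (h : DetectHalt k (s.err .Z) (s.mem .Z)) : CycleStep k s .halted
  | haltedX (j₁ j₂ : ℕ) (hj : j₁ + j₂ ≤ k) (e : Grid n₁ n₂) (m : Memory n₁ n₂)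
      (hook : HookStep j₁ (s.err .X) (s.mem .X) e m) (h : DetectHalt j₂ e m) :
      CycleStep k s .halted
  | ok (j₁ j₂ : ℕ) (hj : j₁ + j₂ ≤ k) (s' : CycleState n₁ n₂) (eX eZ : Grid n₁ n₂)
      (mX mZ : Memory n₁ n₂)
      (hookX : HookStep j₁ (s.err .X) (s.mem .X) eX mX)
      (detectX : DetectStep j₂ eX mX (s'.err .X) (s'.mem .X))
      (detectZ : DetectStep j₁ (s.err .Z) (s.mem .Z) eZ mZ)
      (hookZ : HookStep j₂ eZ mZ (s'.err .Z) (s'.mem .Z)) : CycleStep k s (.ok s')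

/-- The run of `halfCycle b L s`. -/
def halfRun (L : List (Instr (Qubit n₁ n₂) × Event)) (s : CycleState n₁ n₂) :
    RunState (Qubit n₁ n₂) :=
  run L ⟨fun a => dataFrame (s.err a), fun _ => 0⟩

theorem halfCycle_eq (b : Basis) (L : List (Instr (Qubit n₁ n₂) × Event))
    (s : CycleState n₁ n₂) :
    halfCycle b L s = if (halfRun L s).record .check ≠ 0 then .discarded
      else match decodeSets (s.mem b.dual) (xCoords fun x => (halfRun L s).record (.anc x))
        (yCoords fun y => (halfRun L s).record (.rowAnc y)) with
      | none => .halted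
      | some (c, m) => .ok
        { err := fun a x y =>
            (halfRun L s).frame a (.data x y) + (if a = b then 0 else c x y)
          mem := fun a =>
            if a = b then
              { s.mem b with
                hookCols := (s.mem b).hookCols ∪ ones fun x => (halfRun L s).record (.flag x)
                hookRows :=
                  (s.mem b).hookRows ∪ ones fun y => (halfRun L s).record (.rowFlag y) }
            else m } := by
  have hframe : (fun (a : Basis) (q : Qubit n₁ n₂) => match q with
      | .data x y => s.err a x y
      | _ => 0) = fun a => dataFrame (s.err a) := by
    ext a q
    cases q <;> rfl
  rw [halfRun, ← hframe]
  rfl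

end HalfCycles

section Cycles

variable {k n₂ : ℕ} {b : Basis} {L : List (Instr (Qubit (k + 2) n₂) × Event)}

theorem hookStep_halfRun (hL : L.map Prod.fst = extraction (k + 2) n₂ b)
    (s : CycleState (k + 2) n₂) (m : Memory (k + 2) n₂) :
    HookStep (faults L) (s.err b) m (fun x y => (halfRun L s).frame b (.data x y))
      { m with
        hookCols := m.hookCols ∪ ones fun x => (halfRun L s).record (.flag x)
        hookRows := m.hookRows ∪ ones fun y => (halfRun L s).record (.rowFlag y) } := by
  obtain ⟨g, hg, es, hlen, hes, hrun⟩ :=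
    exists_hookEffects hL ⟨fun a => dataFrame (s.err a), fun _ => 0⟩ rfl
  have herr : (fun x y => (halfRun L s).frame b (.data x y)) = s.err b + (g + es.sum).1 := by
    rw [Prod.fst_add, ← add_assoc]
    exact congrArg Prod.fst hrun
  have hcols : (fun x => (halfRun L s).record (.flag x)) = (g + es.sum).2.1 := by
    simpa [halfRun] using congrArg (fun p => p.2.1) hrun
  have hrows : (fun y => (halfRun L s).record (.rowFlag y)) = (g + es.sum).2.2 := by
    simpa [halfRun] using congrArg (fun p => p.2.2) hrun
  rw [herr, hcols, hrows]
  exact ⟨_, _, _, ⟨g, hg, es, hlen, hes, rfl, rfl, rfl⟩, rfl, rfl⟩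

theorem faults_pos_of_check_halfRun_ne_zero (hL : L.map Prod.fst = extraction (k + 2) n₂ b)
    (s : CycleState (k + 2) n₂) (h : (halfRun L s).record .check ≠ 0) : 0 < faults L := by
  obtain ⟨t, es, hlen, -, hrun⟩ := exists_detectEffects hL
    ⟨fun a => dataFrame (s.err a), fun _ => 0⟩ (e := s.err b.dual) rfl
  refine Nat.pos_of_ne_zero fun hfaults => h ?_
  obtain rfl : es = [] := List.length_eq_zero_iff.1 (by omega)
  simpa [halfRun] using congrArg (fun p => p.2.1) hrun

theorem detects_halfRun (hL : L.map Prod.fst = extraction (k + 2) n₂ b)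
    (s : CycleState (k + 2) n₂) (h : (halfRun L s).record .check = 0) :
    Detects (faults L) (s.err b.dual) (fun x y => (halfRun L s).frame b.dual (.data x y))
      (xCoords fun x => (halfRun L s).record (.anc x))
      (yCoords fun y => (halfRun L s).record (.rowAnc y)) := by
  obtain ⟨t, es, hlen, hes, hrun⟩ := exists_detectEffects hL
    ⟨fun a => dataFrame (s.err a), fun _ => 0⟩ (e := s.err b.dual) rfl
  have herr : (fun x y => (halfRun L s).frame b.dual (.data x y)) = s.err b.dual + es.sum.1 := by
    simpa [halfRun] using congrArg Prod.fst hrun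
  have hcheck : (halfRun L s).record .check = es.sum.2.1 := by
    simpa [halfRun] using congrArg (fun p => p.2.1) hrun
  have hhigh : (fun x => (halfRun L s).record (.anc x)) =
      (fun _ => t) + (colSum (s.err b.dual) + es.sum.2.2.1) := by
    rw [← add_assoc, add_comm (fun _ => t)]
    exact congrArg (fun p => p.2.2.1) hrun
  have hlow : (fun y => (halfRun L s).record (.rowAnc y)) =
      rowSum (s.err b.dual) + es.sum.2.2.2 := by
    simpa [halfRun] using congrArg (fun p => p.2.2.2) hrun
  refine ⟨es, hlen, hes, herr, hcheck.symm.trans h, ?_⟩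
  -- The measured signs are determined up to a common flip `t`, which a second flip cancels.
  have hflip := (syndrome_coords (fun x => (halfRun L s).record (.anc x))
    fun y => (halfRun L s).record (.rowAnc y)).add_const t
  have hcancel : (fun _ => t) + (fun x => (halfRun L s).record (.anc x)) =
      colSum (s.err b.dual) + es.sum.2.2.1 := by
    rw [hhigh, ← add_assoc, ZModModule.add_self, zero_add]
  rw [hlow] at hflip ⊢
  rwa [hcancel] at hflip

theorem halfStep_halfCycle (hL : L.map Prod.fst = extraction (k + 2) n₂ b)
    (s : CycleState (k + 2) n₂) : HalfStep b (faults L) s (halfCycle b L s) := by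
  rw [halfCycle_eq]
  by_cases hcheck : (halfRun L s).record .check = 0
  · rw [if_neg (not_not.2 hcheck)]
    have hdetect := detects_halfRun hL s hcheck
    cases hdec : decodeSets (s.mem b.dual) (xCoords fun x => (halfRun L s).record (.anc x))
        (yCoords fun y => (halfRun L s).record (.rowAnc y)) with
    | none => exact .halted ⟨_, _, _, hdetect, hdec⟩
    | some p =>
      refine .ok _ ?_ ⟨_, _, _, p.1, hdetect, ?_, ?_⟩
      · simpa using hookStep_halfRun hL s (s.mem b)
      · simp [hdec, b.dual_ne]
      · simp only [if_neg b.dual_ne]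
        rfl
  · rw [if_pos hcheck]
    exact .discarded (faults_pos_of_check_halfRun_ne_zero hL s hcheck)

variable {j : ℕ} {ρ : CycleRun (k + 2) n₂}

theorem cycleStep_cycle (hρ : IsCycle j ρ) (s : CycleState (k + 2) n₂) :
    CycleStep j s (cycle ρ s) := by
  obtain ⟨hX, hZ, hj⟩ := hρ
  have hfirst := halfStep_halfCycle hX s
  rw [cycle]
  generalize halfCycle .X ρ.1 s = o at hfirst ⊢
  cases hfirst with
  | discarded hpos => exact .discarded (by omega)
  | halted h => exact .haltedZ (h.mono (by omega))
  | ok s₁ hookX detectZ =>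
    have hsecond := halfStep_halfCycle hZ s₁
    simp only
    generalize halfCycle .Z ρ.2 s₁ = o at hsecond ⊢
    cases hsecond with
    | discarded hpos => exact .discarded (by omega)
    | halted h => exact .haltedX _ _ hj _ _ hookX h
    | ok s₂ hookZ detectX => exact .ok _ _ hj _ _ _ _ _ hookX detectX detectZ hookZ

end Cycles

section CycleSteps

variable {n₁ n₂ : ℕ} {s : CycleState n₁ n₂} {o : Outcome n₁ n₂}

theorem CycleStep.ne_discarded (h : CycleStep 0 s o) : o ≠ .discarded := by
  rintro rfl
  obtain ⟨h⟩ := h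
  exact lt_irrefl 0 h

variable [EvenLength n₁] [EvenLength n₂]

theorem CycleStep.errorFree_of_genWeightLeOne (h : CycleStep 0 s o) (hs : s.GenWeightLeOne)
    (ha : s.Allowed) : ∃ s', o = .ok s' ∧ s'.ErrorFree := by
  cases h with
  | discarded hk => exact absurd hk (lt_irrefl 0)
  | haltedZ h => exact absurd h (not_detectHalt_of_leOne (hs .Z) (ha .Z))
  | haltedX j₁ j₂ hj e m hook h =>
    obtain ⟨rfl, rfl⟩ := Nat.add_eq_zero_iff.1 (Nat.le_zero.1 hj)
    exact absurd h (not_detectHalt_of_leOne (hook.leOne (hs .X)) (hook.isAllowed (ha .X)))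
  | ok j₁ j₂ hj s' eX eZ mX mZ hookX detectX detectZ hookZ =>
    obtain ⟨rfl, rfl⟩ := Nat.add_eq_zero_iff.1 (Nat.le_zero.1 hj)
    refine ⟨s', rfl, ?_⟩
    rintro (_ | _)
    · exact detectX.isClean_of_leOne (hookX.leOne (hs .X))
    · exact hookZ.isClean (detectZ.isClean_of_leOne (hs .Z))

theorem CycleStep.eq_halted_of_genWeightTwo (h : CycleStep 0 s o) (hs : s.GenWeightTwo) :
    o = .halted := by
  cases h with
  | discarded hk => exact absurd hk (lt_irrefl 0)
  | haltedZ | haltedX => rfl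
  | ok j₁ j₂ hj s' eX eZ mX mZ hookX detectX detectZ hookZ =>
    obtain ⟨rfl, rfl⟩ := Nat.add_eq_zero_iff.1 (Nat.le_zero.1 hj)
    refine absurd ?_ hs.2
    rintro (_ | _)
    · exact hookX.leOne_of_leOne (detectX.leOne_of_leTwo (hookX.leTwo (hs.1 .X)))
    · exact detectZ.leOne_of_leTwo (hs.1 .Z)

theorem CycleStep.genWeightLeOne_of_errorFree (h : CycleStep 1 s o) (hd : o ≠ .discarded)
    (hs : s.ErrorFree) : ∃ s', o = .ok s' ∧ s'.GenWeightLeOne ∧ s'.Allowed := by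
  have hclean (a) : IsClean (s.err a) (s.mem a) := hs a
  cases h with
  | discarded => exact absurd rfl hd
  | haltedZ h => exact absurd h (not_detectHalt_of_isClean (hclean .Z))
  | haltedX j₁ j₂ hj e m hook h =>
    obtain rfl | ⟨hj₁, rfl⟩ : j₁ = 0 ∨ j₁ ≤ 1 ∧ j₂ = 0 := by omega
    · exact absurd (h.mono (by omega)) (not_detectHalt_of_isClean (hook.isClean (hclean .X)))
    · obtain ⟨hle, hallowed⟩ := (hook.mono hj₁).leOne_of_isClean (hclean .X)
      exact absurd h (not_detectHalt_of_leOne hle (.inl hallowed))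
  | ok j₁ j₂ hj s' eX eZ mX mZ hookX detectX detectZ hookZ =>
    suffices h : ∀ a, IsGenWeightLeOne (s'.err a) (s'.mem a).hookCols (s'.mem a).hookRows ∧
      IsAllowed (s'.err a) (s'.mem a) from ⟨s', rfl, fun a => (h a).1, fun a => (h a).2⟩
    obtain ⟨rfl, hj₂⟩ | ⟨hj₁, rfl⟩ : j₁ = 0 ∧ j₂ ≤ 1 ∨ j₁ ≤ 1 ∧ j₂ = 0 := by omega
    · rintro (_ | _)
      · exact (detectX.mono hj₂).leOne_of_isClean (hookX.isClean (hclean .X))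
      · have hZ := detectZ.isClean_of_leOne (hclean .Z).leOne
        exact ((hookZ.mono hj₂).leOne_of_isClean hZ).imp_right .inl
    · rintro (_ | _)
      · have hX := detectX.isClean_of_leOne ((hookX.mono hj₁).leOne_of_isClean (hclean .X)).1
        exact ⟨hX.leOne, hX.isAllowed⟩
      · obtain ⟨hle, hallowed⟩ := (detectZ.mono hj₁).leOne_of_isClean (hclean .Z)
        exact ⟨hookZ.leOne hle, hookZ.isAllowed hallowed⟩

theorem CycleStep.eq_halted_of_isDeferredPair (h : CycleStep 1 s o) (hd : o ≠ .discarded)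
    {a : Basis} (hs : IsDeferredPair (s.err a) (s.mem a)) : o = .halted := by
  cases h with
  | discarded => exact absurd rfl hd
  | haltedZ | haltedX => rfl
  | ok j₁ j₂ hj s' eX eZ mX mZ hookX detectX detectZ hookZ =>
    cases a with
    | X => exact absurd detectX (hs.not_detectStep hookX hj)
    | Z => exact absurd detectZ (hs.not_detectStep (.refl _ _) (by omega))

theorem CycleStep.genWeightLeOne_or_isDeferredPair (h : CycleStep 1 s o) (hd : o ≠ .discarded)
    (hs : s.GenWeightLeOne) :
    o = .halted ∨ ∃ s', o = .ok s' ∧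
      (s'.GenWeightLeOne ∨ ∃ a, IsDeferredPair (s'.err a) (s'.mem a)) := by
  cases h with
  | discarded => exact absurd rfl hd
  | haltedZ | haltedX => exact .inl rfl
  | ok j₁ j₂ hj s' eX eZ mX mZ hookX detectX detectZ hookZ =>
    suffices h : ∀ a, IsGenWeightLeOne (s'.err a) (s'.mem a).hookCols (s'.mem a).hookRows ∨
        IsDeferredPair (s'.err a) (s'.mem a) from
      .inr ⟨s', rfl, or_iff_not_imp_right.2 fun hne a => (h a).resolve_right fun ha => hne ⟨a, ha⟩⟩
    obtain ⟨rfl, hj₂⟩ | ⟨hj₁, rfl⟩ : j₁ = 0 ∧ j₂ ≤ 1 ∨ j₁ ≤ 1 ∧ j₂ = 0 := by omega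
    · rintro (_ | _)
      · exact (detectX.mono hj₂).leOne_or_isDeferredPair (hookX.leOne (hs .X))
      · have hZ := detectZ.isClean_of_leOne (hs .Z)
        exact .inl ((hookZ.mono hj₂).leOne_of_isClean hZ).1
    · rintro (_ | _)
      · have hX := detectX.isClean_of_leTwo ((hookX.mono hj₁).leTwo_of_leOne (hs .X))
        exact .inl hX.leOne
      · exact ((detectZ.mono hj₁).leOne_or_isDeferredPair (hs .Z)).imp hookZ.leOne
          hookZ.isDeferredPair

theorem CycleStep.genWeightLeTwo_of_errorFree (h : CycleStep 2 s o) (hd : o ≠ .discarded)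
    (hs : s.ErrorFree) : o = .halted ∨ ∃ s', o = .ok s' ∧ s'.GenWeightLeTwo := by
  have hclean (a) : IsClean (s.err a) (s.mem a) := hs a
  cases h with
  | discarded => exact absurd rfl hd
  | haltedZ | haltedX => exact .inl rfl
  | ok j₁ j₂ hj s' eX eZ mX mZ hookX detectX detectZ hookZ =>
    refine .inr ⟨s', rfl, ?_⟩
    obtain ⟨rfl, hj₂⟩ | ⟨hj₁, hj₂⟩ | ⟨hj₁, rfl⟩ :
      j₁ = 0 ∧ j₂ ≤ 2 ∨ j₁ ≤ 1 ∧ j₂ ≤ 1 ∨ j₁ ≤ 2 ∧ j₂ = 0 := by omega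
    · rintro (_ | _)
      · exact (detectX.mono hj₂).leTwo_of_isClean (hookX.isClean (hclean .X))
      · have hZ := detectZ.isClean_of_leOne (hclean .Z).leOne
        exact (hookZ.mono hj₂).leTwo_of_isClean (EvenLength.pos n₁) hZ
    · rintro (_ | _)
      · have hX := ((hookX.mono hj₁).leOne_of_isClean (hclean .X)).1
        exact ((detectX.mono hj₂).leOne_or_isDeferredPair hX).elim IsGenWeightLeOne.leTwo
          IsDeferredPair.leTwo
      · have hZ := ((detectZ.mono hj₁).leOne_of_isClean (hclean .Z)).1
        exact (hookZ.mono hj₂).leTwo_of_leOne hZ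
    · rintro (_ | _)
      · have hX := (hookX.mono hj₁).leTwo_of_isClean (EvenLength.pos n₁) (hclean .X)
        exact (detectX.isClean_of_leTwo hX).leOne.leTwo
      · exact hookZ.leTwo ((detectZ.mono hj₁).leTwo_of_isClean (hclean .Z))

end CycleSteps

end Iceberg

theorem proposition1 (k₁ k₂ : ℕ) (hk₁ : Even k₁) (hk₁pos : 0 < k₁)
    (hk₂ : Even k₂) (hk₂pos : 0 < k₂) :
    -- no fault
    (∀ (s : Iceberg.CycleState (k₁ + 2) (k₂ + 2)) (ρ : Iceberg.CycleRun (k₁ + 2) (k₂ + 2)),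
      Iceberg.IsCycle 0 ρ →
        (s.GenWeightLeOne → s.Allowed →
          ∃ s', Iceberg.cycle ρ s = .ok s' ∧ s'.ErrorFree) ∧
        (s.GenWeightTwo → Iceberg.cycle ρ s = .halted)) ∧
    -- one fault, error-free input
    (∀ (s : Iceberg.CycleState (k₁ + 2) (k₂ + 2)) (ρ : Iceberg.CycleRun (k₁ + 2) (k₂ + 2)),
      Iceberg.IsCycle 1 ρ → Iceberg.cycle ρ s ≠ .discarded → s.ErrorFree →
        ∃ s', Iceberg.cycle ρ s = .ok s' ∧ s'.GenWeightLeOne ∧ s'.Allowed) ∧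
    -- one fault, input of generalized weight one
    (∀ (s : Iceberg.CycleState (k₁ + 2) (k₂ + 2)) (ρ : Iceberg.CycleRun (k₁ + 2) (k₂ + 2)),
      Iceberg.IsCycle 1 ρ → Iceberg.cycle ρ s ≠ .discarded → s.GenWeightLeOne →
        Iceberg.cycle ρ s = .halted ∨
        ∃ s', Iceberg.cycle ρ s = .ok s' ∧
          (s'.GenWeightLeOne ∨
            ∀ ρ' : Iceberg.CycleRun (k₁ + 2) (k₂ + 2),
              (Iceberg.IsCycle 0 ρ' → Iceberg.cycle ρ' s' = .halted) ∧
              (Iceberg.IsCycle 1 ρ' → Iceberg.cycle ρ' s' ≠ .discarded →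
                Iceberg.cycle ρ' s' = .halted))) ∧
    -- two faults, error-free input
    (∀ (s : Iceberg.CycleState (k₁ + 2) (k₂ + 2)) (ρ : Iceberg.CycleRun (k₁ + 2) (k₂ + 2)),
      Iceberg.IsCycle 2 ρ → Iceberg.cycle ρ s ≠ .discarded → s.ErrorFree →
        Iceberg.cycle ρ s = .halted ∨
        ∃ s', Iceberg.cycle ρ s = .ok s' ∧ s'.GenWeightLeTwo) := by
  have : Iceberg.EvenLength (k₁ + 2) := ⟨hk₁.add even_two, by obtain ⟨r, rfl⟩ := hk₁; omega⟩
  have : Iceberg.EvenLength (k₂ + 2) := ⟨hk₂.add even_two, by obtain ⟨r, rfl⟩ := hk₂; omega⟩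
  refine ⟨fun s ρ hρ => ?_,
    fun s ρ hρ => (Iceberg.cycleStep_cycle hρ s).genWeightLeOne_of_errorFree,
    fun s ρ hρ hd hs => ?_,
    fun s ρ hρ => (Iceberg.cycleStep_cycle hρ s).genWeightLeTwo_of_errorFree⟩
  · have hstep := Iceberg.cycleStep_cycle hρ s
    exact ⟨hstep.errorFree_of_genWeightLeOne, hstep.eq_halted_of_genWeightTwo⟩
  · have hstep := Iceberg.cycleStep_cycle hρ s
    refine (hstep.genWeightLeOne_or_isDeferredPair hd hs).imp_right ?_
    rintro ⟨s', hok, hle | ⟨a, hpair⟩⟩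
    · exact ⟨s', hok, .inl hle⟩
    · have hnext {ρ'} (hρ' : Iceberg.IsCycle 1 ρ') (hd' : Iceberg.cycle ρ' s' ≠ .discarded) :
          Iceberg.cycle ρ' s' = .halted :=
        (Iceberg.cycleStep_cycle hρ' s').eq_halted_of_isDeferredPair hd' hpair
      exact ⟨s', hok, .inr fun ρ' => ⟨fun hρ' => hnext ⟨hρ'.1, hρ'.2.1, hρ'.2.2.trans zero_le_one⟩
        (Iceberg.cycleStep_cycle hρ' s').ne_discarded, hnext⟩⟩
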